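/- Let $N\ge 1$ be an integer and $\ell\nmid N$ a prime. Let $T_\ell$ be the Hecke correspondence on the complex modular curve $X_0(N)=\Gamma_0(N)\backslash(\mathbb H\cup\mathbb P^1(\mathbb Q))$, given by the two maps $\pi_1,\pi_2:X_0(N\ell)\to X_0(N)$ induced by $z\mapsto z$ and $z\mapsto \ell z$, that is, $(E,C_N,C_\ell)\mapsto(E,C_N)$ and $(E,C_N,C_\ell)\mapsto(E/C_\ell,(C_N+C_\ell)/C_\ell)$. Let $F_{T_\ell}$ be its fixed-point divisor on $X_0(N)$, i.e. the intersection of the graph $(\pi_1,\pi_2)(X_0(N\ell))\subset X_0(N)^2$ with the diagonal, counted with intersection multiplicity. For a non-cuspidal point $x=(E,C_N)$, let its order $\mathcal O_x$ be the ring of endomorphisms of $E$ that map $C_N$ to itself. For $d\ge 1$ let $D_d$ be the sum, with multiplicity $1$, of the non-cuspidal points whose order is a quadratic order of discriminant $-d$ ($D_d=0$ if there are none), and let $D_\infty$ be the sum of all cusps of $X_0(N)$. 1. (Transversality) Every branch of the graph through a point $P\in X_0(N\ell)$ with $\pi_1(P)=\pi_2(P)$ meets the diagonal with local intersection number $1$.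 2. (Support and multiplicities) $F_{T_\ell}$ is a divisor, i.e. has finite support and finite multiplicities. A non-cuspidal point $x$ lies in its support if and only if $\mathcal O_x$ contains an element of norm $\ell$. In that case $E$ has complex multiplication, $\mathcal O_x$ has an ideal $I$ with $\mathcal O_x/I\cong\mathbb Z/N$, and the multiplicity of $x$ in $F_{T_\ell}$ is the number of prime ideals of $\mathcal O_x$ above $\ell$, which is also the number of prime ideals of $\operatorname{End}(E)$ above $\ell$. Every cusp in the support has multiplicity $2$. The cusp $a/d$, with $d\mid N$ and $\gcd(a,d)=1$, lies in the support if and only if $\ell\equiv 1 \pmod{\gcd(d,N/d)}$. In particular, if $N$ is squarefree, every cusp of $X_0(N)$ has multiplicity $2$ in $F_{T_\ell}$. 3. (The case $\ell=2$, $N$ odd) If $N$ is squarefree, then $F_{T_2}=D_4+D_8+2D_7+2D_\infty$. For an arbitrary odd $N$ the same formula holds with $D_\infty$ replaced by the sum of those cusps $a/d$ (with $d\mid N$, $\gcd(a,d)=1$) for which $\gcd(d,N/d)=1$. -/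

import Mathlib

open scoped MatrixGroups UpperHalfPlane OnePoint

namespace ModularHecke

noncomputable section

/-! ### The modular curve `X₀(N)` over the complex numbers -/

/-- The extended upper half plane `ℍ ∪ ℙ¹(ℚ)`. -/
def ExtH : Type := ℍ ⊕ OnePoint ℚ

/-- `GL₂(ℚ)` acts by Möbius transformations on `ℍ` and on `ℙ¹(ℚ)`. -/
instance : MulAction (GL (Fin 2) ℚ) ExtH where
  smul g x := Sum.map (fun τ : ℍ => g.map (algebraMap ℚ ℝ) • τ) (fun s : OnePoint ℚ => g • s) x
  one_smul x := by
    change Sum.map _ _ x = x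
    rcases x with x | x <;> simp
  mul_smul g h x := by
    change Sum.map _ _ x = Sum.map _ _ (Sum.map _ _ x)
    rcases x with x | x <;> simp [mul_smul]

/-- `Γ₀(N)`, viewed inside `GL₂(ℚ)`. -/
def gamma0Q (N : ℕ) : Subgroup (GL (Fin 2) ℚ) :=
  (CongruenceSubgroup.Gamma0 N).map (Matrix.SpecialLinearGroup.mapGL ℚ)

/-- The points of the compact modular curve `X₀(N)(ℂ) = Γ₀(N) \ (ℍ ∪ ℙ¹(ℚ))`. Its structure of a
Riemann surface is recorded by the local coordinates `localCoord` below. -/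
def X0 (N : ℕ) : Type := MulAction.orbitRel.Quotient (gamma0Q N) ExtH

/-- The class in `X₀(N)` of a point of the extended upper half plane. -/
def X0.mk (N : ℕ) (x : ExtH) : X0 N := Quotient.mk _ x

/-- The non-cuspidal point of `X₀(N)` given by `τ ∈ ℍ`: the pair consisting of the elliptic curve
`ℂ / (ℤ + ℤτ)` and its cyclic subgroup of order `N` generated by `1 / N`. -/
def X0.pt (N : ℕ) (τ : ℍ) : X0 N := X0.mk N (Sum.inl τ)

/-- The cusp of `X₀(N)` given by `s ∈ ℙ¹(ℚ)`. -/
def X0.cusp (N : ℕ) (s : OnePoint ℚ) : X0 N := X0.mk N (Sum.inr s)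

/-- A representative in the extended upper half plane of a point of `X₀(N)`. -/
def X0.rep {N : ℕ} (P : X0 N) : ExtH := Quotient.out P

/-- For `s ∈ ℙ¹(ℚ)`, an element `γ` of `SL₂(ℤ)` with `γ ∞ = s`. -/
def cuspMatrix (s : OnePoint ℚ) : SL(2, ℤ) :=
  Classical.choose (OnePoint.exists_mem_SL2 ℤ s)

lemma cuspMatrix_spec (s : OnePoint ℚ) :
    Matrix.SpecialLinearGroup.mapGL ℚ (cuspMatrix s) • (∞ : OnePoint ℚ) = s :=
  Classical.choose_spec (OnePoint.exists_mem_SL2 ℤ s)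

/-- The trace on `ℍ` of the filter of neighbourhoods of a point of `ℍ ∪ ℙ¹(ℚ)`: the usual one at
a point of `ℍ`; at a cusp `s = γ ∞`, the one generated by the horoballs `γ {Im z > A}`. -/
def nhdsExt : ExtH → Filter ℍ
  | Sum.inl τ => nhds τ
  | Sum.inr s => Filter.map (fun z : ℍ => cuspMatrix s • z) UpperHalfPlane.atImInfty

/-- The order of the stabiliser of `τ` in `Γ₀(M) / {±1}`. -/
def ellipticOrder (M : ℕ) (τ : ℍ) : ℕ :=
  Nat.card (MulAction.stabilizer (CongruenceSubgroup.Gamma0 M) τ) / 2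

/-- The width of the cusp `s = γ ∞` for `Γ₀(M)`: the least `h > 0` with `γ Tʰ γ⁻¹ ∈ Γ₀(M)`. -/
def cuspWidth (M : ℕ) (s : OnePoint ℚ) : ℕ :=
  sInf {h : ℕ | 0 < h ∧
    cuspMatrix s * ModularGroup.T ^ h * (cuspMatrix s)⁻¹ ∈ CongruenceSubgroup.Gamma0 M}

/-- The standard local coordinate of the Riemann surface `X₀(M)`, centred at the class of `x`
and pulled back to the part of `ℍ` near `x`: it is `((z - τ) / (z - τ̄)) ^ e` at `x = τ ∈ ℍ`, with
`e` the order of the stabiliser of `τ` in `Γ₀(M) / {±1}`, and `exp (2 π i γ⁻¹ z / h)` at a cusp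
`x = γ ∞` of width `h`. -/
def localCoord (M : ℕ) (x : ExtH) (z : ℍ) : ℂ :=
  match x with
  | Sum.inl τ =>
      (((z : ℂ) - (τ : ℂ)) / ((z : ℂ) - (starRingEnd ℂ) (τ : ℂ))) ^ ellipticOrder M τ
  | Sum.inr s =>
      Complex.exp (2 * Real.pi * Complex.I * (((cuspMatrix s)⁻¹ • z : ℍ) : ℂ) / cuspWidth M s)

/-- The order of vanishing, at the class of `x` on `X₀(M)`, of a holomorphic function defined near
that point (given by its pull-back `f` to `ℍ`): the largest `m` such that `f = O(tᵐ)` near `x`,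
where `t` is the local coordinate of `X₀(M)` there. -/
def ordAt (M : ℕ) (x : ExtH) (f : ℍ → ℂ) : ℕ∞ :=
  ⨆ (m : ℕ) (_ : f =O[nhdsExt x] fun z => localCoord M x z ^ m), (m : ℕ∞)

/-! ### The Hecke correspondence `T_ℓ` and its fixed point divisor -/

/-- The matrix of `z ↦ ℓ z`. -/
def mulMat (l : ℕ) [NeZero l] : GL (Fin 2) ℚ :=
  Matrix.GeneralLinearGroup.mkOfDetNeZero !![(l : ℚ), 0; 0, 1] (by simp [NeZero.ne])

lemma gamma0Q_mul_le (N l : ℕ) : gamma0Q (N * l) ≤ gamma0Q N := by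
  refine Subgroup.map_mono fun γ hγ => ?_
  rw [CongruenceSubgroup.Gamma0_mem, ZMod.intCast_zmod_eq_zero_iff_dvd] at hγ ⊢
  exact (Dvd.intro _ (by push_cast; rfl)).trans hγ

lemma mulMat_conj (N l : ℕ) [NeZero l] {g : GL (Fin 2) ℚ} (hg : g ∈ gamma0Q (N * l)) :
    mulMat l * g * (mulMat l)⁻¹ ∈ gamma0Q N := by
  obtain ⟨γ, hγ, rfl⟩ := hg
  have hγ' : γ ∈ CongruenceSubgroup.Gamma0 (N * l) := hγ
  rw [CongruenceSubgroup.Gamma0_mem, ZMod.intCast_zmod_eq_zero_iff_dvd] at hγ'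
  obtain ⟨k, hk⟩ := hγ'
  have hdet := γ.det_coe
  rw [Matrix.det_fin_two, hk] at hdet
  have hdet' : (!![γ 0 0, (l : ℤ) * γ 0 1; (N : ℤ) * k, γ 1 1]).det = 1 := by
    rw [Matrix.det_fin_two_of]
    push_cast at hdet
    linarith
  let γ' : SL(2, ℤ) := ⟨_, hdet'⟩
  have h00 : γ' 0 0 = γ 0 0 := rfl
  have h01 : γ' 0 1 = l * γ 0 1 := rfl
  have h10 : γ' 1 0 = N * k := rfl
  have h11 : γ' 1 1 = γ 1 1 := rfl
  have hmem : γ' ∈ CongruenceSubgroup.Gamma0 N := by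
    rw [CongruenceSubgroup.Gamma0_mem, h10]
    simp
  refine ⟨γ', hmem, ?_⟩
  clear_value γ'
  rw [eq_mul_inv_iff_mul_eq]
  ext i j
  fin_cases i <;> fin_cases j <;>
    simp [mulMat, Matrix.GeneralLinearGroup.mkOfDetNeZero, Matrix.mul_apply, Fin.sum_univ_two,
      hk, Matrix.GeneralLinearGroup.mk', Matrix.unitOfDetInvertible, h00, h01, h10, h11,
      mul_assoc, mul_comm, mul_left_comm]

/-- The forgetful map `X₀(Nℓ) → X₀(N)`, induced by `z ↦ z`. -/
def proj₁ (N l : ℕ) : X0 (N * l) → X0 N :=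
  Quotient.map id (by
    rintro _ y ⟨⟨g, hg⟩, rfl⟩
    exact ⟨⟨g, gamma0Q_mul_le N l hg⟩, rfl⟩)

/-- The second projection `X₀(Nℓ) → X₀(N)` of the correspondence `T_ℓ`, induced by `z ↦ ℓ z`, that
is `(E, C_N, C_ℓ) ↦ (E / C_ℓ, (C_N + C_ℓ) / C_ℓ)`. For a prime `ℓ ∤ N` it is the forgetful map
composed with the Atkin-Lehner involution `w_ℓ` of `X₀(Nℓ)`. -/
def proj₂ (N l : ℕ) [NeZero l] : X0 (N * l) → X0 N :=
  Quotient.map (fun x => mulMat l • x) (by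
    rintro _ y ⟨⟨g, hg⟩, rfl⟩
    refine ⟨⟨_, mulMat_conj N l hg⟩, ?_⟩
    change (mulMat l * g * (mulMat l)⁻¹) • mulMat l • y = mulMat l • g • y
    simp [mul_smul])

/-- The local intersection number with the diagonal of the branch of the graph of `T_ℓ` (the image
of `(proj₁, proj₂) : X₀(Nℓ) → X₀(N) × X₀(N)`) through the point `P` of `X₀(Nℓ)`. If both
projections of `P` agree, so that `δ (ℓ x) = x` for a representative `x` of `P` and some
`δ ∈ Γ₀(N)`, it is the order of vanishing at `P` of `t ∘ proj₁ - t ∘ proj₂`, the pull-back of the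
local equation `t ⊗ 1 - 1 ⊗ t` of the diagonal, where `t` is the local coordinate of `X₀(N)` at
`x`. It is `0` if the two projections of `P` differ. -/
def branchIndex (N l : ℕ) [NeZero l] (P : X0 (N * l)) : ℕ∞ :=
  ⨆ (δ : SL(2, ℤ)) (_ : δ ∈ CongruenceSubgroup.Gamma0 N)
    (_ : Matrix.SpecialLinearGroup.mapGL ℚ δ • mulMat l • P.rep = P.rep),
    ordAt (N * l) P.rep fun z : ℍ =>
      localCoord N P.rep z -
        localCoord N P.rep (δ • ((mulMat l).map (algebraMap ℚ ℝ) • z))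

/-- The multiplicity of `x ∈ X₀(N)` in the fixed point divisor of `T_ℓ`, that is the intersection
multiplicity at `(x, x)` of the graph of `T_ℓ` with the diagonal: the sum of the contributions of
the finitely many branches of the graph, one for each point of `X₀(Nℓ)` above `x`. -/
def fixMult (N l : ℕ) [NeZero l] (x : X0 N) : ℕ∞ :=
  ∑ᶠ (P : X0 (N * l)) (_ : proj₁ N l P = x), branchIndex N l P

/-! ### Complex multiplication -/

/-- The multiplier ring `{α ∈ ℂ | α L ⊆ L}` of `L`. -/
def multiplierRing (L : AddSubgroup ℂ) : Subring ℂ where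
  carrier := {α | ∀ x ∈ L, α * x ∈ L}
  mul_mem' ha hb x hx := by rw [mul_assoc]; exact ha _ (hb _ hx)
  one_mem' x hx := by rwa [one_mul]
  add_mem' ha hb x hx := by rw [add_mul]; exact L.add_mem (ha _ hx) (hb _ hx)
  zero_mem' x _ := by rw [zero_mul]; exact L.zero_mem
  neg_mem' ha x hx := by rw [neg_mul]; exact L.neg_mem (ha _ hx)

/-- The endomorphism ring of the elliptic curve `E_τ = ℂ / (ℤ + ℤτ)`. -/
def curveOrder (τ : ℍ) : Subring ℂ :=
  multiplierRing (AddSubgroup.closure {1, (τ : ℂ)})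

/-- The endomorphism ring of the pair `(E_τ, C_N)`, i.e. the ring of all endomorphisms of
`E_τ = ℂ / (ℤ + ℤτ)` that map the subgroup `C_N = (ℤ (1 / N) + ℤτ) / (ℤ + ℤτ)` to itself. -/
def pointOrder (N : ℕ) (τ : ℍ) : Subring ℂ :=
  curveOrder τ ⊓ multiplierRing (AddSubgroup.closure {1 / (N : ℂ), (τ : ℂ)})

/-- `E_τ` has complex multiplication: it has more endomorphisms than the integers. -/
def IsCM (τ : ℍ) : Prop := curveOrder τ ≠ ⊥

/-- `R` is a quadratic order of discriminant `D`. -/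
def HasDiscr (R : Subring ℂ) (D : ℤ) : Prop :=
  ∃ b : Module.Basis (Fin 2) ℤ R, Algebra.discr ℤ b = D

/-- The number of prime ideals of `R` above the prime number `ℓ`. -/
def numPrimesAbove (R : Subring ℂ) (l : ℕ) : ℕ :=
  Set.ncard {p : Ideal R | p.IsPrime ∧ (l : R) ∈ p}

/-! ### Some divisors -/

/-- The divisor `D_d`: the points of `X₀(N)` with complex multiplication by an order of
discriminant `-d`, each with multiplicity `1`. -/
def cmDivisor (N d : ℕ) : X0 N → ℕ :=
  Set.indicator {x | ∃ τ : ℍ, x = X0.pt N τ ∧ HasDiscr (pointOrder N τ) (-(d : ℤ))} 1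

/-- The cuspidal divisor `D_∞`: all cusps of `X₀(N)`, each with multiplicity `1`. -/
def cuspDivisor (N : ℕ) : X0 N → ℕ :=
  Set.indicator (Set.range (X0.cusp N)) 1

/-- The cusps of `X₀(N)` of the form `a / d` with `d ∣ N`, `gcd (a, d) = 1` and
`gcd (d, N / d) = 1`, each with multiplicity `1`. -/
def unitaryCuspDivisor (N : ℕ) : X0 N → ℕ :=
  Set.indicator {x | ∃ (a : ℤ) (d : ℕ), d ∣ N ∧ IsCoprime a (d : ℤ) ∧ d.Coprime (N / d) ∧
    x = X0.cusp N (((a : ℚ) / (d : ℚ) : ℚ) : OnePoint ℚ)} 1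

end

end ModularHecke

open ModularHecke

namespace ModularHecke

noncomputable section

/-! Write m = diag(ℓ, 1). The branches of the graph through (x, x), where x is the class of y, are
counted by matrices. Since ℓ ∤ N, every integral matrix of determinant ℓ with lower left entry
divisible by N lies in Γ₀(N) m Γ₀(N) (`exists_eq_mul_mulMat_mul`). Moreover Γ₀(Nℓ) = Γ₀(N) ∩ m⁻¹
Γ₀(N) m. Hence sending g = δ m γ to the class of γ y identifies the branches with the matrices g
fixing y, modulo the stabiliser of y in Γ₀(N) on both sides (`fixSet_ncard`).

At y = τ in ℍ, a matrix fixing τ has the eigenvector (τ, 1), and its eigenvalue α is an element of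
the order whose norm is the determinant. The stabiliser becomes the unit group, so the branches
correspond to the principal ideals generated by elements of norm ℓ (`autIdeal_eq_iff`). Such an
ideal is maximal, and ℓ = α ᾱ shows that (α) and (ᾱ) are all the primes above ℓ. They coincide
exactly when ℓ divides the trace of α, a condition that is the same for the order of the pair and
for that of the curve.

At a cusp, conjugation to ∞ makes the matrix upper triangular with diagonal ±(ℓ, 1) or ±(1, ℓ).
These two types are the double cosets (`isExpanding_eq_iff`) and the adjugate exchanges them, so the
count is 0 or 2. Which of the two occurs is decided by a linear congruence
(`fixers_cusp_div_nonempty_iff`).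

Each branch counts once. At τ the disc coordinate is multiplied by ζ = ᾱ/α, so the equation of the
diagonal pulls back to (1 - ζᵉ) t, where e is the elliptic order; ζᵉ = 1 would produce an integer of
norm ℓ (`pow_ellipticOrder_ne_one`). At a cusp the pull-back is q - c q^ℓ or q^ℓ - c q with c ≠ 0
(`ordAt_ratPoint`). The support is finite because an equation |cτ + d|² = ℓ has finitely many
solutions in the fundamental domain that come from complex multiplication. For ℓ = 2, a norm
equation leaves only the discriminants -4, -7 and -8. -/

/-! ### Integral matrices of determinant ℓ and the double coset of diag(ℓ, 1) -/

/-- The elements of `GL₂(ℚ)` with integral entries, of determinant `n`, and with lower left entry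
divisible by `N`. -/
def heckeSet (N : ℕ) (n : ℤ) : Set (GL (Fin 2) ℚ) :=
  {g | ∃ A : Matrix (Fin 2) (Fin 2) ℤ, A.det = n ∧ (N : ℤ) ∣ A 1 0 ∧
    (g : Matrix (Fin 2) (Fin 2) ℚ) = A.map (Int.cast : ℤ → ℚ)}

lemma mem_gamma0_iff_dvd {N : ℕ} {γ : SL(2, ℤ)} :
    γ ∈ CongruenceSubgroup.Gamma0 N ↔ (N : ℤ) ∣ γ 1 0 := by
  rw [CongruenceSubgroup.Gamma0_mem, ZMod.intCast_zmod_eq_zero_iff_dvd]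

lemma coe_mapGL_rat (γ : SL(2, ℤ)) :
    ((Matrix.SpecialLinearGroup.mapGL ℚ γ : GL (Fin 2) ℚ) : Matrix (Fin 2) (Fin 2) ℚ) =
      (γ : Matrix (Fin 2) (Fin 2) ℤ).map (Int.cast : ℤ → ℚ) := by
  ext i j
  simp

lemma mem_gamma0Q {N : ℕ} {g : GL (Fin 2) ℚ} : g ∈ gamma0Q N ↔ g ∈ heckeSet N 1 := by
  constructor
  · rintro ⟨γ, hγ, rfl⟩
    exact ⟨γ, γ.det_coe, mem_gamma0_iff_dvd.1 hγ, coe_mapGL_rat γ⟩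
  · rintro ⟨A, hA, hN, hg⟩
    refine ⟨⟨A, hA⟩, mem_gamma0_iff_dvd.2 hN, ?_⟩
    exact Units.ext ((coe_mapGL_rat _).trans hg.symm)

lemma mapGL_mem_gamma0Q {N : ℕ} {γ : SL(2, ℤ)} :
    Matrix.SpecialLinearGroup.mapGL ℚ γ ∈ gamma0Q N ↔ γ ∈ CongruenceSubgroup.Gamma0 N := by
  constructor
  · rintro ⟨γ', hγ', h⟩
    rwa [← Matrix.SpecialLinearGroup.mapGL_injective h]
  · exact fun h => ⟨γ, h, rfl⟩

lemma mul_mem_heckeSet {N : ℕ} {n m : ℤ} {g h : GL (Fin 2) ℚ} (hg : g ∈ heckeSet N n)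
    (hh : h ∈ heckeSet N m) : g * h ∈ heckeSet N (n * m) := by
  obtain ⟨A, hA, hAN, hgA⟩ := hg
  obtain ⟨B, hB, hBN, hhB⟩ := hh
  refine ⟨A * B, by rw [Matrix.det_mul, hA, hB], ?_, ?_⟩
  · rw [Matrix.mul_apply, Fin.sum_univ_two]
    exact dvd_add (hAN.mul_right _) (hBN.mul_left _)
  · rw [Units.val_mul, hgA, hhB]
    exact (Matrix.map_mul (f := Int.castRingHom ℚ)).symm

lemma coe_mulMat (l : ℕ) [NeZero l] :
    (mulMat l : Matrix (Fin 2) (Fin 2) ℚ) = !![(l : ℚ), 0; 0, 1] := rfl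

lemma mulMat_mem_heckeSet (N l : ℕ) [NeZero l] : mulMat l ∈ heckeSet N l := by
  refine ⟨!![(l : ℤ), 0; 0, 1], by simp, by simp, ?_⟩
  rw [coe_mulMat]
  ext i j
  fin_cases i <;> fin_cases j <;> simp

/-- Conjugation by diag(ℓ, 1) divides the lower left entry by ℓ. This criterion decides when two
Γ₀(N)-translates of a point agree in X₀(Nℓ). -/
lemma mem_gamma0Q_mul_iff {N l : ℕ} [NeZero l] {g : GL (Fin 2) ℚ} :
    g ∈ gamma0Q (N * l) ↔ g ∈ gamma0Q N ∧ mulMat l * g * (mulMat l)⁻¹ ∈ gamma0Q N := by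
  refine ⟨fun h => ⟨gamma0Q_mul_le N l h, mulMat_conj N l h⟩, ?_⟩
  rintro ⟨h₁, h₂⟩
  rw [mem_gamma0Q] at h₁ h₂ ⊢
  obtain ⟨A, hA, -, hgA⟩ := h₁
  obtain ⟨B, -, ⟨k, hk⟩, hgB⟩ := h₂
  refine ⟨A, hA, ⟨k, ?_⟩, hgA⟩
  have h : (mulMat l * g : GL (Fin 2) ℚ).1 = B.map (Int.cast : ℤ → ℚ) * (mulMat l).1 := by
    rw [← hgB, ← Units.val_mul, inv_mul_cancel_right]
  have h10 := congrFun₂ h 1 0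
  rw [Units.val_mul, coe_mulMat, hgA] at h10
  simp [Matrix.mul_apply, Fin.sum_univ_two, hk] at h10
  push_cast
  have : (A 1 0 : ℚ) = ((N * l * k : ℤ) : ℚ) := by rw [h10]; push_cast; ring
  exact_mod_cast this

/-- Modulo N both `g` and `h` are upper triangular, and `h` is invertible there because ℓ ∤ N, so
the quotient is upper triangular modulo N. -/
lemma mem_gamma0Q_of_mul_eq {N l : ℕ} [Fact l.Prime] (hl : ¬ l ∣ N) {g h k : GL (Fin 2) ℚ}
    {A : Matrix (Fin 2) (Fin 2) ℤ} (hg : g ∈ heckeSet N l) (hh : h ∈ heckeSet N l)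
    (hk : (k : Matrix (Fin 2) (Fin 2) ℚ) = A.map (Int.cast : ℤ → ℚ)) (e : g = k * h) :
    k ∈ gamma0Q N := by
  obtain ⟨B, hB, hBN, hgB⟩ := hg
  obtain ⟨C, hC, hCN, hhC⟩ := hh
  have hl0 : (l : ℤ) ≠ 0 := by exact_mod_cast (Fact.out : l.Prime).ne_zero
  have hBC : B = A * C := by
    have : B.map (Int.cast : ℤ → ℚ) = (A * C).map (Int.cast : ℤ → ℚ) := by
      rw [← hgB, e, Units.val_mul, hk, hhC]
      exact (Matrix.map_mul (f := Int.castRingHom ℚ)).symm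
    exact Matrix.map_injective Int.cast_injective this
  rw [mem_gamma0Q]
  refine ⟨A, ?_, ?_, hk⟩
  · have := congrArg Matrix.det hBC
    rw [Matrix.det_mul, hB, hC] at this
    exact (mul_left_inj' hl0).1 (by rw [one_mul, ← this])
  · have h1 : B 1 0 = A 1 0 * C 0 0 + A 1 1 * C 1 0 := by
      rw [hBC, Matrix.mul_apply, Fin.sum_univ_two]
    have h2 : (N : ℤ) ∣ A 1 0 * C 0 0 := by
      rw [← dvd_add_left (hCN.mul_left (A 1 1)), ← h1]
      exact hBN
    have h3 : (N : ℤ) ∣ A 1 0 * l := by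
      rw [Matrix.det_fin_two] at hC
      have : A 1 0 * (l : ℤ) = (A 1 0 * C 0 0) * C 1 1 - (A 1 0 * C 0 1) * C 1 0 := by
        rw [← hC]; ring
      rw [this]
      exact dvd_sub (h2.mul_right _) (hCN.mul_left _)
    refine IsCoprime.dvd_of_dvd_mul_right ?_ h3
    exact Nat.isCoprime_iff_coprime.2 (((Nat.Prime.coprime_iff_not_dvd Fact.out).2 hl).symm)

/-- `A` is singular modulo ℓ, so it kills a line in 𝔽_ℓ². Because ℓ ∤ N, the first columns of
elements of Γ₀(N) represent every such line: (1, Nk) gives all lines but that of (0, 1), and (ℓ, N)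
gives that one. -/
lemma exists_first_column {N l : ℕ} [Fact l.Prime] (hl : ¬ l ∣ N) {A : Matrix (Fin 2) (Fin 2) ℤ}
    (hA : A.det = l) :
    ∃ γ : SL(2, ℤ), γ ∈ CongruenceSubgroup.Gamma0 N ∧
      (l : ℤ) ∣ A 0 0 * γ 0 0 + A 0 1 * γ 1 0 ∧ (l : ℤ) ∣ A 1 0 * γ 0 0 + A 1 1 * γ 1 0 := by
  have hp : l.Prime := Fact.out
  have hpi : Prime (l : ℤ) := Nat.prime_iff_prime_int.1 hp
  have hcop : IsCoprime (l : ℤ) (N : ℤ) :=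
    Nat.isCoprime_iff_coprime.2 ((Nat.Prime.coprime_iff_not_dvd hp).2 hl)
  rw [Matrix.det_fin_two] at hA
  have key : ∀ u : ℤ, ¬ (l : ℤ) ∣ u → ∃ w : ℤ, (l : ℤ) ∣ u * N * w - 1 := by
    intro u hu
    have : IsCoprime (l : ℤ) (u * N) :=
      IsCoprime.mul_right ((Prime.coprime_iff_not_dvd hpi).2 hu) hcop
    obtain ⟨s, t, hst⟩ := this
    exact ⟨t, -s, by linarith⟩
  have low : ∀ k : ℤ, ∃ γ : SL(2, ℤ), γ ∈ CongruenceSubgroup.Gamma0 N ∧ γ 0 0 = 1 ∧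
      γ 1 0 = N * k := fun k =>
    ⟨⟨!![1, 0; N * k, 1], by simp⟩, mem_gamma0_iff_dvd.2 ⟨k, rfl⟩, rfl, rfl⟩
  by_cases h : (l : ℤ) ∣ A 0 1 ∧ (l : ℤ) ∣ A 1 1
  · obtain ⟨s, t, hst⟩ := hcop
    refine ⟨⟨!![(l : ℤ), -t; N, s], by simp; linarith⟩, mem_gamma0_iff_dvd.2 ⟨1, ?_⟩, ?_, ?_⟩
    · simp
    · exact dvd_add (Dvd.intro_left _ rfl) (h.1.mul_right _)
    · exact dvd_add (Dvd.intro_left _ rfl) (h.2.mul_right _)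
  · by_cases h0 : (l : ℤ) ∣ A 0 1
    · have h1 : ¬ (l : ℤ) ∣ A 1 1 := fun h' => h ⟨h0, h'⟩
      obtain ⟨w, hw⟩ := key _ h1
      obtain ⟨γ, hγ, e0, e1⟩ := low (-(A 1 0 * w))
      refine ⟨γ, hγ, ?_, ?_⟩ <;> rw [e0, e1]
      · refine dvd_add ?_ (h0.mul_right _)
        rw [mul_one]
        refine (hpi.dvd_or_dvd (a := A 0 0) (b := A 1 1) ?_).resolve_right h1
        have : A 0 0 * A 1 1 = l + A 0 1 * A 1 0 := by linarith
        rw [this]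
        exact dvd_add dvd_rfl (h0.mul_right _)
      · have : A 1 0 * 1 + A 1 1 * (N * -(A 1 0 * w)) = -(A 1 0 * (A 1 1 * N * w - 1)) := by ring
        rw [this]
        exact (hw.mul_left _).neg_right
    · obtain ⟨w, hw⟩ := key _ h0
      obtain ⟨γ, hγ, e0, e1⟩ := low (-(A 0 0 * w))
      refine ⟨γ, hγ, ?_, ?_⟩ <;> rw [e0, e1]
      · have : A 0 0 * 1 + A 0 1 * (N * -(A 0 0 * w)) = -(A 0 0 * (A 0 1 * N * w - 1)) := by ring
        rw [this]
        exact (hw.mul_left _).neg_right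
      · refine (hpi.dvd_or_dvd (a := A 0 1) ?_).resolve_left h0
        have : A 0 1 * (A 1 0 * 1 + A 1 1 * (N * -(A 0 0 * w))) =
          -l - (A 0 0 * A 1 1) * (A 0 1 * N * w - 1) := by rw [← hA]; ring
        rw [this]
        exact dvd_sub (dvd_neg.2 dvd_rfl) (hw.mul_left _)

lemma exists_eq_mul_mulMat_mul {N l : ℕ} [NeZero l] [Fact l.Prime] (hl : ¬ l ∣ N)
    {g : GL (Fin 2) ℚ} (hg : g ∈ heckeSet N l) :
    ∃ δ ∈ gamma0Q N, ∃ γ ∈ gamma0Q N, g = δ * mulMat l * γ := by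
  have hg' := hg
  obtain ⟨A, hA, -, hgA⟩ := hg
  obtain ⟨γ, hγ, ⟨p, hp⟩, ⟨q, hq⟩⟩ := exists_first_column hl hA
  set γQ := Matrix.SpecialLinearGroup.mapGL ℚ γ with hγQ
  have hmem : γQ ∈ gamma0Q N := mapGL_mem_gamma0Q.2 hγ
  -- Right division by diag(ℓ, 1) divides the first column by ℓ, which `γ` has made possible.
  refine ⟨g * γQ * (mulMat l)⁻¹, ?_, γQ⁻¹, inv_mem hmem, by group⟩
  have hlQ : (l : ℚ) ≠ 0 := NeZero.ne _
  refine mem_gamma0Q_of_mul_eq hl (A := !![p, A 0 0 * γ 0 1 + A 0 1 * γ 1 1;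
    q, A 1 0 * γ 0 1 + A 1 1 * γ 1 1]) (g := g * γQ) (h := mulMat l) ?_
    (mulMat_mem_heckeSet N l) ?_ (by group)
  · simpa using mul_mem_heckeSet hg' (mem_gamma0Q.1 hmem)
  · have hval : (g * γQ).1 = !![(p : ℚ), A 0 0 * γ 0 1 + A 0 1 * γ 1 1;
        q, A 1 0 * γ 0 1 + A 1 1 * γ 1 1] * (mulMat l).1 := by
      rw [Units.val_mul, hgA, hγQ, coe_mapGL_rat, coe_mulMat]
      have hp' : (A 0 0 * γ 0 0 + A 0 1 * γ 1 0 : ℚ) = l * p := by exact_mod_cast hp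
      have hq' : (A 1 0 * γ 0 0 + A 1 1 * γ 1 0 : ℚ) = l * q := by exact_mod_cast hq
      ext i j
      fin_cases i <;> fin_cases j <;>
        simp [Matrix.mul_apply, Fin.sum_univ_two, hp', hq', mul_comm]
    rw [Units.val_mul, hval, Matrix.mul_assoc, ← Units.val_mul, mul_inv_cancel, Units.val_one,
      Matrix.mul_one]
    ext i j
    fin_cases i <;> fin_cases j <;> simp

/-! ### Fixed points of the correspondence -/

lemma X0.mk_eq_mk {N : ℕ} {x y : ExtH} :
    X0.mk N x = X0.mk N y ↔ ∃ g ∈ gamma0Q N, g • x = y := by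
  rw [eq_comm]
  refine Quotient.eq.trans ?_
  constructor
  · rintro ⟨⟨g, hg⟩, h⟩
    exact ⟨g, hg, h⟩
  · rintro ⟨g, hg, h⟩
    exact ⟨⟨g, hg⟩, h⟩

lemma X0.mk_rep {N : ℕ} (P : X0 N) : X0.mk N P.rep = P := Quotient.out_eq P

lemma proj₁_mk (N l : ℕ) (x : ExtH) : proj₁ N l (X0.mk (N * l) x) = X0.mk N x := rfl

lemma proj₂_mk (N l : ℕ) [NeZero l] (x : ExtH) :
    proj₂ N l (X0.mk (N * l) x) = X0.mk N (mulMat l • x) := rfl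

/-- The points of the graph of `T_ℓ` that lie above the point `(x, x)` of the diagonal. -/
def fixSet (N l : ℕ) [NeZero l] (x : X0 N) : Set (X0 (N * l)) :=
  {P | proj₁ N l P = x ∧ proj₂ N l P = x}

/-- The integral matrices of determinant `l` with lower left entry divisible by `N` that fix a
given point of the extended upper half plane. -/
def fixers (N l : ℕ) (x : ExtH) : Set (GL (Fin 2) ℚ) := {g | g ∈ heckeSet N l ∧ g • x = x}

/-- Both images are the quotient of `s` by the same equivalence relation. Finiteness is carried
separately because `Set.ncard` is 0 on infinite sets. -/
lemma ncard_eq_of_fibers {α β γ : Type*} {s : Set α} {f : α → β} {g : α → γ}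
    (h : ∀ a ∈ s, ∀ b ∈ s, f a = f b ↔ g a = g b) :
    (f '' s).ncard = (g '' s).ncard ∧ ((g '' s).Finite → (f '' s).Finite) := by
  classical
  rcases s.eq_empty_or_nonempty with rfl | ⟨a₀, ha₀⟩
  · simp
  have : ∀ b : β, ∃ a, b ∈ f '' s → a ∈ s ∧ f a = b := fun b => by
    by_cases hb : b ∈ f '' s
    · obtain ⟨a, ha⟩ := hb
      exact ⟨a, fun _ => ha⟩
    · exact ⟨a₀, fun h => absurd h hb⟩
  choose k hk using this
  have himg : (g ∘ k) '' (f '' s) = g '' s := by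
    ext c
    constructor
    · rintro ⟨b, hb, rfl⟩
      exact ⟨k b, (hk b hb).1, rfl⟩
    · rintro ⟨a, ha, rfl⟩
      have hb := Set.mem_image_of_mem f ha
      exact ⟨f a, hb, (h _ (hk _ hb).1 _ ha).1 (hk _ hb).2⟩
  have hinj : Set.InjOn (g ∘ k) (f '' s) := by
    intro b hb c hc hbc
    rw [← (hk b hb).2, ← (hk c hc).2]
    exact (h _ (hk b hb).1 _ (hk c hc).1).2 hbc
  rw [← himg]
  exact ⟨hinj.ncard_image.symm, fun hf => hf.of_finite_image hinj⟩

/-- Here `f` is any invariant whose fibres on the fixers are the double cosets of the stabiliser of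
`x` in Γ₀(N); it becomes an ideal at a point of ℍ and a truth value at a cusp. -/
lemma fixSet_ncard {N l : ℕ} [NeZero l] [Fact l.Prime] (hl : ¬ l ∣ N) {β : Type*} (x : ExtH)
    (f : GL (Fin 2) ℚ → β)
    (hf : ∀ g ∈ fixers N l x, ∀ h ∈ fixers N l x, f g = f h ↔
      ∃ s ∈ gamma0Q N, ∃ t ∈ gamma0Q N, s • x = x ∧ t • x = x ∧ h = s * g * t) :
    (fixSet N l (X0.mk N x)).ncard = (f '' fixers N l x).ncard ∧
      ((f '' fixers N l x).Finite → (fixSet N l (X0.mk N x)).Finite) := by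
  have hex : ∀ g : GL (Fin 2) ℚ, ∃ γ δ : GL (Fin 2) ℚ, g ∈ fixers N l x →
      δ ∈ gamma0Q N ∧ γ ∈ gamma0Q N ∧ g = δ * mulMat l * γ := fun g => by
    by_cases hg : g ∈ fixers N l x
    · obtain ⟨δ, hδ, γ, hγ, e⟩ := exists_eq_mul_mulMat_mul hl hg.1
      exact ⟨γ, δ, fun _ => ⟨hδ, hγ, e⟩⟩
    · exact ⟨1, 1, fun h => absurd h hg⟩
  choose γ δ hγδ using hex
  have himg : (fun g => X0.mk (N * l) (γ g • x)) '' fixers N l x = fixSet N l (X0.mk N x) := by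
    ext P
    constructor
    · rintro ⟨g, hg, rfl⟩
      obtain ⟨hδ, hγ, e⟩ := hγδ g hg
      refine ⟨(X0.mk_eq_mk.2 ⟨_, hγ, rfl⟩).symm, ?_⟩
      rw [proj₂_mk, X0.mk_eq_mk]
      refine ⟨_, hδ, ?_⟩
      rw [smul_smul, smul_smul, ← e, hg.2]
    · rintro ⟨h₁, h₂⟩
      rw [← P.mk_rep, proj₁_mk, eq_comm, X0.mk_eq_mk] at h₁
      rw [← P.mk_rep, proj₂_mk, X0.mk_eq_mk] at h₂
      obtain ⟨a, ha, hax⟩ := h₁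
      obtain ⟨b, hb, hbx⟩ := h₂
      -- If `a • x` represents `P` and `b` brings the second projection back to `x`, then `b m a`
      -- fixes `x`.
      have hmem : b * mulMat l * a ∈ fixers N l x := by
        refine ⟨?_, by rw [mul_smul, mul_smul, hax, hbx]⟩
        simpa using mul_mem_heckeSet (mul_mem_heckeSet (mem_gamma0Q.1 hb)
          (mulMat_mem_heckeSet N l)) (mem_gamma0Q.1 ha)
      refine ⟨_, hmem, ?_⟩
      obtain ⟨hδ, hγ, e⟩ := hγδ _ hmem
      rw [← P.mk_rep, X0.mk_eq_mk]
      set g := b * mulMat l * a with hg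
      refine ⟨a * (γ g)⁻¹, ?_, by rw [mul_smul, inv_smul_smul, hax]⟩
      rw [mem_gamma0Q_mul_iff]
      refine ⟨mul_mem ha (inv_mem hγ), ?_⟩
      have : mulMat l * (a * (γ g)⁻¹) * (mulMat l)⁻¹ = b⁻¹ * δ g := by
        have : mulMat l * a = b⁻¹ * (δ g * mulMat l * γ g) := by rw [← e, hg]; group
        rw [← mul_assoc, this]
        group
      rw [this]
      exact mul_mem (inv_mem hb) hδ
  rw [← himg]
  refine ncard_eq_of_fibers fun g hg h hh => ?_
  rw [hf g hg h hh]
  obtain ⟨hδg, hγg, eg⟩ := hγδ g hg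
  obtain ⟨hδh, hγh, eh⟩ := hγδ h hh
  rw [X0.mk_eq_mk]
  constructor
  · rintro ⟨a, ha, hax⟩
    rw [mem_gamma0Q_mul_iff] at ha
    -- The discrepancy between the two right factors is the stabiliser element on the right; the one
    -- on the left is then forced.
    set t := (γ g)⁻¹ * a⁻¹ * γ h with ht
    have htx : t • x = x := by rw [ht, mul_smul, mul_smul, ← hax, inv_smul_smul, inv_smul_smul]
    have htm : t ∈ gamma0Q N := mul_mem (mul_mem (inv_mem hγg) (inv_mem ha.1)) hγh
    refine ⟨h * t⁻¹ * g⁻¹, ?_, t, htm, ?_, htx, by group⟩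
    · have : h * t⁻¹ * g⁻¹ = δ h * (mulMat l * a * (mulMat l)⁻¹) * (δ g)⁻¹ := by
        conv_lhs => rw [eh, eg, ht]
        group
      rw [this]
      exact mul_mem (mul_mem hδh ha.2) (inv_mem hδg)
    · have h1 : t⁻¹ • x = x := by rw [inv_smul_eq_iff, htx]
      have h2 : g⁻¹ • x = x := by rw [inv_smul_eq_iff, hg.2]
      rw [mul_smul, mul_smul, h2, h1, hh.2]
  · rintro ⟨s, hs, t, ht, hsx, htx, e⟩
    refine ⟨γ h * t⁻¹ * (γ g)⁻¹, ?_, ?_⟩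
    · rw [mem_gamma0Q_mul_iff]
      refine ⟨mul_mem (mul_mem hγh (inv_mem ht)) (inv_mem hγg), ?_⟩
      have : mulMat l * (γ h * t⁻¹ * (γ g)⁻¹) * (mulMat l)⁻¹ = (δ h)⁻¹ * s * δ g := by
        have h1 : mulMat l * γ h = (δ h)⁻¹ * (s * (δ g * mulMat l * γ g) * t) := by
          rw [← eg, ← e, eq_inv_mul_iff_mul_eq, ← mul_assoc, ← eh]
        have : mulMat l * (γ h * t⁻¹ * (γ g)⁻¹) * (mulMat l)⁻¹ =
          (mulMat l * γ h) * t⁻¹ * (γ g)⁻¹ * (mulMat l)⁻¹ := by group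
        rw [this, h1]
        group
      rw [this]
      exact mul_mem (mul_mem (inv_mem hδh) hs) hδg
    · have h1 : t⁻¹ • x = x := by rw [inv_smul_eq_iff, htx]
      rw [mul_smul, mul_smul, inv_smul_smul, h1]

/-! ### Endomorphisms as integral matrices -/

/-- The vector `(τ, 1)`. -/
def tauVec (τ : ℍ) : Fin 2 → ℂ := ![(τ : ℂ), 1]

/-- The integral matrix `A` has the eigenvector `(τ, 1)` with eigenvalue `α`. -/
def HasEigen (A : Matrix (Fin 2) (Fin 2) ℤ) (τ : ℍ) (α : ℂ) : Prop :=
  (A.map (Int.cast : ℤ → ℂ)).mulVec (tauVec τ) = α • tauVec τ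

lemma hasEigen_iff {A : Matrix (Fin 2) (Fin 2) ℤ} {τ : ℍ} {α : ℂ} :
    HasEigen A τ α ↔ (A 0 0 * τ + A 0 1 : ℂ) = α * τ ∧ (A 1 0 * τ + A 1 1 : ℂ) = α := by
  rw [HasEigen, funext_iff, Fin.forall_fin_two]
  simp [Matrix.mulVec, dotProduct, Fin.sum_univ_two, tauVec]

lemma HasEigen.mul {A B : Matrix (Fin 2) (Fin 2) ℤ} {τ : ℍ} {α β : ℂ} (hA : HasEigen A τ α)
    (hB : HasEigen B τ β) : HasEigen (A * B) τ (α * β) := by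
  have : (A * B).map (Int.cast : ℤ → ℂ) = A.map Int.cast * B.map Int.cast :=
    Matrix.map_mul (f := Int.castRingHom ℂ)
  have hA' : (A.map (Int.cast : ℤ → ℂ)).mulVec (tauVec τ) = α • tauVec τ := hA
  have hB' : (B.map (Int.cast : ℤ → ℂ)).mulVec (tauVec τ) = β • tauVec τ := hB
  rw [HasEigen, this, ← Matrix.mulVec_mulVec, hB', Matrix.mulVec_smul, hA', smul_smul, mul_comm]

lemma real_linear_independent {τ : ℍ} {x y : ℝ} (h : (x * τ + y : ℂ) = 0) : x = 0 ∧ y = 0 := by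
  have him := congrArg Complex.im h
  simp [τ.im_ne_zero] at him
  subst him
  simpa using h

lemma int_linear_independent {τ : ℍ} {x y x' y' : ℤ} (h : (x * τ + y : ℂ) = x' * τ + y') :
    x = x' ∧ y = y' := by
  have := real_linear_independent (τ := τ) (x := (x - x' : ℤ)) (y := (y - y' : ℤ)) (by
    push_cast
    linear_combination h)
  norm_cast at this
  omega

/-- 1 and τ are linearly independent over ℤ, so the eigenvalue determines both rows. -/
lemma HasEigen.unique {A B : Matrix (Fin 2) (Fin 2) ℤ} {τ : ℍ} {α : ℂ} (hA : HasEigen A τ α)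
    (hB : HasEigen B τ α) : A = B := by
  rw [hasEigen_iff] at hA hB
  obtain ⟨h1, h2⟩ := int_linear_independent (hA.1.trans hB.1.symm)
  obtain ⟨h3, h4⟩ := int_linear_independent (hA.2.trans hB.2.symm)
  ext i j
  fin_cases i <;> fin_cases j <;> assumption

lemma hasEigen_intCast (n : ℤ) (τ : ℍ) : HasEigen !![n, 0; 0, n] τ n := by
  simp [hasEigen_iff]

/-- `A` is real and τ is not, so the other eigenvalue is the conjugate of `α`. The same reason gives
the determinant as norm below. -/
lemma HasEigen.add_conj {A : Matrix (Fin 2) (Fin 2) ℤ} {τ : ℍ} {α : ℂ} (hA : HasEigen A τ α) :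
    α + (starRingEnd ℂ) α = (A.trace : ℤ) := by
  obtain ⟨h0, rfl⟩ := hasEigen_iff.1 hA
  have him := congrArg Complex.im h0
  simp at him
  have h : (A 0 0 : ℝ) = 2 * A 1 0 * τ.re + A 1 1 := by
    refine mul_right_cancel₀ τ.im_ne_zero ?_
    rw [him]; ring
  rw [Complex.add_conj, Matrix.trace_fin_two]
  have h' : (A 0 0 : ℂ) = 2 * A 1 0 * τ.re + A 1 1 := by exact_mod_cast h
  push_cast
  rw [h']
  simp
  ring

lemma HasEigen.mul_conj {A : Matrix (Fin 2) (Fin 2) ℤ} {τ : ℍ} {α : ℂ} (hA : HasEigen A τ α) :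
    α * (starRingEnd ℂ) α = (A.det : ℤ) := by
  have h := hA.add_conj
  obtain ⟨h0, h1⟩ := hasEigen_iff.1 hA
  have hc : (starRingEnd ℂ) α = (A.trace : ℤ) - α := by rw [← h]; ring
  rw [hc, Matrix.trace_fin_two, Matrix.det_fin_two]
  push_cast
  have : α * (A 0 0 + A 1 1 - α) = A 0 0 * (α - A 1 0 * (τ : ℂ)) + A 1 1 * α -
      (α - A 1 0 * (τ : ℂ)) * α + A 1 0 * (A 0 0 * (τ : ℂ) - α * τ) := by ring
  have e1 : α - A 1 0 * (τ : ℂ) = A 1 1 := by rw [← h1]; ring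
  have e0 : A 0 0 * (τ : ℂ) - α * τ = - (A 0 1 : ℂ) := by rw [← h0]; ring
  rw [this, e1, e0]
  ring

lemma HasEigen.normSq {A : Matrix (Fin 2) (Fin 2) ℤ} {τ : ℍ} {α : ℂ} (hA : HasEigen A τ α) :
    Complex.normSq α = (A.det : ℤ) := by
  have := hA.mul_conj
  rw [Complex.mul_conj] at this
  exact Complex.ofReal_injective (by rw [this]; simp)

/-- The adjugate is tr(A) - A, which acts on the eigenvector by tr(A) - α = ᾱ. -/
lemma HasEigen.conj {A : Matrix (Fin 2) (Fin 2) ℤ} {τ : ℍ} {α : ℂ} (hA : HasEigen A τ α) :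
    HasEigen A.adjugate τ ((starRingEnd ℂ) α) := by
  have h := hA.add_conj
  have hc : (starRingEnd ℂ) α = (A.trace : ℤ) - α := by rw [← h]; ring
  rw [hasEigen_iff] at hA ⊢
  rw [hc, Matrix.adjugate_fin_two, Matrix.trace_fin_two]
  push_cast
  simp
  constructor
  · linear_combination -hA.1
  · linear_combination -hA.2

lemma mem_multiplierRing_closure {x y α : ℂ} :
    α ∈ multiplierRing (AddSubgroup.closure {x, y}) ↔
      (∃ m n : ℤ, m • x + n • y = α * x) ∧ (∃ m n : ℤ, m • x + n • y = α * y) := by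
  rw [← AddSubgroup.mem_closure_pair, ← AddSubgroup.mem_closure_pair]
  constructor
  · intro h
    exact ⟨h _ (AddSubgroup.subset_closure (by simp)), h _ (AddSubgroup.subset_closure (by simp))⟩
  · rintro ⟨h1, h2⟩ z hz
    obtain ⟨m, n, rfl⟩ := AddSubgroup.mem_closure_pair.1 hz
    rw [mul_add, mul_smul_comm, mul_smul_comm]
    exact add_mem (AddSubgroup.zsmul_mem _ h1 _) (AddSubgroup.zsmul_mem _ h2 _)

lemma mem_curveOrder_iff {τ : ℍ} {α : ℂ} :
    α ∈ curveOrder τ ↔ ∃ A : Matrix (Fin 2) (Fin 2) ℤ, HasEigen A τ α := by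
  rw [curveOrder, mem_multiplierRing_closure]
  constructor
  · rintro ⟨⟨d, c, h1⟩, b, a, h2⟩
    refine ⟨!![a, b; c, d], hasEigen_iff.2 ?_⟩
    simp at h1 h2 ⊢
    constructor
    · linear_combination h2
    · linear_combination h1
  · rintro ⟨A, hA⟩
    rw [hasEigen_iff] at hA
    refine ⟨⟨A 1 1, A 1 0, ?_⟩, A 0 1, A 0 0, ?_⟩
    · simp
      linear_combination hA.2
    · simp
      linear_combination hA.1

/-- Multiplication by `α` sends 1/N to (cτ + d)/N, where (c, d) is the lower row of the matrix. This
lies in ℤ(1/N) + ℤτ exactly when N ∣ c. -/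
lemma mem_pointOrder_iff {N : ℕ} [NeZero N] {τ : ℍ} {α : ℂ} :
    α ∈ pointOrder N τ ↔
      ∃ A : Matrix (Fin 2) (Fin 2) ℤ, (N : ℤ) ∣ A 1 0 ∧ HasEigen A τ α := by
  have hN : (N : ℂ) ≠ 0 := NeZero.ne _
  rw [pointOrder, Subring.mem_inf, mem_curveOrder_iff, mem_multiplierRing_closure]
  constructor
  · rintro ⟨⟨A, hA⟩, ⟨m, n, h⟩, -⟩
    refine ⟨A, ⟨n, ?_⟩, hA⟩
    have hA' := (hasEigen_iff.1 hA).2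
    refine (int_linear_independent (τ := τ) (y := A 1 1) (y' := m) ?_).1
    rw [hA']
    simp at h
    field_simp at h
    push_cast
    linear_combination -h
  · rintro ⟨A, ⟨k, hk⟩, hA⟩
    have hA' := hasEigen_iff.1 hA
    refine ⟨⟨A, hA⟩, ⟨A 1 1, k, ?_⟩, N * A 0 1, A 0 0, ?_⟩
    · rw [← hA'.2, hk]
      simp
      field_simp
      ring
    · rw [← hA'.1]
      simp
      field_simp
      ring

lemma pointOrder_one (τ : ℍ) : pointOrder 1 τ = curveOrder τ := by
  simp [pointOrder, curveOrder]

/-! ### The order of a point as a ring -/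

section Order

variable {N : ℕ} [NeZero N] {τ : ℍ}

lemma conj_mem_pointOrder {α : ℂ} (h : α ∈ pointOrder N τ) :
    (starRingEnd ℂ) α ∈ pointOrder N τ := by
  rw [mem_pointOrder_iff] at h ⊢
  obtain ⟨A, hA, h⟩ := h
  refine ⟨_, ?_, h.conj⟩
  rw [Matrix.adjugate_fin_two]
  simpa using hA

lemma exists_normSq_eq {α : ℂ} (h : α ∈ pointOrder N τ) : ∃ n : ℤ, Complex.normSq α = n := by
  obtain ⟨A, -, h⟩ := mem_pointOrder_iff.1 h
  exact ⟨_, h.normSq⟩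

lemma exists_add_conj_eq {α : ℂ} (h : α ∈ pointOrder N τ) :
    ∃ t : ℤ, α + (starRingEnd ℂ) α = t := by
  obtain ⟨A, -, h⟩ := mem_pointOrder_iff.1 h
  exact ⟨_, h.add_conj⟩

lemma intCast_eq_of_im_eq_zero {α : ℂ} (h : α ∈ pointOrder N τ) (h0 : α.im = 0) :
    ∃ n : ℤ, α = n := by
  obtain ⟨A, -, h⟩ := mem_pointOrder_iff.1 h
  refine ⟨A 1 1, ?_⟩
  obtain ⟨-, rfl⟩ := hasEigen_iff.1 h
  simp [τ.im_ne_zero] at h0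
  simp [h0]

/-- The order is generated, as an abelian group, by `1` and another element. -/
lemma exists_generator (N : ℕ) [NeZero N] (τ : ℍ) :
    ∃ ω ∈ pointOrder N τ, ∀ α ∈ pointOrder N τ, ∃ m n : ℤ, α = m + n * ω := by
  let S : AddSubgroup ℤ :=
    { carrier := {c | ∃ α ∈ pointOrder N τ, ∃ d : ℤ, α = c * τ + d}
      add_mem' := by
        rintro _ _ ⟨α, hα, d, e⟩ ⟨β, hβ, d', e'⟩
        exact ⟨α + β, add_mem hα hβ, d + d', by rw [e, e']; push_cast; ring⟩
      zero_mem' := ⟨0, zero_mem _, 0, by simp⟩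
      neg_mem' := by
        rintro _ ⟨α, hα, d, e⟩
        exact ⟨-α, neg_mem hα, -d, by rw [e]; push_cast; ring⟩ }
  -- The coefficients of τ form a cyclic group. An element over its generator serves as ω; without
  -- complex multiplication c = 0 and ω is an integer.
  obtain ⟨c, hc⟩ := Int.subgroup_cyclic S
  have hcS : c ∈ S := by rw [hc]; exact AddSubgroup.subset_closure rfl
  obtain ⟨ω, hω, d, e⟩ := hcS
  refine ⟨ω, hω, fun α hα => ?_⟩
  obtain ⟨A, -, h⟩ := mem_pointOrder_iff.1 hα
  have h2 := (hasEigen_iff.1 h).2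
  have : A 1 0 ∈ S := ⟨α, hα, A 1 1, h2.symm⟩
  rw [hc, AddSubgroup.mem_closure_singleton] at this
  obtain ⟨n, hn⟩ := this
  refine ⟨A 1 1 - n * d, n, ?_⟩
  rw [← h2, e, ← hn]
  push_cast
  simp
  ring

/-! ### Elements of norm ℓ and the primes above ℓ -/

section Norm

variable {l : ℕ} {α : ℂ}

lemma mul_conj_eq (hn : Complex.normSq α = l) : α * (starRingEnd ℂ) α = l := by
  rw [Complex.mul_conj, hn]; simp

lemma normSq_conj_eq (hn : Complex.normSq α = l) :
    Complex.normSq ((starRingEnd ℂ) α) = l := by rw [Complex.normSq_conj, hn]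

variable [Fact l.Prime]

/-- The norm of an integer is a square, which a prime is not. -/
lemma not_isInt_of_normSq_eq (hn : Complex.normSq α = l) (n : ℤ) : α ≠ n := by
  rintro rfl
  have hp := Nat.prime_iff_prime_int.1 (Fact.out : l.Prime)
  refine hp.irreducible.not_isSquare ⟨n, ?_⟩
  have : ((n * n : ℤ) : ℝ) = (l : ℤ) := by
    rw [Complex.normSq_intCast] at hn
    push_cast
    rw [← hn]
  exact_mod_cast this.symm

/-- The norm of m + nω is m² + mnt + n²q. If ℓ divides n, it divides m as well, and then ℓ² divides
the norm ℓ. -/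
lemma not_dvd_coeff {ω : ℂ} (hω : ω ∈ pointOrder N τ) (hn : Complex.normSq α = l) {m n : ℤ}
    (e : α = m + n * ω) : ¬ (l : ℤ) ∣ n := by
  rintro ⟨k, rfl⟩
  have hp := Nat.prime_iff_prime_int.1 (Fact.out : l.Prime)
  obtain ⟨t, ht⟩ := exists_add_conj_eq hω
  obtain ⟨q, hq⟩ := exists_normSq_eq hω
  have hq' : ω * (starRingEnd ℂ) ω = q := by rw [Complex.mul_conj, hq]; simp
  have h := mul_conj_eq hn
  rw [e] at h
  push_cast at h
  simp only [map_add, map_mul, map_intCast, map_natCast] at h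
  have h' : (m ^ 2 + m * (l * k) * t + (l * k) ^ 2 * q : ℤ) = (l : ℤ) := by
    have : ((m ^ 2 + m * (l * k) * t + (l * k) ^ 2 * q : ℤ) : ℂ) = (l : ℤ) := by
      push_cast
      linear_combination h - m * (l * k) * ht - (l * k) ^ 2 * hq'
    exact_mod_cast this
  have hm : (l : ℤ) ∣ m := by
    refine hp.dvd_of_dvd_pow (n := 2) ?_
    exact ⟨1 - m * k * t - l * k ^ 2 * q, by linear_combination h'⟩
  obtain ⟨r, rfl⟩ := hm
  have h2 : (l : ℤ) * (l * (r ^ 2 + r * k * t + k ^ 2 * q)) = l * 1 := by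
    linear_combination h'
  have h3 := mul_left_cancel₀ hp.ne_zero h2
  exact hp.not_isUnit (IsUnit.of_mul_eq_one _ h3)

/-- The quotient is 𝔽_ℓ: the ideal contains ℓ = α ᾱ, and in α = m + nω the coefficient n is
invertible modulo ℓ, so ω is congruent to an integer. The order need not be maximal for this. -/
lemma isMaximal_span (hα : α ∈ pointOrder N τ) (hn : Complex.normSq α = l) :
    (Ideal.span {(⟨α, hα⟩ : pointOrder N τ)}).IsMaximal := by
  have hp := Nat.prime_iff_prime_int.1 (Fact.out : l.Prime)
  obtain ⟨ω, hω, hgen⟩ := exists_generator N τ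
  obtain ⟨m, n, e⟩ := hgen α hα
  have hndvd := not_dvd_coeff hω hn e
  have hlmem : ((l : ℤ) : pointOrder N τ) ∈ Ideal.span {(⟨α, hα⟩ : pointOrder N τ)} := by
    refine Ideal.mem_span_singleton.2 ⟨⟨_, conj_mem_pointOrder hα⟩, Subtype.ext ?_⟩
    simpa using (mul_conj_eq hn).symm
  have hred : ∀ x : pointOrder N τ, ∃ k : ℤ,
      x - k ∈ Ideal.span {(⟨α, hα⟩ : pointOrder N τ)} := by
    intro x
    obtain ⟨a, b, hx⟩ := hgen x x.2
    obtain ⟨s, t, hst⟩ := (Prime.coprime_iff_not_dvd hp).2 hndvd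
    refine ⟨a - b * t * m, ?_⟩
    have : x - ((a - b * t * m : ℤ) : pointOrder N τ) =
        ((l : ℤ) : pointOrder N τ) * ((b * s : ℤ) * ⟨ω, hω⟩) + (b * t : ℤ) * ⟨α, hα⟩ := by
      refine Subtype.ext ?_
      have hst' : (s * l + t * n : ℂ) = 1 := by exact_mod_cast hst
      push_cast
      simp only [hx]
      rw [e]
      linear_combination (-b * ω : ℂ) * hst'
    rw [this]
    exact add_mem (Ideal.mul_mem_right _ _ hlmem)
      (Ideal.mul_mem_left _ _ (Ideal.mem_span_singleton_self _))
  rw [Ideal.isMaximal_iff]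
  constructor
  · rw [Ideal.mem_span_singleton]
    rintro ⟨y, hy⟩
    have h1 := congrArg Complex.normSq (congrArg Subtype.val hy)
    obtain ⟨q, hq⟩ := exists_normSq_eq y.2
    simp only [Subring.coe_one, Subring.coe_mul, map_mul, map_one, hn, hq] at h1
    have h2 : (1 : ℤ) = l * q := by exact_mod_cast h1
    exact hp.not_isUnit (IsUnit.of_mul_eq_one _ h2.symm)
  · intro J x hIJ hx hxJ
    obtain ⟨k, hk⟩ := hred x
    have hkJ : (k : pointOrder N τ) ∈ J := by
      have := sub_mem hxJ (hIJ hk)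
      rwa [sub_sub_cancel] at this
    have hkI : ¬ (l : ℤ) ∣ k := by
      rintro ⟨r, rfl⟩
      refine hx ?_
      have := add_mem hk (Ideal.mul_mem_right (r : pointOrder N τ) _ hlmem)
      rwa [← Int.cast_mul, sub_add_cancel] at this
    obtain ⟨s, t, hst⟩ := (Prime.coprime_iff_not_dvd hp).2 hkI
    have : (1 : pointOrder N τ) = s * (l : ℤ) + t * k := by exact_mod_cast hst.symm
    rw [this]
    exact add_mem (Ideal.mul_mem_left _ _ (hIJ hlmem)) (Ideal.mul_mem_left _ _ hkJ)

/-- A prime containing ℓ = α ᾱ contains one of the factors, and both factors generate maximal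
ideals. -/
lemma isPrime_and_mem_iff (hα : α ∈ pointOrder N τ) (hn : Complex.normSq α = l)
    (p : Ideal (pointOrder N τ)) : p.IsPrime ∧ (l : pointOrder N τ) ∈ p ↔
      p = Ideal.span {⟨α, hα⟩} ∨ p = Ideal.span {⟨_, conj_mem_pointOrder hα⟩} := by
  have hprod : (l : pointOrder N τ) = ⟨α, hα⟩ * ⟨_, conj_mem_pointOrder hα⟩ :=
    Subtype.ext (by simpa using (mul_conj_eq hn).symm)
  have h1 := isMaximal_span hα hn
  have h2 := isMaximal_span (conj_mem_pointOrder hα) (normSq_conj_eq hn)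
  constructor
  · rintro ⟨hp, hl⟩
    rw [hprod] at hl
    rcases hp.mem_or_mem hl with h | h
    · exact .inl (h1.eq_of_le hp.ne_top ((Ideal.span_singleton_le_iff_mem _).2 h)).symm
    · exact .inr (h2.eq_of_le hp.ne_top ((Ideal.span_singleton_le_iff_mem _).2 h)).symm
  · rintro (rfl | rfl) <;> rw [hprod]
    · exact ⟨h1.isPrime, Ideal.mul_mem_right _ _ (Ideal.mem_span_singleton_self _)⟩
    · exact ⟨h2.isPrime, Ideal.mul_mem_left _ _ (Ideal.mem_span_singleton_self _)⟩

lemma span_eq_span_conj_iff (hα : α ∈ pointOrder N τ) (hn : Complex.normSq α = l) {t : ℤ}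
    (ht : α + (starRingEnd ℂ) α = t) :
    (Ideal.span {⟨α, hα⟩} : Ideal (pointOrder N τ)) =
      Ideal.span {⟨_, conj_mem_pointOrder hα⟩} ↔ (l : ℤ) ∣ t := by
  have hp := Nat.prime_iff_prime_int.1 (Fact.out : l.Prime)
  have hl0 : (l : ℂ) ≠ 0 := by exact_mod_cast (Fact.out : l.Prime).ne_zero
  have hm := mul_conj_eq hn
  have hα0 : α ≠ 0 := by rintro rfl; simp at hm; exact hl0 hm.symm
  constructor
  · intro h
    obtain ⟨u, hu⟩ := Ideal.mem_span_singleton.1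
      (h.symm ▸ Ideal.mem_span_singleton_self _ :
        (⟨_, conj_mem_pointOrder hα⟩ : pointOrder N τ) ∈ Ideal.span {⟨α, hα⟩})
    have hu' : (starRingEnd ℂ) α = α * u := congrArg Subtype.val hu
    by_contra hlt
    obtain ⟨a, b, hab⟩ := (Prime.coprime_iff_not_dvd hp).2 hlt
    have hab' : (a * l + b * t : ℂ) = 1 := by exact_mod_cast hab
    set β : ℂ := (starRingEnd ℂ) α with hβ
    -- From ᾱ = αu follows u + 1 = t/α = t ᾱ/ℓ. With aℓ + bt = 1 this combination equals ᾱ/ℓ, whose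
    -- norm 1/ℓ is not an integer.
    have hmem : (a * β + b * (u + 1) : ℂ) ∈ pointOrder N τ := by
      have hβm : β ∈ pointOrder N τ := conj_mem_pointOrder hα
      exact add_mem (mul_mem (intCast_mem _ _) hβm)
        (mul_mem (intCast_mem _ _) (add_mem u.2 (one_mem _)))
    have hval : (a * β + b * (u + 1) : ℂ) = β / l := by
      rw [eq_div_iff hl0]
      have e1 : (u + 1 : ℂ) * l = t * β := by
        rw [← hm, ← ht]
        linear_combination -β * hu'
      linear_combination b * e1 + β * hab'
    rw [hval] at hmem
    obtain ⟨q, hq⟩ := exists_normSq_eq hmem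
    rw [Complex.normSq_div, hβ, normSq_conj_eq hn, Complex.normSq_natCast] at hq
    have hlR : (l : ℝ) ≠ 0 := by exact_mod_cast (Fact.out : l.Prime).ne_zero
    field_simp at hq
    have h2 : (1 : ℤ) = l * q := by exact_mod_cast hq
    exact hp.not_isUnit (IsUnit.of_mul_eq_one _ h2.symm)
  · rintro ⟨k, rfl⟩
    push_cast at ht
    apply le_antisymm <;> rw [Ideal.span_singleton_le_iff_mem, Ideal.mem_span_singleton]
    -- If t = kℓ, then α = t - ᾱ = ᾱ(kα - 1), and symmetrically for ᾱ.
    · refine ⟨k * ⟨α, hα⟩ - 1, Subtype.ext ?_⟩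
      push_cast
      linear_combination ht - k * hm
    · refine ⟨k * ⟨_, conj_mem_pointOrder hα⟩ - 1, Subtype.ext ?_⟩
      push_cast
      linear_combination ht - k * hm

lemma primesAbove_eq (hα : α ∈ pointOrder N τ) (hn : Complex.normSq α = l) :
    {p : Ideal (pointOrder N τ) | p.IsPrime ∧ (l : pointOrder N τ) ∈ p} =
      {Ideal.span {⟨α, hα⟩}, Ideal.span {⟨_, conj_mem_pointOrder hα⟩}} :=
  Set.ext (isPrime_and_mem_iff hα hn)

lemma numPrimesAbove_eq (hα : α ∈ pointOrder N τ) (hn : Complex.normSq α = l) {t : ℤ}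
    (ht : α + (starRingEnd ℂ) α = t) :
    numPrimesAbove (pointOrder N τ) l = if (l : ℤ) ∣ t then 1 else 2 := by
  rw [numPrimesAbove, primesAbove_eq hα hn]
  split_ifs with h
  · rw [(span_eq_span_conj_iff hα hn ht).2 h, Set.pair_eq_singleton, Set.ncard_singleton]
  · exact Set.ncard_pair fun h' => h ((span_eq_span_conj_iff hα hn ht).1 h')

/-- The count depends only on ℓ and the trace of `α`, and `α` lies in both rings. -/
lemma numPrimesAbove_curveOrder (hα : α ∈ pointOrder N τ) (hn : Complex.normSq α = l) :
    numPrimesAbove (curveOrder τ) l = numPrimesAbove (pointOrder N τ) l := by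
  obtain ⟨t, ht⟩ := exists_add_conj_eq hα
  have hα' : α ∈ pointOrder 1 τ := by rw [pointOrder_one]; exact hα.1
  rw [numPrimesAbove_eq hα hn ht, ← numPrimesAbove_eq hα' hn ht, pointOrder_one]

lemma isCM_of_normSq_eq (hα : α ∈ curveOrder τ) (hn : Complex.normSq α = l) : IsCM τ := by
  intro h
  rw [h, Subring.mem_bot] at hα
  obtain ⟨n, hn'⟩ := hα
  exact not_isInt_of_normSq_eq hn n hn'.symm

end Norm

/-- The action of the order on the cyclic subgroup of order `N`. -/
lemma exists_quotient_equiv_zmod (N : ℕ) [NeZero N] (τ : ℍ) :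
    ∃ I : Ideal (pointOrder N τ), Nonempty ((pointOrder N τ ⧸ I) ≃+* ZMod N) := by
  choose M hdvd hM using fun x : pointOrder N τ => mem_pointOrder_iff.1 x.2
  have hzero : ∀ x, ((M x 1 0 : ℤ) : ZMod N) = 0 := fun x =>
    (ZMod.intCast_zmod_eq_zero_iff_dvd _ _).2 (hdvd x)
  have hM1 : M 1 = 1 := (hM 1).unique (by
    have := hasEigen_intCast 1 τ
    rwa [Int.cast_one, ← Matrix.one_fin_two] at this)
  have hMmul : ∀ x y, M (x * y) = M x * M y := fun x y => (hM _).unique ((hM x).mul (hM y))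
  have hMadd : ∀ x y, M (x + y) = M x + M y := fun x y => (hM _).unique (by
    have h1 := hasEigen_iff.1 (hM x)
    have h2 := hasEigen_iff.1 (hM y)
    rw [hasEigen_iff]
    simp only [Matrix.add_apply, Int.cast_add, Subring.coe_add]
    exact ⟨by linear_combination h1.1 + h2.1, by linear_combination h1.2 + h2.2⟩)
  -- Since N divides all lower left entries, the lower right entry is multiplicative modulo N. A
  -- ring homomorphism to `ZMod N` is automatically surjective.
  let φ : pointOrder N τ →+* ZMod N := RingHom.mk'
    { toFun := fun x => ((M x 1 1 : ℤ) : ZMod N)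
      map_one' := by simp [hM1]
      map_mul' := fun x y => by
        simp only [hMmul, Matrix.mul_apply, Fin.sum_univ_two]
        push_cast
        rw [hzero x, zero_mul, zero_add] }
    (fun x y => by simp [hMadd])
  exact ⟨_, ⟨RingHom.quotientKerEquivOfSurjective (ZMod.ringHom_surjective φ)⟩⟩

end Order

/-! ### Points of the upper half plane fixed by integral matrices -/

/-- A point of `ℍ`, viewed in the extended upper half plane. -/
def ExtH.point (τ : ℍ) : ExtH := Sum.inl τ

/-- A point of `ℙ¹(ℚ)`, viewed in the extended upper half plane. -/
def ExtH.ratPoint (s : OnePoint ℚ) : ExtH := Sum.inr s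

lemma ExtH.point_injective : Function.Injective ExtH.point := Sum.inl_injective

lemma ExtH.ratPoint_injective : Function.Injective ExtH.ratPoint := Sum.inr_injective

lemma smul_point (g : GL (Fin 2) ℚ) (τ : ℍ) :
    g • ExtH.point τ = ExtH.point (g.map (algebraMap ℚ ℝ) • τ) := rfl

lemma smul_ratPoint (g : GL (Fin 2) ℚ) (s : OnePoint ℚ) :
    g • ExtH.ratPoint s = ExtH.ratPoint (g • s) := rfl

section Moebius

variable {g : GL (Fin 2) ℚ} {A : Matrix (Fin 2) (Fin 2) ℤ}

lemma map_apply_of_eq (hg : (g : Matrix (Fin 2) (Fin 2) ℚ) = A.map (Int.cast : ℤ → ℚ))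
    (i j : Fin 2) : (g.map (algebraMap ℚ ℝ)) i j = A i j := by
  have : g i j = A i j := congrFun₂ hg i j
  simp [this]

lemma det_map_pos (hg : (g : Matrix (Fin 2) (Fin 2) ℚ) = A.map (Int.cast : ℤ → ℚ))
    (hA : 0 < A.det) : 0 < (g.map (algebraMap ℚ ℝ)).det.val := by
  rw [Matrix.GeneralLinearGroup.val_det_apply, Matrix.det_fin_two]
  rw [Matrix.det_fin_two] at hA
  have h := map_apply_of_eq hg
  simp only [h]
  exact_mod_cast hA

lemma coe_map_smul (hg : (g : Matrix (Fin 2) (Fin 2) ℚ) = A.map (Int.cast : ℤ → ℚ))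
    (hA : 0 < A.det) (z : ℍ) : ((g.map (algebraMap ℚ ℝ) • z : ℍ) : ℂ) =
      (A 0 0 * z + A 0 1) / (A 1 0 * z + A 1 1) := by
  rw [UpperHalfPlane.coe_smul_of_det_pos (det_map_pos hg hA), UpperHalfPlane.num,
    UpperHalfPlane.denom]
  have h := map_apply_of_eq hg
  simp only [h]
  norm_cast

lemma denom_ne_zero' (hA : A.det ≠ 0) (z : ℍ) : (A 1 0 * z + A 1 1 : ℂ) ≠ 0 := by
  intro h
  have := real_linear_independent (τ := z) (x := A 1 0) (y := A 1 1) (by exact_mod_cast h)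
  norm_cast at this
  rw [Matrix.det_fin_two, this.1, this.2] at hA
  simp at hA

lemma smul_point_eq_iff (hg : (g : Matrix (Fin 2) (Fin 2) ℚ) = A.map (Int.cast : ℤ → ℚ))
    (hA : 0 < A.det) {τ : ℍ} : g • ExtH.point τ = ExtH.point τ ↔
      HasEigen A τ (A 1 0 * τ + A 1 1) := by
  have hd := denom_ne_zero' hA.ne' τ
  rw [smul_point, ExtH.point_injective.eq_iff, UpperHalfPlane.ext_iff,
    coe_map_smul hg hA, div_eq_iff hd, hasEigen_iff]
  constructor
  · intro h
    exact ⟨by rw [h, mul_comm], rfl⟩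
  · intro h
    rw [h.1, mul_comm]

lemma HasEigen.smul_point_eq (hg : (g : Matrix (Fin 2) (Fin 2) ℚ) = A.map (Int.cast : ℤ → ℚ))
    (hA : 0 < A.det) {τ : ℍ} {α : ℂ} (h : HasEigen A τ α) :
    g • ExtH.point τ = ExtH.point τ := by
  rw [smul_point_eq_iff hg hA, (hasEigen_iff.1 h).2]
  exact h

end Moebius

/-- The GL₂(ℚ)-element given by an integral matrix of nonzero determinant. -/
lemma exists_coe_eq_map {A : Matrix (Fin 2) (Fin 2) ℤ} (hA : A.det ≠ 0) :
    ∃ g : GL (Fin 2) ℚ, (g : Matrix (Fin 2) (Fin 2) ℚ) = A.map (Int.cast : ℤ → ℚ) := by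
  refine ⟨Matrix.GeneralLinearGroup.mkOfDetNeZero (A.map (Int.cast : ℤ → ℚ)) ?_, rfl⟩
  rw [Matrix.det_fin_two]
  rw [Matrix.det_fin_two] at hA
  simp only [Matrix.map_apply]
  exact_mod_cast hA

/-- The factor of automorphy `c τ + d`. -/
def autFactor (g : GL (Fin 2) ℚ) (τ : ℍ) : ℂ := (g 1 0 : ℂ) * τ + (g 1 1 : ℂ)

lemma autFactor_eq {g : GL (Fin 2) ℚ} {A : Matrix (Fin 2) (Fin 2) ℤ}
    (hg : (g : Matrix (Fin 2) (Fin 2) ℚ) = A.map (Int.cast : ℤ → ℚ)) (τ : ℍ) :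
    autFactor g τ = A 1 0 * τ + A 1 1 := by
  have h : ∀ i j, g i j = A i j := congrFun₂ hg
  simp [autFactor, h]

/-! ### Branches at a point of ℍ and primes above ℓ -/

section FixSet

variable {N l : ℕ} {τ : ℍ}

lemma hasEigen_of_mem_heckeSet {n : ℤ} (hn : 0 < n) {g : GL (Fin 2) ℚ} (hg : g ∈ heckeSet N n)
    (h : g • ExtH.point τ = ExtH.point τ) :
    ∃ A : Matrix (Fin 2) (Fin 2) ℤ, A.det = n ∧ (N : ℤ) ∣ A 1 0 ∧
      (g : Matrix (Fin 2) (Fin 2) ℚ) = A.map (Int.cast : ℤ → ℚ) ∧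
      HasEigen A τ (autFactor g τ) := by
  obtain ⟨A, hA, hAN, hgA⟩ := hg
  refine ⟨A, hA, hAN, hgA, ?_⟩
  rw [autFactor_eq hgA]
  exact (smul_point_eq_iff hgA (hA ▸ hn)).1 h

lemma autFactor_mul {n m : ℤ} (hn : 0 < n) (hm : 0 < m) {g h : GL (Fin 2) ℚ}
    (hg : g ∈ heckeSet N n) (hh : h ∈ heckeSet N m) (hgτ : g • ExtH.point τ = ExtH.point τ)
    (hhτ : h • ExtH.point τ = ExtH.point τ) :
    autFactor (g * h) τ = autFactor g τ * autFactor h τ := by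
  obtain ⟨A, hA, hAN, hgA, heA⟩ := hasEigen_of_mem_heckeSet hn hg hgτ
  obtain ⟨B, hB, hBN, hhB, heB⟩ := hasEigen_of_mem_heckeSet hm hh hhτ
  have : ((g * h : GL (Fin 2) ℚ) : Matrix (Fin 2) (Fin 2) ℚ) =
      (A * B).map (Int.cast : ℤ → ℚ) := by
    rw [Units.val_mul, hgA, hhB]
    exact (Matrix.map_mul (f := Int.castRingHom ℚ)).symm
  rw [autFactor_eq this, (hasEigen_iff.1 (heA.mul heB)).2]

lemma autFactor_injective {n m : ℤ} (hn : 0 < n) (hm : 0 < m) {g h : GL (Fin 2) ℚ}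
    (hg : g ∈ heckeSet N n) (hh : h ∈ heckeSet N m) (hgτ : g • ExtH.point τ = ExtH.point τ)
    (hhτ : h • ExtH.point τ = ExtH.point τ) (e : autFactor g τ = autFactor h τ) : g = h := by
  obtain ⟨A, hA, hAN, hgA, heA⟩ := hasEigen_of_mem_heckeSet hn hg hgτ
  obtain ⟨B, hB, hBN, hhB, heB⟩ := hasEigen_of_mem_heckeSet hm hh hhτ
  refine Units.ext ?_
  rw [e] at heA
  rw [hgA, hhB, heA.unique heB]

variable [NeZero N] [Fact l.Prime]

lemma autFactor_mem {n : ℤ} (hn : 0 < n) {g : GL (Fin 2) ℚ} (hg : g ∈ heckeSet N n)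
    (h : g • ExtH.point τ = ExtH.point τ) :
    autFactor g τ ∈ pointOrder N τ ∧ Complex.normSq (autFactor g τ) = n := by
  obtain ⟨A, hA, hAN, -, he⟩ := hasEigen_of_mem_heckeSet hn hg h
  exact ⟨mem_pointOrder_iff.2 ⟨A, hAN, he⟩, by rw [he.normSq, hA]⟩

lemma exists_autFactor_eq {n : ℤ} (hn : 0 < n) {α : ℂ} (hα : α ∈ pointOrder N τ)
    (hnorm : Complex.normSq α = n) : ∃ g ∈ heckeSet N n,
      g • ExtH.point τ = ExtH.point τ ∧ autFactor g τ = α := by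
  obtain ⟨A, hAN, he⟩ := mem_pointOrder_iff.1 hα
  have hA : A.det = n := by
    have := he.normSq
    rw [hnorm] at this
    exact_mod_cast this.symm
  obtain ⟨g, hg⟩ := exists_coe_eq_map (A := A) (by rw [hA]; exact hn.ne')
  exact ⟨g, ⟨A, hA, hAN, hg⟩, he.smul_point_eq hg (hA ▸ hn),
    by rw [autFactor_eq hg, (hasEigen_iff.1 he).2]⟩

/-- The principal ideal of the order generated by the factor of automorphy. -/
def autIdeal (N : ℕ) (τ : ℍ) (g : GL (Fin 2) ℚ) : Ideal (pointOrder N τ) :=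
  Ideal.span {x | (x : ℂ) = autFactor g τ}

/-- The ideal is spanned by a set, so that it is defined for every `g`; the set is a single element
once the factor of automorphy lies in the order. -/
lemma autIdeal_eq {N : ℕ} {τ : ℍ} {g : GL (Fin 2) ℚ} {α : ℂ} (hα : α ∈ pointOrder N τ)
    (h : autFactor g τ = α) : autIdeal N τ g = Ideal.span {⟨α, hα⟩} := by
  rw [autIdeal, h]
  congr 1
  ext x
  exact ⟨fun hx => Subtype.ext hx, fun hx => congrArg Subtype.val hx⟩

lemma normSq_unit (u : (pointOrder N τ)ˣ) : Complex.normSq (u : pointOrder N τ) = 1 := by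
  obtain ⟨a, ha⟩ := exists_normSq_eq (u : pointOrder N τ).2
  obtain ⟨b, hb⟩ := exists_normSq_eq (↑u⁻¹ : pointOrder N τ).2
  have h : Complex.normSq ((u : pointOrder N τ) : ℂ) *
      Complex.normSq ((↑u⁻¹ : pointOrder N τ) : ℂ) = 1 := by
    rw [← map_mul, ← Subring.coe_mul, Units.mul_inv]
    simp
  have h0 := Complex.normSq_nonneg ((u : pointOrder N τ) : ℂ)
  rw [ha, hb] at h
  rw [ha] at h0 ⊢
  have h' : a * b = 1 := by exact_mod_cast h
  have h0' : 0 ≤ a := by exact_mod_cast h0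
  have := Int.eq_one_or_neg_one_of_mul_eq_one h'
  rcases this with rfl | rfl
  · simp
  · omega

lemma isUnit_of_normSq {u : ℂ} (hu : u ∈ pointOrder N τ) (hn : Complex.normSq u = 1) :
    IsUnit (⟨u, hu⟩ : pointOrder N τ) := by
  refine IsUnit.of_mul_eq_one ⟨_, conj_mem_pointOrder hu⟩ (Subtype.ext ?_)
  simp [Complex.mul_conj, hn]

lemma prime_cast_pos (l : ℕ) [Fact l.Prime] : (0 : ℤ) < l := by
  exact_mod_cast (Fact.out : l.Prime).pos

/-- Factors of automorphy turn fixers into elements of norm ℓ and stabilisers into units. By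
commutativity the two-sided classes are classes up to units, that is, principal ideals. -/
lemma autIdeal_eq_iff {g h : GL (Fin 2) ℚ} (hg : g ∈ fixers N l (ExtH.point τ))
    (hh : h ∈ fixers N l (ExtH.point τ)) : autIdeal N τ g = autIdeal N τ h ↔
      ∃ s ∈ gamma0Q N, ∃ t ∈ gamma0Q N, s • ExtH.point τ = ExtH.point τ ∧
        t • ExtH.point τ = ExtH.point τ ∧ h = s * g * t := by
  have hl0 := prime_cast_pos l
  obtain ⟨hgm, hgn⟩ := autFactor_mem hl0 hg.1 hg.2
  obtain ⟨hhm, hhn⟩ := autFactor_mem hl0 hh.1 hh.2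
  rw [autIdeal_eq hgm rfl, autIdeal_eq hhm rfl, Ideal.span_singleton_eq_span_singleton]
  constructor
  · rintro ⟨u, hu⟩
    obtain ⟨s, hs, hsτ, hse⟩ := exists_autFactor_eq (N := N) (τ := τ) (n := 1) one_pos
      (u : pointOrder N τ).2 (by rw [normSq_unit]; simp)
    refine ⟨s, mem_gamma0Q.2 hs, 1, one_mem _, hsτ, one_smul _ _, ?_⟩
    rw [mul_one]
    refine autFactor_injective hl0 (by simpa using hl0) hh.1 (mul_mem_heckeSet hs hg.1) hh.2
      (by rw [mul_smul, hg.2, hsτ]) ?_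
    rw [autFactor_mul one_pos hl0 hs hg.1 hsτ hg.2, hse]
    have := congrArg Subtype.val hu
    simp only [Subring.coe_mul] at this
    rw [← this, mul_comm]
  · rintro ⟨s, hs, t, ht, hsτ, htτ, rfl⟩
    rw [mem_gamma0Q] at hs ht
    obtain ⟨hsm, hsn⟩ := autFactor_mem one_pos hs hsτ
    obtain ⟨htm, htn⟩ := autFactor_mem one_pos ht htτ
    have h1 := isUnit_of_normSq hsm (by simpa using hsn)
    have h2 := isUnit_of_normSq htm (by simpa using htn)
    refine ⟨(h1.mul h2).unit, Subtype.ext ?_⟩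
    simp only [IsUnit.unit_spec, Subring.coe_mul]
    rw [autFactor_mul (by simpa using hl0) one_pos (mul_mem_heckeSet hs hg.1) ht
      (by rw [mul_smul, hg.2, hsτ]) htτ, autFactor_mul one_pos hl0 hs hg.1 hsτ hg.2]
    ring

/-- One element of norm ℓ suffices: its conjugate generates the other prime, and both come from
matrices. -/
lemma autIdeal_image {α : ℂ} (hα : α ∈ pointOrder N τ) (hn : Complex.normSq α = l) :
    autIdeal N τ '' fixers N l (ExtH.point τ) =
      {p : Ideal (pointOrder N τ) | p.IsPrime ∧ (l : pointOrder N τ) ∈ p} := by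
  have hl0 := prime_cast_pos l
  ext p
  constructor
  · rintro ⟨g, hg, rfl⟩
    obtain ⟨hgm, hgn⟩ := autFactor_mem hl0 hg.1 hg.2
    rw [autIdeal_eq hgm rfl]
    exact (isPrime_and_mem_iff hgm (by simpa using hgn) _).2 (.inl rfl)
  · intro hp
    have : ∀ β (hβ : β ∈ pointOrder N τ), Complex.normSq β = l → p = Ideal.span {⟨β, hβ⟩} →
        p ∈ autIdeal N τ '' fixers N l (ExtH.point τ) := by
      rintro β hβ hβn rfl
      obtain ⟨g, hg, hgτ, hge⟩ := exists_autFactor_eq hl0 hβ (by simpa using hβn)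
      exact ⟨g, ⟨hg, hgτ⟩, autIdeal_eq hβ hge⟩
    rcases (isPrime_and_mem_iff hα hn p).1 hp with h | h
    · exact this _ _ hn h
    · exact this _ _ (normSq_conj_eq hn) h

lemma fixers_nonempty_iff : (fixers N l (ExtH.point τ)).Nonempty ↔
    ∃ α ∈ pointOrder N τ, Complex.normSq α = l := by
  have hl0 := prime_cast_pos l
  constructor
  · rintro ⟨g, hg⟩
    obtain ⟨hgm, hgn⟩ := autFactor_mem hl0 hg.1 hg.2
    exact ⟨_, hgm, by simpa using hgn⟩
  · rintro ⟨α, hα, hn⟩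
    obtain ⟨g, hg, hgτ, -⟩ := exists_autFactor_eq hl0 hα (by simpa using hn)
    exact ⟨g, hg, hgτ⟩

lemma numPrimesAbove_ne_zero {N l : ℕ} [NeZero N] [Fact l.Prime] {τ : ℍ} {α : ℂ}
    (hα : α ∈ pointOrder N τ) (hn : Complex.normSq α = l) :
    numPrimesAbove (pointOrder N τ) l ≠ 0 := by
  obtain ⟨t, ht⟩ := exists_add_conj_eq hα
  rw [numPrimesAbove_eq hα hn ht]
  split_ifs <;> simp

variable [NeZero l]

lemma fixSet_pt_ncard (hl : ¬ l ∣ N) {α : ℂ} (hα : α ∈ pointOrder N τ)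
    (hn : Complex.normSq α = l) :
    (fixSet N l (X0.pt N τ)).ncard = numPrimesAbove (pointOrder N τ) l := by
  have := (fixSet_ncard hl (ExtH.point τ) (autIdeal N τ)
    (fun _ hg _ hh => autIdeal_eq_iff hg hh)).1
  rw [autIdeal_image hα hn] at this
  exact this

lemma fixSet_pt_finite (hl : ¬ l ∣ N) (τ : ℍ) : (fixSet N l (X0.pt N τ)).Finite := by
  refine (fixSet_ncard hl (ExtH.point τ) (autIdeal N τ)
    (fun _ hg _ hh => autIdeal_eq_iff hg hh)).2 ?_
  rcases (fixers N l (ExtH.point τ)).eq_empty_or_nonempty with h | h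
  · rw [h]; simp
  · obtain ⟨α, hα, hn⟩ := fixers_nonempty_iff.1 h
    rw [autIdeal_image hα hn, primesAbove_eq hα hn]
    simp

lemma fixSet_pt_ncard_ne_zero (hl : ¬ l ∣ N) : (fixSet N l (X0.pt N τ)).ncard ≠ 0 ↔
    ∃ α ∈ pointOrder N τ, Complex.normSq α = l := by
  constructor
  · intro h
    by_contra h'
    rw [← fixers_nonempty_iff, Set.not_nonempty_iff_eq_empty] at h'
    refine h ((fixSet_ncard hl (ExtH.point τ) (autIdeal N τ)
      (fun _ hg _ hh => autIdeal_eq_iff hg hh)).1.trans ?_)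
    rw [h']
    simp
  · rintro ⟨α, hα, hn⟩
    rw [fixSet_pt_ncard hl hα hn]
    exact numPrimesAbove_ne_zero hα hn

end FixSet

/-! ### Stabilisers and roots of unity -/

lemma coe_sl_smul (γ : SL(2, ℤ)) (z : ℍ) : ((γ • z : ℍ) : ℂ) =
    (γ 0 0 * z + γ 0 1) / (γ 1 0 * z + γ 1 1) := by
  rw [UpperHalfPlane.coe_specialLinearGroup_apply]
  simp

lemma sl_smul_eq_iff {γ : SL(2, ℤ)} {τ : ℍ} :
    γ • τ = τ ↔ HasEigen γ.1 τ (γ 1 0 * τ + γ 1 1) := by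
  have hd := denom_ne_zero' (A := γ.1) (by rw [γ.2]; exact one_ne_zero) τ
  rw [UpperHalfPlane.ext_iff, coe_sl_smul, div_eq_iff hd, hasEigen_iff]
  constructor
  · intro h
    exact ⟨by rw [h, mul_comm], rfl⟩
  · intro h
    rw [h.1, mul_comm]

/-- The units of norm one in the order of a point. -/
def unitGroup (M : ℕ) [NeZero M] (τ : ℍ) : Subgroup ℂˣ where
  carrier := {u | (u : ℂ) ∈ pointOrder M τ ∧ Complex.normSq u = 1}
  mul_mem' := by
    rintro a b ⟨ha, ha'⟩ ⟨hb, hb'⟩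
    exact ⟨mul_mem ha hb, by rw [Units.val_mul, map_mul, ha', hb', one_mul]⟩
  one_mem' := ⟨one_mem _, by simp⟩
  inv_mem' := by
    rintro a ⟨ha, ha'⟩
    have : ((a⁻¹ : ℂˣ) : ℂ) = (starRingEnd ℂ) a := by
      rw [Units.val_inv_eq_inv_val, Complex.inv_def, ha']
      simp
    refine ⟨this ▸ conj_mem_pointOrder ha, ?_⟩
    rw [this, Complex.normSq_conj, ha']

section Stabilizer

variable {M : ℕ} [NeZero M] {τ : ℍ}

lemma mem_unitGroup {u : ℂˣ} :
    u ∈ unitGroup M τ ↔ (u : ℂ) ∈ pointOrder M τ ∧ Complex.normSq u = 1 := Iff.rfl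

lemma exists_unit_of_stabilizer (γ : MulAction.stabilizer (CongruenceSubgroup.Gamma0 M) τ) :
    ∃ u : unitGroup M τ, HasEigen (γ.1.1 : SL(2, ℤ)).1 τ ((u : ℂˣ) : ℂ) := by
  obtain ⟨⟨γ, hγ⟩, h⟩ := γ
  have h' : γ • τ = τ := h
  have he := sl_smul_eq_iff.1 h'
  have hnorm := he.normSq
  rw [γ.2] at hnorm
  have hne : (γ 1 0 * τ + γ 1 1 : ℂ) ≠ 0 := by
    intro h0
    rw [h0] at hnorm
    simp at hnorm
  exact ⟨⟨Units.mk0 _ hne, mem_pointOrder_iff.2 ⟨γ.1, mem_gamma0_iff_dvd.1 hγ, he⟩,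
    by simpa using hnorm⟩, he⟩

/-- Passing to eigenvalues places the stabiliser inside ℂˣ, where a finite group is a group of all
roots of unity of some order. -/
lemma card_stabilizer : Nat.card (MulAction.stabilizer (CongruenceSubgroup.Gamma0 M) τ) =
    Nat.card (unitGroup M τ) := by
  choose f hf using exists_unit_of_stabilizer (M := M) (τ := τ)
  refine Nat.card_eq_of_bijective f ⟨fun γ γ' h => ?_, fun u => ?_⟩
  · have h1 := hf γ
    rw [h] at h1
    exact Subtype.ext (Subtype.ext (Subtype.ext (h1.unique (hf γ'))))
  · obtain ⟨u, hu, hn⟩ := u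
    obtain ⟨A, hA, he⟩ := mem_pointOrder_iff.1 hu
    have hdet : A.det = 1 := by
      have := he.normSq
      rw [hn] at this
      exact_mod_cast this.symm
    let γ : SL(2, ℤ) := ⟨A, hdet⟩
    have hγ : γ • τ = τ := by
      rw [sl_smul_eq_iff]
      have h2 := (hasEigen_iff.1 he).2
      change HasEigen A τ (A 1 0 * τ + A 1 1)
      rwa [h2]
    refine ⟨⟨⟨γ, mem_gamma0_iff_dvd.2 hA⟩, hγ⟩, ?_⟩
    refine Subtype.ext (Units.ext ?_)
    rw [← (hasEigen_iff.1 (hf ⟨⟨γ, mem_gamma0_iff_dvd.2 hA⟩, hγ⟩)).2]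
    exact (hasEigen_iff.1 he).2

/-- An element of norm one has an integral trace t with |t| ≤ 2, so it is a root of one of five
quadratic polynomials. -/
lemma finite_unitGroup : Finite (unitGroup M τ) := by
  let p : ℤ → Polynomial ℂ := fun t =>
    Polynomial.X ^ 2 - Polynomial.C (t : ℂ) * Polynomial.X + 1
  have hp : ∀ t, p t ≠ 0 := fun t => by
    intro h
    have := congrArg (Polynomial.eval 0) h
    simp [p] at this
  have hfin : (⋃ t ∈ Set.Icc (-2 : ℤ) 2, {x : ℂ | (p t).IsRoot x}).Finite :=
    (Set.finite_Icc _ _).biUnion fun t _ => Polynomial.finite_setOfPred_isRoot (hp t)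
  refine Set.Finite.of_finite_image (f := fun u : ℂˣ => (u : ℂ)) (hfin.subset ?_)
    Units.val_injective.injOn
  rintro _ ⟨u, ⟨hu, hn⟩, rfl⟩
  obtain ⟨t, ht⟩ := exists_add_conj_eq hu
  have hm : (u : ℂ) * (starRingEnd ℂ) u = 1 := by rw [Complex.mul_conj, hn]; simp
  have hre : (2 * (u : ℂ).re : ℝ) = t := by
    rw [Complex.add_conj] at ht
    exact_mod_cast ht
  have hle : |(u : ℂ).re| ≤ 1 := by
    refine (Complex.abs_re_le_norm _).trans ?_
    rw [← sq_le_one_iff₀ (norm_nonneg _), ← Complex.normSq_eq_norm_sq, hn]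
  rw [abs_le] at hle
  simp only [Set.mem_iUnion, Set.mem_ofPred_eq]
  refine ⟨t, ⟨?_, ?_⟩, ?_⟩
  · have : (-2 : ℝ) ≤ t := by linarith
    exact_mod_cast this
  · have : (t : ℝ) ≤ 2 := by linarith
    exact_mod_cast this
  · simp only [p, Polynomial.IsRoot, Polynomial.eval_add, Polynomial.eval_sub,
      Polynomial.eval_pow, Polynomial.eval_X, Polynomial.eval_mul, Polynomial.eval_C,
      Polynomial.eval_one]
    rw [← ht]
    linear_combination -hm

/-- The group contains -1; hence the division by 2 in `ellipticOrder` is exact. -/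
lemma two_dvd_card_unitGroup : 2 ∣ Nat.card (unitGroup M τ) := by
  have : Finite (unitGroup M τ) := finite_unitGroup
  have hmem : (-1 : ℂˣ) ∈ unitGroup M τ := ⟨by simp, by simp⟩
  have h := orderOf_dvd_natCard (⟨-1, hmem⟩ : unitGroup M τ)
  have h2 : orderOf (⟨-1, hmem⟩ : unitGroup M τ) = 2 := by
    rw [← Subgroup.orderOf_coe]
    refine orderOf_eq_prime (by simp) ?_
    intro h
    have := congrArg (Units.val) h
    norm_num at this
  rwa [h2] at h

lemma two_mul_ellipticOrder : 2 * ellipticOrder M τ = Nat.card (unitGroup M τ) := by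
  rw [ellipticOrder, card_stabilizer]
  exact Nat.mul_div_cancel' two_dvd_card_unitGroup

lemma ellipticOrder_pos : 0 < ellipticOrder M τ := by
  have : Finite (unitGroup M τ) := finite_unitGroup
  have h : 0 < Nat.card (unitGroup M τ) := Nat.card_pos
  rw [← two_mul_ellipticOrder] at h
  omega

lemma mem_pointOrder_of_pow_eq_one {v : ℂ} (h : v ^ (2 * ellipticOrder M τ) = 1) :
    v ∈ pointOrder M τ ∧ Complex.normSq v = 1 := by
  have : Finite (unitGroup M τ) := finite_unitGroup
  set n := Nat.card (unitGroup M τ) with hn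
  have : NeZero n := ⟨Nat.card_pos.ne'⟩
  rw [two_mul_ellipticOrder, ← hn] at h
  have hv : v ≠ 0 := by
    rintro rfl
    rw [zero_pow (NeZero.ne n)] at h
    exact zero_ne_one h
  have hle : unitGroup M τ ≤ rootsOfUnity n ℂ := fun u hu => by
    rw [mem_rootsOfUnity]
    have := pow_card_eq_one' (x := (⟨u, hu⟩ : unitGroup M τ))
    exact congrArg Subtype.val this
  have heq : unitGroup M τ = rootsOfUnity n ℂ :=
    Subgroup.eq_of_le_of_card_ge hle (by rw [Complex.card_rootsOfUnity])
  have hmem : Units.mk0 v hv ∈ unitGroup M τ := by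
    rw [heq, mem_rootsOfUnity]
    exact Units.ext h
  exact hmem

end Stabilizer

/-! ### Elliptic orders at a fixed branch -/

section Elliptic

variable {N l : ℕ} [Fact l.Prime] {τ : ℍ}

/-- `A` and `B` share an eigenvector, so they commute. Modulo ℓ the kernel of `A` is spanned by (1,
0), and `B` must preserve it. -/
lemma mul_dvd_of_hasEigen (hl : ¬ l ∣ N) {δ : SL(2, ℤ)} {A B : Matrix (Fin 2) (Fin 2) ℤ}
    (hA : A = δ.1 * !![(l : ℤ), 0; 0, 1]) {α u : ℂ} (h : HasEigen A τ α) (hB : HasEigen B τ u)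
    (hN : (N : ℤ) ∣ B 1 0) : ((N * l : ℕ) : ℤ) ∣ B 1 0 := by
  have hcomm : A * B = B * A := (h.mul hB).unique (mul_comm α u ▸ hB.mul h)
  have h1 := congrFun₂ hcomm 1 0
  have h2 := congrFun₂ hcomm 1 1
  have hdet := δ.det_coe
  rw [Matrix.det_fin_two] at hdet
  rw [hA] at h1 h2
  simp [Matrix.mul_apply, Fin.sum_univ_two] at h1 h2
  have hlB : (l : ℤ) ∣ B 1 0 := by
    have : B 1 0 = δ 0 0 * (δ 1 1 * B 1 0) - δ 1 0 * (B 1 0 * δ 0 1) := by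
      linear_combination -B 1 0 * hdet
    rw [this]
    refine dvd_sub (Dvd.dvd.mul_left ?_ _) (Dvd.dvd.mul_left ?_ _)
    · exact ⟨B 1 0 * δ 0 0 + B 1 1 * δ 1 0 - δ 1 0 * B 0 0, by linear_combination h1⟩
    · exact ⟨δ 1 0 * B 0 1, by linear_combination -h2⟩
  push_cast
  exact IsCoprime.mul_dvd (Nat.isCoprime_iff_coprime.2
    (((Nat.Prime.coprime_iff_not_dvd Fact.out).2 hl).symm)) hN hlB

variable [NeZero N]

lemma pow_ellipticOrder_ne_one {α : ℂ} (hα : α ∈ pointOrder N τ) (hn : Complex.normSq α = l) :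
    ((starRingEnd ℂ) α / α) ^ ellipticOrder N τ ≠ 1 := by
  intro h
  have hm := mul_conj_eq hn
  have hα0 : α ≠ 0 := by
    rintro rfl
    rw [map_zero, eq_comm, Nat.cast_eq_zero] at hn
    exact (Fact.out : l.Prime).ne_zero hn
  -- A square root v of ᾱ/α would satisfy v^(2e) = 1 and so be a unit of the order. Then αv equals
  -- its own conjugate, hence is an integer of norm ℓ.
  obtain ⟨v, hv⟩ := IsAlgClosed.exists_pow_nat_eq ((starRingEnd ℂ) α / α) two_pos
  obtain ⟨hvm, hvn⟩ := mem_pointOrder_of_pow_eq_one (M := N) (τ := τ) (v := v)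
    (by rw [pow_mul, hv, h])
  have hvv : v * (starRingEnd ℂ) v = 1 := by rw [Complex.mul_conj, hvn]; simp
  have hmem : α * v ∈ pointOrder N τ := mul_mem hα hvm
  have hreal : (starRingEnd ℂ) (α * v) = α * v := by
    rw [eq_div_iff hα0] at hv
    rw [map_mul, ← hv]
    linear_combination v * α * hvv
  obtain ⟨k, hk⟩ := intCast_eq_of_im_eq_zero hmem (Complex.conj_eq_iff_im.1 hreal)
  exact not_isInt_of_normSq_eq (α := α * v) (l := l) (by rw [map_mul, hn, hvn, mul_one]) k hk

variable [NeZero l]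

lemma ellipticOrder_mul_eq (hl : ¬ l ∣ N) {δ : SL(2, ℤ)} {A : Matrix (Fin 2) (Fin 2) ℤ}
    (hA : A = δ.1 * !![(l : ℤ), 0; 0, 1]) {α : ℂ} (h : HasEigen A τ α) :
    ellipticOrder (N * l) τ = ellipticOrder N τ := by
  have : unitGroup (N * l) τ = unitGroup N τ := by
    ext u
    rw [mem_unitGroup, mem_unitGroup, mem_pointOrder_iff, mem_pointOrder_iff]
    refine and_congr_left fun _ => ⟨?_, ?_⟩
    · rintro ⟨B, hB, hu⟩
      exact ⟨B, (Int.natCast_dvd_natCast.2 (dvd_mul_right N l)).trans hB, hu⟩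
    · rintro ⟨B, hB, hu⟩
      exact ⟨B, mul_dvd_of_hasEigen hl hA h hu hB, hu⟩
  have h2 := two_mul_ellipticOrder (M := N * l) (τ := τ)
  rw [this, ← two_mul_ellipticOrder] at h2
  omega

end Elliptic

/-! ### Local intersection numbers -/

/-- An exponent m > 1 would give t = O(tᵐ) = o(t), impossible when t is frequently nonzero. -/
lemma ordAt_eq_one {M : ℕ} {x : ExtH} {f : ℍ → ℂ}
    (h0 : Filter.Tendsto (localCoord M x) (nhdsExt x) (nhds 0))
    (hne : ∃ᶠ z in nhdsExt x, localCoord M x z ≠ 0)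
    (hf : f =Θ[nhdsExt x] localCoord M x) : ordAt M x f = 1 := by
  refine le_antisymm (iSup₂_le fun m hm => ?_) ?_
  · by_contra hlt
    have h2 : 1 < m := by
      rw [not_le] at hlt
      exact_mod_cast hlt
    have h1 : (fun z => localCoord M x z ^ m) =o[nhdsExt x] localCoord M x := by
      have h3 : (fun z => localCoord M x z ^ (m - 1)) =o[nhdsExt x] fun _ => (1 : ℂ) := by
        rw [Asymptotics.isLittleO_one_iff]
        have := h0.pow (m - 1)
        rwa [zero_pow (by omega)] at this
      have h4 := h3.mul_isBigO (Asymptotics.isBigO_refl (localCoord M x) (nhdsExt x))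
      simp only [one_mul, ← pow_succ] at h4
      rwa [Nat.sub_add_cancel h2.le] at h4
    exact Asymptotics.isLittleO_irrefl hne ((hf.2.trans hm).trans_isLittleO h1)
  · refine le_iSup₂_of_le (f := fun (m : ℕ)
      (_ : f =O[nhdsExt x] fun z => localCoord M x z ^ m) => (m : ℕ∞)) 1 ?_ (by simp)
    simpa only [pow_one] using hf.1

lemma frequently_ne (τ : ℍ) : ∃ᶠ z in nhds τ, z ≠ τ := by
  -- The horizontal translates of τ show that τ is not isolated.
  intro h
  have hc : Continuous fun r : ℝ => r +ᵥ τ := by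
    rw [UpperHalfPlane.isEmbedding_coe.continuous_iff]
    change Continuous fun r : ℝ => ((r +ᵥ τ : ℍ) : ℂ)
    simp only [UpperHalfPlane.coe_vadd]
    fun_prop
  have ht : Filter.Tendsto (fun r : ℝ => r +ᵥ τ) (nhds 0) (nhds τ) := by
    have := hc.tendsto 0
    rwa [zero_vadd] at this
  have h1 : ∀ᶠ r : ℝ in nhdsWithin 0 {0}ᶜ, r +ᵥ τ = τ := by
    refine Filter.Eventually.filter_mono nhdsWithin_le_nhds ?_
    refine (ht.eventually h).mono fun r hr => not_not.1 hr
  have h2 : ∀ᶠ r : ℝ in nhdsWithin 0 {0}ᶜ, r ≠ 0 := eventually_mem_nhdsWithin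
  obtain ⟨r, hr, hr0⟩ := (h1.and h2).exists
  refine hr0 ?_
  have := congrArg UpperHalfPlane.re hr
  rw [UpperHalfPlane.vadd_re] at this
  linarith

lemma sub_conj_ne_zero (z τ : ℍ) : (z : ℂ) - (starRingEnd ℂ) (τ : ℂ) ≠ 0 := by
  intro h
  have := congrArg Complex.im h
  simp at this
  have h1 := z.im_pos
  have h2 := τ.im_pos
  linarith

lemma tendsto_discCoord (τ : ℍ) : Filter.Tendsto
    (fun z : ℍ => ((z : ℂ) - (τ : ℂ)) / ((z : ℂ) - (starRingEnd ℂ) (τ : ℂ))) (nhds τ) (nhds 0) := by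
  have hc : Continuous
      (fun z : ℍ => ((z : ℂ) - (τ : ℂ)) / ((z : ℂ) - (starRingEnd ℂ) (τ : ℂ))) := by
    refine Continuous.div ?_ ?_ fun z => sub_conj_ne_zero z τ
    · exact UpperHalfPlane.continuous_coe.sub continuous_const
    · exact UpperHalfPlane.continuous_coe.sub continuous_const
  simpa using hc.tendsto τ

/-- The disc coordinate moves the fixed points τ and τ̄ to 0 and ∞, so the Möbius map becomes
linear, with multiplier ᾱ/α. -/
lemma discCoord_smul {g : GL (Fin 2) ℚ} {A : Matrix (Fin 2) (Fin 2) ℤ}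
    (hg : (g : Matrix (Fin 2) (Fin 2) ℚ) = A.map (Int.cast : ℤ → ℚ)) (hA : 0 < A.det)
    {τ : ℍ} {α : ℂ} (h : HasEigen A τ α) (z : ℍ) :
    (((g.map (algebraMap ℚ ℝ) • z : ℍ) : ℂ) - τ) /
      (((g.map (algebraMap ℚ ℝ) • z : ℍ) : ℂ) - (starRingEnd ℂ) (τ : ℂ)) =
    (starRingEnd ℂ) α / α * (((z : ℂ) - τ) / ((z : ℂ) - (starRingEnd ℂ) (τ : ℂ))) := by
  rw [coe_map_smul hg hA]
  obtain ⟨h0, h1⟩ := hasEigen_iff.1 h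
  have hα : α ≠ 0 := h1 ▸ denom_ne_zero' hA.ne' τ
  have hd := denom_ne_zero' hA.ne' z
  have hα' : (starRingEnd ℂ) α ≠ 0 := (map_ne_zero _).2 hα
  have hc0 := congrArg (starRingEnd ℂ) h0
  have hc1 := congrArg (starRingEnd ℂ) h1
  simp only [map_add, map_mul, map_intCast] at hc0 hc1
  have hz := sub_conj_ne_zero z τ
  have hdet : ((A.det : ℤ) : ℂ) ≠ 0 := by exact_mod_cast hA.ne'
  have hm := h.mul_conj
  have e1 : ((A 0 0 * z + A 0 1) / (A 1 0 * z + A 1 1) - τ : ℂ) =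
      (starRingEnd ℂ) α * (z - τ) / (A 1 0 * z + A 1 1) := by
    rw [eq_div_iff hd, sub_mul, div_mul_cancel₀ _ hd]
    have ht : (starRingEnd ℂ) α = A 0 0 + A 1 1 - α := by
      have := h.add_conj
      rw [Matrix.trace_fin_two] at this
      push_cast at this
      linear_combination this
    rw [ht]
    linear_combination h0 - z * h1
  have e2 : ((A 0 0 * z + A 0 1) / (A 1 0 * z + A 1 1) - (starRingEnd ℂ) (τ : ℂ) : ℂ) =
      α * (z - (starRingEnd ℂ) (τ : ℂ)) / (A 1 0 * z + A 1 1) := by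
    rw [eq_div_iff hd, sub_mul, div_mul_cancel₀ _ hd]
    have ht : α = A 0 0 + A 1 1 - (starRingEnd ℂ) α := by
      have := h.add_conj
      rw [Matrix.trace_fin_two] at this
      push_cast at this
      linear_combination this
    rw [ht]
    linear_combination hc0 - z * hc1
  rw [e1, e2, div_div_div_cancel_right₀ hd, mul_div_mul_comm]

lemma sl_smul_map_smul (δ : SL(2, ℤ)) (g : GL (Fin 2) ℚ) (z : ℍ) :
    δ • (g.map (algebraMap ℚ ℝ) • z) =
      (Matrix.SpecialLinearGroup.mapGL ℚ δ * g).map (algebraMap ℚ ℝ) • z := by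
  rw [map_mul, mul_smul]
  have : (Matrix.SpecialLinearGroup.mapGL ℚ δ).map (algebraMap ℚ ℝ) =
      Matrix.SpecialLinearGroup.mapGL ℝ δ := by
    ext i j
    simp
  rw [this]
  rfl

lemma coe_mapGL_mul_mulMat (δ : SL(2, ℤ)) (l : ℕ) [NeZero l] :
    ((Matrix.SpecialLinearGroup.mapGL ℚ δ * mulMat l : GL (Fin 2) ℚ) :
      Matrix (Fin 2) (Fin 2) ℚ) =
      (δ.1 * !![(l : ℤ), 0; 0, 1]).map (Int.cast : ℤ → ℚ) := by
  rw [Units.val_mul, coe_mapGL_rat, coe_mulMat]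
  ext i j
  fin_cases j <;> simp [Matrix.mul_apply, Fin.sum_univ_two]

lemma det_mul_diag (δ : SL(2, ℤ)) (l : ℕ) : (δ.1 * !![(l : ℤ), 0; 0, 1]).det = l := by
  rw [Matrix.det_mul, δ.2]
  simp

lemma ordAt_point {N l : ℕ} [NeZero N] [NeZero l] [Fact l.Prime] (hl : ¬ l ∣ N) {τ : ℍ}
    {δ : SL(2, ℤ)} (hδ : δ ∈ CongruenceSubgroup.Gamma0 N)
    (h : Matrix.SpecialLinearGroup.mapGL ℚ δ • mulMat l • ExtH.point τ = ExtH.point τ) :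
    (ordAt (N * l) (ExtH.point τ) fun z : ℍ => localCoord N (ExtH.point τ) z -
      localCoord N (ExtH.point τ) (δ • ((mulMat l).map (algebraMap ℚ ℝ) • z))) = 1 := by
  set A := δ.1 * !![(l : ℤ), 0; 0, 1] with hA
  have hcoe := coe_mapGL_mul_mulMat δ l
  have hdet : A.det = l := det_mul_diag δ l
  have hpos : 0 < A.det := hdet ▸ prime_cast_pos l
  rw [smul_smul, smul_point_eq_iff hcoe hpos] at h
  rw [← hA] at h
  set α : ℂ := A 1 0 * τ + A 1 1 with hα
  have hNA : (N : ℤ) ∣ A 1 0 := by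
    have : A 1 0 = δ 1 0 * l := by simp [hA, Matrix.mul_apply, Fin.sum_univ_two]
    rw [this]
    exact (mem_gamma0_iff_dvd.1 hδ).mul_right _
  have hαm : α ∈ pointOrder N τ := mem_pointOrder_iff.2 ⟨A, hNA, h⟩
  have hαn : Complex.normSq α = l := by rw [h.normSq, hdet]; simp
  have he := ellipticOrder_mul_eq (N := N) hl hA h
  have hζ := pow_ellipticOrder_ne_one hαm hαn
  have hpos' := ellipticOrder_pos (M := N) (τ := τ)
  have hloc : ∀ z, localCoord (N * l) (ExtH.point τ) z =
      (((z : ℂ) - (τ : ℂ)) / ((z : ℂ) - (starRingEnd ℂ) (τ : ℂ))) ^ ellipticOrder N τ := by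
    intro z
    rw [← he]
    rfl
  have hf : (fun z : ℍ => localCoord N (ExtH.point τ) z -
      localCoord N (ExtH.point τ) (δ • ((mulMat l).map (algebraMap ℚ ℝ) • z))) =
      fun z => (1 - ((starRingEnd ℂ) α / α) ^ ellipticOrder N τ) *
        localCoord (N * l) (ExtH.point τ) z := by
    funext z
    rw [hloc, sl_smul_map_smul]
    change _ - (_ / _) ^ _ = _
    rw [discCoord_smul hcoe hpos h, mul_pow, sub_mul, one_mul]
    rfl
  refine ordAt_eq_one ?_ ?_ ?_
  · have := (tendsto_discCoord τ).pow (ellipticOrder N τ)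
    rw [zero_pow hpos'.ne'] at this
    exact this.congr fun z => (hloc z).symm
  · refine (frequently_ne τ).mono fun z hz => ?_
    rw [hloc]
    refine pow_ne_zero _ (div_ne_zero ?_ (sub_conj_ne_zero z τ))
    exact sub_ne_zero.2 fun h => hz (UpperHalfPlane.ext h)
  · rw [hf]
    have hc : (1 - ((starRingEnd ℂ) α / α) ^ ellipticOrder N τ) ≠ 0 :=
      sub_ne_zero.2 (Ne.symm hζ)
    exact (Asymptotics.isTheta_const_mul_left hc).2 (Asymptotics.isTheta_refl _ _)

/-! ### Matrices fixing a cusp -/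

/-- The conjugate of an integral matrix by the matrix that moves `∞` to the cusp `s`. -/
def cuspConj (s : OnePoint ℚ) (A : Matrix (Fin 2) (Fin 2) ℤ) : Matrix (Fin 2) (Fin 2) ℤ :=
  (cuspMatrix s).1.adjugate * A * (cuspMatrix s).1

lemma cuspMatrix_mul_adjugate (s : OnePoint ℚ) :
    (cuspMatrix s).1 * (cuspMatrix s).1.adjugate = 1 := by
  rw [Matrix.mul_adjugate, (cuspMatrix s).2, one_smul]

lemma adjugate_mul_cuspMatrix (s : OnePoint ℚ) :
    (cuspMatrix s).1.adjugate * (cuspMatrix s).1 = 1 := by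
  rw [Matrix.adjugate_mul, (cuspMatrix s).2, one_smul]

lemma cuspMatrix_det (s : OnePoint ℚ) :
    cuspMatrix s 0 0 * cuspMatrix s 1 1 - cuspMatrix s 0 1 * cuspMatrix s 1 0 = 1 := by
  rw [← Matrix.det_fin_two]
  exact (cuspMatrix s).2

lemma det_cuspConj (s : OnePoint ℚ) (A : Matrix (Fin 2) (Fin 2) ℤ) :
    (cuspConj s A).det = A.det := by
  have h := congrArg Matrix.det (adjugate_mul_cuspMatrix s)
  rw [Matrix.det_mul, (cuspMatrix s).2, mul_one, Matrix.det_one] at h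
  rw [cuspConj, Matrix.det_mul, Matrix.det_mul, (cuspMatrix s).2, h]
  ring

lemma cuspMatrix_mul_cuspConj (s : OnePoint ℚ) (A : Matrix (Fin 2) (Fin 2) ℤ) :
    (cuspMatrix s).1 * cuspConj s A = A * (cuspMatrix s).1 := by
  rw [cuspConj, ← Matrix.mul_assoc, ← Matrix.mul_assoc, cuspMatrix_mul_adjugate, Matrix.one_mul]

lemma eq_of_cuspConj (s : OnePoint ℚ) (A : Matrix (Fin 2) (Fin 2) ℤ) :
    A = (cuspMatrix s).1 * cuspConj s A * (cuspMatrix s).1.adjugate := by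
  rw [cuspMatrix_mul_cuspConj, Matrix.mul_assoc, cuspMatrix_mul_adjugate, Matrix.mul_one]

lemma cuspConj_mul (s : OnePoint ℚ) (A B : Matrix (Fin 2) (Fin 2) ℤ) :
    cuspConj s (A * B) = cuspConj s A * cuspConj s B := by
  calc cuspConj s (A * B) = (cuspMatrix s).1.adjugate * A *
        ((cuspMatrix s).1 * (cuspMatrix s).1.adjugate) * B * (cuspMatrix s).1 := by
        rw [cuspMatrix_mul_adjugate, Matrix.mul_one, cuspConj, Matrix.mul_assoc _ A B]
    _ = _ := by simp only [cuspConj, Matrix.mul_assoc]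

lemma cuspConj_conj (s : OnePoint ℚ) (B : Matrix (Fin 2) (Fin 2) ℤ) :
    cuspConj s ((cuspMatrix s).1 * B * (cuspMatrix s).1.adjugate) = B := by
  calc _ = ((cuspMatrix s).1.adjugate * (cuspMatrix s).1) * B *
        ((cuspMatrix s).1.adjugate * (cuspMatrix s).1) := by simp only [cuspConj, Matrix.mul_assoc]
    _ = B := by rw [adjugate_mul_cuspMatrix, Matrix.one_mul, Matrix.mul_one]

lemma cuspConj_adjugate (s : OnePoint ℚ) (A : Matrix (Fin 2) (Fin 2) ℤ) :
    cuspConj s A.adjugate = (cuspConj s A).adjugate := by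
  simp only [cuspConj, Matrix.adjugate_mul_distrib, Matrix.adjugate_adjugate' , Matrix.mul_assoc]
  simp

/-- Rewrites the level condition N ∣ A₁₀ in terms of the triangular form at the cusp. -/
lemma lower_left_eq (s : OnePoint ℚ) (A : Matrix (Fin 2) (Fin 2) ℤ) (h : cuspConj s A 1 0 = 0) :
    A 1 0 = cuspMatrix s 1 0 * ((cuspConj s A 0 0 - cuspConj s A 1 1) * cuspMatrix s 1 1 -
      cuspConj s A 0 1 * cuspMatrix s 1 0) := by
  have := congrFun₂ (eq_of_cuspConj s A) 1 0
  rw [Matrix.adjugate_fin_two] at this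
  simp only [Matrix.mul_apply, Fin.sum_univ_two, h] at this
  rw [this]
  simp
  ring

lemma coe_cuspConj {g : GL (Fin 2) ℚ} {A : Matrix (Fin 2) (Fin 2) ℤ} (s : OnePoint ℚ)
    (hg : (g : Matrix (Fin 2) (Fin 2) ℚ) = A.map (Int.cast : ℤ → ℚ)) :
    (((Matrix.SpecialLinearGroup.mapGL ℚ (cuspMatrix s))⁻¹ * g *
      Matrix.SpecialLinearGroup.mapGL ℚ (cuspMatrix s) : GL (Fin 2) ℚ) :
      Matrix (Fin 2) (Fin 2) ℚ) = (cuspConj s A).map (Int.cast : ℤ → ℚ) := by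
  rw [← map_inv, Units.val_mul, Units.val_mul, hg, coe_mapGL_rat, coe_mapGL_rat, cuspConj,
    Matrix.SpecialLinearGroup.coe_inv]
  have h : ∀ P Q : Matrix (Fin 2) (Fin 2) ℤ, (P * Q).map (Int.cast : ℤ → ℚ) =
    P.map Int.cast * Q.map Int.cast := fun P Q => Matrix.map_mul (f := Int.castRingHom ℚ)
  rw [h, h]

lemma smul_ratPoint_eq_iff {g : GL (Fin 2) ℚ} {A : Matrix (Fin 2) (Fin 2) ℤ} {s : OnePoint ℚ}
    (hg : (g : Matrix (Fin 2) (Fin 2) ℚ) = A.map (Int.cast : ℤ → ℚ)) :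
    g • ExtH.ratPoint s = ExtH.ratPoint s ↔ cuspConj s A 1 0 = 0 := by
  rw [smul_ratPoint, ExtH.ratPoint_injective.eq_iff]
  set γ := Matrix.SpecialLinearGroup.mapGL ℚ (cuspMatrix s) with hγ
  have hs : γ • (∞ : OnePoint ℚ) = s := cuspMatrix_spec s
  have : g • s = s ↔ (γ⁻¹ * g * γ) • (∞ : OnePoint ℚ) = ∞ := by
    rw [mul_smul, mul_smul, hs, inv_smul_eq_iff, hs]
  rw [this, OnePoint.smul_infty_eq_self_iff]
  have h10 := congrFun₂ (coe_cuspConj s hg) 1 0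
  rw [← hγ] at h10
  rw [h10, Matrix.map_apply, Int.cast_eq_zero]

/-- The element of `GL₂(ℚ)` acts on the tangent direction at the cusp by a multiple of `l`. -/
def IsExpanding (l : ℕ) (s : OnePoint ℚ) (g : GL (Fin 2) ℚ) : Prop :=
  ∃ A : Matrix (Fin 2) (Fin 2) ℤ, (g : Matrix (Fin 2) (Fin 2) ℚ) = A.map (Int.cast : ℤ → ℚ) ∧
    (l : ℤ) ∣ cuspConj s A 0 0

lemma isExpanding_iff {l : ℕ} {s : OnePoint ℚ} {g : GL (Fin 2) ℚ} {A : Matrix (Fin 2) (Fin 2) ℤ}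
    (hg : (g : Matrix (Fin 2) (Fin 2) ℚ) = A.map (Int.cast : ℤ → ℚ)) :
    IsExpanding l s g ↔ (l : ℤ) ∣ cuspConj s A 0 0 := by
  constructor
  · rintro ⟨B, hB, h⟩
    rwa [← Matrix.map_injective Int.cast_injective (hB.symm.trans hg)]
  · exact fun h => ⟨A, hg, h⟩

/-! ### The two branches at a fixed cusp -/

section Prime

variable {N l : ℕ} [Fact l.Prime]

/-- The diagonal entries of the conjugate at a cusp of a matrix of prime determinant. -/
lemma cuspConj_diag {s : OnePoint ℚ} {A : Matrix (Fin 2) (Fin 2) ℤ} (hA : A.det = l)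
    (h : cuspConj s A 1 0 = 0) : ∃ ε : ℤ, (ε = 1 ∨ ε = -1) ∧
      (((l : ℤ) ∣ cuspConj s A 0 0 ∧ cuspConj s A 0 0 = ε * l ∧ cuspConj s A 1 1 = ε) ∨
      (¬ (l : ℤ) ∣ cuspConj s A 0 0 ∧ cuspConj s A 0 0 = ε ∧ cuspConj s A 1 1 = ε * l)) := by
  have hp := Nat.prime_iff_prime_int.1 (Fact.out : l.Prime)
  have hdet := det_cuspConj s A
  rw [hA, Matrix.det_fin_two, h, mul_zero, sub_zero] at hdet
  by_cases hd : (l : ℤ) ∣ cuspConj s A 0 0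
  · obtain ⟨k, hk⟩ := hd
    have h1 : k * cuspConj s A 1 1 = 1 := by
      refine mul_left_cancel₀ hp.ne_zero ?_
      rw [← mul_assoc, ← hk, hdet, mul_one]
    refine ⟨k, Int.eq_one_or_neg_one_of_mul_eq_one h1, .inl ⟨⟨k, hk⟩, by rw [hk, mul_comm], ?_⟩⟩
    rcases Int.eq_one_or_neg_one_of_mul_eq_one h1 with rfl | rfl <;> omega
  · have hd' : (l : ℤ) ∣ cuspConj s A 1 1 :=
      (hp.dvd_or_dvd (Dvd.intro_left 1 (by rw [one_mul, hdet]) :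
        (l : ℤ) ∣ cuspConj s A 0 0 * cuspConj s A 1 1)).resolve_left hd
    obtain ⟨k, hk⟩ := hd'
    have h1 : k * cuspConj s A 0 0 = 1 := by
      refine mul_left_cancel₀ hp.ne_zero ?_
      rw [← mul_assoc, ← hk, mul_comm, hdet, mul_one]
    refine ⟨k, Int.eq_one_or_neg_one_of_mul_eq_one h1, .inr ⟨hd, ?_, by rw [hk, mul_comm]⟩⟩
    rcases Int.eq_one_or_neg_one_of_mul_eq_one h1 with rfl | rfl <;> omega

lemma mem_gamma0Q_of_eq_mul (hl : ¬ l ∣ N) {g h k : GL (Fin 2) ℚ}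
    {A : Matrix (Fin 2) (Fin 2) ℤ} (hg : g ∈ heckeSet N l) (hh : h ∈ heckeSet N l)
    (hk : (k : Matrix (Fin 2) (Fin 2) ℚ) = A.map (Int.cast : ℤ → ℚ)) (e : g = h * k) :
    k ∈ gamma0Q N := by
  obtain ⟨B, hB, hBN, hgB⟩ := hg
  obtain ⟨C, hC, hCN, hhC⟩ := hh
  have hl0 : (l : ℤ) ≠ 0 := by exact_mod_cast (Fact.out : l.Prime).ne_zero
  have hBC : B = C * A := by
    have : B.map (Int.cast : ℤ → ℚ) = (C * A).map (Int.cast : ℤ → ℚ) := by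
      rw [← hgB, e, Units.val_mul, hk, hhC]
      exact (Matrix.map_mul (f := Int.castRingHom ℚ)).symm
    exact Matrix.map_injective Int.cast_injective this
  rw [mem_gamma0Q]
  refine ⟨A, ?_, ?_, hk⟩
  · have := congrArg Matrix.det hBC
    rw [Matrix.det_mul, hB, hC] at this
    exact (mul_right_inj' hl0).1 (by rw [mul_one, ← this])
  · have h1 : B 1 0 = C 1 0 * A 0 0 + C 1 1 * A 1 0 := by
      rw [hBC, Matrix.mul_apply, Fin.sum_univ_two]
    have h2 : (N : ℤ) ∣ C 1 1 * A 1 0 := by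
      rw [← dvd_add_right (hCN.mul_right (A 0 0)), ← h1]
      exact hBN
    have h3 : (N : ℤ) ∣ A 1 0 * l := by
      rw [Matrix.det_fin_two] at hC
      have : A 1 0 * (l : ℤ) = (C 1 1 * A 1 0) * C 0 0 - C 1 0 * (A 1 0 * C 0 1) := by
        rw [← hC]; ring
      rw [this]
      exact dvd_sub (h2.mul_right _) (hCN.mul_right _)
    refine IsCoprime.dvd_of_dvd_mul_right ?_ h3
    exact Nat.isCoprime_iff_coprime.2 (((Nat.Prime.coprime_iff_not_dvd Fact.out).2 hl).symm)

/-- The inverse of a triangular matrix has ℓ in its denominators. For diagonal ±(ℓ, 1) they cancel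
in A' A⁻¹, for ±(1, ℓ) in A⁻¹ A'; hence the alternative. -/
lemma exists_integral_quotient {s : OnePoint ℚ} {A A' : Matrix (Fin 2) (Fin 2) ℤ}
    (hA : A.det = l) (hA' : A'.det = l) (h : cuspConj s A 1 0 = 0) (h' : cuspConj s A' 1 0 = 0)
    (hd : (l : ℤ) ∣ cuspConj s A 0 0 ↔ (l : ℤ) ∣ cuspConj s A' 0 0) :
    ∃ U : Matrix (Fin 2) (Fin 2) ℤ, cuspConj s U 1 0 = 0 ∧ (A' = U * A ∨ A' = A * U) := by
  have hinj : ∀ {P Q : Matrix (Fin 2) (Fin 2) ℤ}, cuspConj s P = cuspConj s Q → P = Q :=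
    fun {P Q} e => by rw [eq_of_cuspConj s P, e, ← eq_of_cuspConj]
  obtain ⟨ε, hε, hc⟩ := cuspConj_diag hA h
  obtain ⟨ε', hε', hc'⟩ := cuspConj_diag hA' h'
  have h2 : ε * ε = 1 := by rcases hε with rfl | rfl <;> rfl
  rcases hc with ⟨h1, e0, e1⟩ | ⟨h1, e0, e1⟩
  · obtain ⟨-, e0', e1'⟩ := hc'.resolve_right fun hc' => hc'.1 (hd.1 h1)
    refine ⟨(cuspMatrix s).1 * !![ε * ε', ε * (cuspConj s A' 0 1 - ε * ε' * cuspConj s A 0 1);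
      0, ε * ε'] * (cuspMatrix s).1.adjugate, by rw [cuspConj_conj]; simp, .inl (hinj ?_)⟩
    rw [cuspConj_mul, cuspConj_conj]
    ext i j
    fin_cases i <;> fin_cases j <;> simp [Matrix.mul_apply, Fin.sum_univ_two, h, h', e0, e0', e1,
      e1']
    · linear_combination -(ε' * l) * h2
    · linear_combination (ε * ε' * cuspConj s A 0 1 - cuspConj s A' 0 1) * h2
    · linear_combination -ε' * h2
  · obtain ⟨-, e0', e1'⟩ := hc'.resolve_left fun hc' => h1 (hd.2 hc'.1)
    refine ⟨(cuspMatrix s).1 * !![ε * ε', ε * (cuspConj s A' 0 1 - ε * ε' * cuspConj s A 0 1);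
      0, ε * ε'] * (cuspMatrix s).1.adjugate, by rw [cuspConj_conj]; simp, .inr (hinj ?_)⟩
    rw [cuspConj_mul, cuspConj_conj]
    ext i j
    fin_cases i <;> fin_cases j <;> simp [Matrix.mul_apply, Fin.sum_univ_two, h, h', e0, e0', e1,
      e1']
    · linear_combination -ε' * h2
    · linear_combination (ε * ε' * cuspConj s A 0 1 - cuspConj s A' 0 1) * h2
    · linear_combination -(ε' * l) * h2

lemma cuspConj_unit_diag {s : OnePoint ℚ} {A : Matrix (Fin 2) (Fin 2) ℤ} (hA : A.det = 1)
    (h : cuspConj s A 1 0 = 0) : IsUnit (cuspConj s A 0 0) := by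
  have hdet := det_cuspConj s A
  rw [hA, Matrix.det_fin_two, h, mul_zero, sub_zero] at hdet
  exact IsUnit.of_mul_eq_one _ hdet

/-- Within one type the integral quotient lies in Γ₀(N). Conversely, stabilisers have diagonal
entries ±1 at the cusp and cannot change the type. -/
lemma isExpanding_eq_iff (hl : ¬ l ∣ N) {s : OnePoint ℚ} {g h : GL (Fin 2) ℚ}
    (hg : g ∈ fixers N l (ExtH.ratPoint s)) (hh : h ∈ fixers N l (ExtH.ratPoint s)) :
    IsExpanding l s g = IsExpanding l s h ↔
      ∃ u ∈ gamma0Q N, ∃ v ∈ gamma0Q N, u • ExtH.ratPoint s = ExtH.ratPoint s ∧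
        v • ExtH.ratPoint s = ExtH.ratPoint s ∧ h = u * g * v := by
  obtain ⟨hgm, hgs⟩ := hg
  obtain ⟨hhm, hhs⟩ := hh
  obtain ⟨A, hA, hAN, hgA⟩ := id hgm
  obtain ⟨B, hB, hBN, hhB⟩ := id hhm
  rw [smul_ratPoint_eq_iff hgA] at hgs
  rw [smul_ratPoint_eq_iff hhB] at hhs
  rw [eq_iff_iff, isExpanding_iff hgA, isExpanding_iff hhB]
  have hmap : ∀ P Q : Matrix (Fin 2) (Fin 2) ℤ, (P * Q).map (Int.cast : ℤ → ℚ) =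
    P.map Int.cast * Q.map Int.cast := fun P Q => Matrix.map_mul (f := Int.castRingHom ℚ)
  have hl0 : (l : ℤ) ≠ 0 := by exact_mod_cast (Fact.out : l.Prime).ne_zero
  constructor
  · intro hd
    obtain ⟨U, hU, e⟩ := exists_integral_quotient hA hB hgs hhs hd
    have hUdet : U.det ≠ 0 := by
      intro h0
      rcases e with e | e <;>
      · rw [e, Matrix.det_mul, h0] at hB
        simp at hB
        exact hl0 hB.symm
    obtain ⟨u, hu⟩ := exists_coe_eq_map hUdet
    rcases e with e | e
    · have e' : h = u * g := Units.ext (by rw [Units.val_mul, hhB, hu, hgA, e, hmap])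
      exact ⟨u, mem_gamma0Q_of_mul_eq hl hhm hgm hu e', 1, one_mem _,
        (smul_ratPoint_eq_iff hu).2 hU, one_smul _ _, by rw [mul_one, e']⟩
    · have e' : h = g * u := Units.ext (by rw [Units.val_mul, hhB, hu, hgA, e, hmap])
      exact ⟨1, one_mem _, u, mem_gamma0Q_of_eq_mul hl hhm hgm hu e',
        one_smul _ _, (smul_ratPoint_eq_iff hu).2 hU, by rw [one_mul, e']⟩
  · rintro ⟨u, hu, v, hv, hus, hvs, rfl⟩
    obtain ⟨U, hU, -, huU⟩ := mem_gamma0Q.1 hu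
    obtain ⟨V, hV, -, hvV⟩ := mem_gamma0Q.1 hv
    rw [smul_ratPoint_eq_iff huU] at hus
    rw [smul_ratPoint_eq_iff hvV] at hvs
    have e : B = U * A * V := by
      refine Matrix.map_injective (Int.cast_injective (α := ℚ)) ?_
      change B.map (Int.cast : ℤ → ℚ) = (U * A * V).map (Int.cast : ℤ → ℚ)
      rw [← hhB, hmap, hmap, ← huU, ← hgA, ← hvV, Units.val_mul, Units.val_mul]
    have h00 : cuspConj s B 0 0 = cuspConj s U 0 0 * cuspConj s A 0 0 * cuspConj s V 0 0 := by
      rw [e, cuspConj_mul, cuspConj_mul]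
      simp [Matrix.mul_apply, Fin.sum_univ_two, hgs, hvs]
    rw [h00, (cuspConj_unit_diag hV hvs).dvd_mul_right, (cuspConj_unit_diag hU hus).dvd_mul_left]

/-- The adjugate, which corresponds to the dual isogeny, interchanges the diagonal entries. -/
lemma exists_swap {s : OnePoint ℚ} {g : GL (Fin 2) ℚ} (hg : g ∈ fixers N l (ExtH.ratPoint s)) :
    ∃ h ∈ fixers N l (ExtH.ratPoint s), IsExpanding l s h = ¬ IsExpanding l s g := by
  have hp := Nat.prime_iff_prime_int.1 (Fact.out : l.Prime)
  obtain ⟨⟨A, hA, hAN, hgA⟩, hgs⟩ := hg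
  rw [smul_ratPoint_eq_iff hgA] at hgs
  have hdet : A.adjugate.det = l := by
    rw [Matrix.adjugate_fin_two, Matrix.det_fin_two_of]
    rw [Matrix.det_fin_two] at hA
    linarith
  obtain ⟨h, hh⟩ := exists_coe_eq_map (A := A.adjugate) (hdet ▸ hp.ne_zero)
  have hadj := cuspConj_adjugate s A
  rw [Matrix.adjugate_fin_two (cuspConj s A)] at hadj
  refine ⟨h, ⟨⟨_, hdet, ?_, hh⟩, ?_⟩, ?_⟩
  · rw [Matrix.adjugate_fin_two]
    simpa using hAN
  · rw [smul_ratPoint_eq_iff hh, hadj]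
    simpa using hgs
  · rw [eq_iff_iff, isExpanding_iff hgA, isExpanding_iff hh, hadj]
    obtain ⟨ε, hε, ⟨h1, e0, e1⟩ | ⟨h1, e0, e1⟩⟩ := cuspConj_diag hA hgs
    · simp only [h1, not_true, iff_false]
      simp only [e1, Matrix.of_apply, Matrix.cons_val_zero]
      intro h
      have h1' : IsUnit ε := Int.isUnit_iff.2 hε
      exact hp.not_isUnit (isUnit_of_dvd_unit h h1')
    · simp only [h1, not_false_iff, iff_true]
      simp only [e1, Matrix.of_apply, Matrix.cons_val_zero]
      exact Dvd.intro_left _ rfl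

variable [NeZero l]

lemma fixSet_cusp_finite (hl : ¬ l ∣ N) (s : OnePoint ℚ) :
    (fixSet N l (X0.cusp N s)).Finite :=
  (fixSet_ncard hl (ExtH.ratPoint s) (IsExpanding l s)
    (fun _ hg _ hh => isExpanding_eq_iff hl hg hh)).2 (Set.toFinite _)

lemma fixSet_cusp_ncard_eq_two (hl : ¬ l ∣ N) {s : OnePoint ℚ}
    (hne : (fixers N l (ExtH.ratPoint s)).Nonempty) : (fixSet N l (X0.cusp N s)).ncard = 2 := by
  refine (fixSet_ncard hl (ExtH.ratPoint s) (IsExpanding l s)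
    (fun _ hg _ hh => isExpanding_eq_iff hl hg hh)).1.trans ?_
  have : IsExpanding l s '' fixers N l (ExtH.ratPoint s) = {True, False} := by
    obtain ⟨g, hg⟩ := hne
    obtain ⟨h, hh, e⟩ := exists_swap hg
    ext p
    simp only [Set.mem_image, Set.mem_insert_iff, Set.mem_singleton_iff]
    constructor
    · rintro -
      exact Classical.propComplete p
    · intro _
      by_cases hp : p = IsExpanding l s g
      · exact ⟨g, hg, hp.symm⟩
      · refine ⟨h, hh, ?_⟩
        rw [e]
        by_cases h1 : p <;> by_cases h2 : IsExpanding l s g <;> simp_all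
  rw [this, Set.ncard_pair]
  simp

lemma fixSet_cusp_ncard_eq_zero (hl : ¬ l ∣ N) {s : OnePoint ℚ}
    (hne : ¬ (fixers N l (ExtH.ratPoint s)).Nonempty) :
    (fixSet N l (X0.cusp N s)).ncard = 0 := by
  refine (fixSet_ncard hl (ExtH.ratPoint s) (IsExpanding l s)
    (fun _ hg _ hh => isExpanding_eq_iff hl hg hh)).1.trans ?_
  rw [Set.not_nonempty_iff_eq_empty.1 hne]
  simp

lemma fixSet_cusp_ncard_ne_zero (hl : ¬ l ∣ N) {s : OnePoint ℚ} :
    (fixSet N l (X0.cusp N s)).ncard ≠ 0 ↔ (fixers N l (ExtH.ratPoint s)).Nonempty := by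
  constructor
  · intro h
    by_contra hne
    exact h (fixSet_cusp_ncard_eq_zero hl hne)
  · intro h
    rw [fixSet_cusp_ncard_eq_two hl h]
    exact two_ne_zero

end Prime

/-! ### Which cusps are fixed -/

section Cusps

variable {N l : ℕ} [Fact l.Prime]

/-- Up to sign and adjugate a fixer has the triangular form (ℓ, b; 0, 1), so only the integer b is
free. -/
lemma fixers_cusp_nonempty_iff {s : OnePoint ℚ} : (fixers N l (ExtH.ratPoint s)).Nonempty ↔
    ∃ b : ℤ, (N : ℤ) ∣ cuspMatrix s 1 0 * ((l - 1) * cuspMatrix s 1 1 - b * cuspMatrix s 1 0) := by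
  constructor
  · rintro ⟨g, ⟨A, hA, hAN, hgA⟩, hgs⟩
    rw [smul_ratPoint_eq_iff hgA] at hgs
    rw [lower_left_eq s A hgs] at hAN
    obtain ⟨ε, hε, ⟨-, e0, e1⟩ | ⟨-, e0, e1⟩⟩ := cuspConj_diag hA hgs <;> rw [e0, e1] at hAN
    · refine ⟨ε * cuspConj s A 0 1, ?_⟩
      have h2 : ε * ε = 1 := by rcases hε with rfl | rfl <;> rfl
      refine (hAN.mul_left ε).trans (dvd_of_eq ?_)
      linear_combination (cuspMatrix s 1 0 * ((l : ℤ) - 1) * cuspMatrix s 1 1) * h2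
    · refine ⟨-(ε * cuspConj s A 0 1), ?_⟩
      have h2 : ε * ε = 1 := by rcases hε with rfl | rfl <;> rfl
      refine (hAN.mul_left (-ε)).trans (dvd_of_eq ?_)
      linear_combination (cuspMatrix s 1 0 * ((l : ℤ) - 1) * cuspMatrix s 1 1) * h2
  · rintro ⟨b, hb⟩
    set A := (cuspMatrix s).1 * !![(l : ℤ), b; 0, 1] * (cuspMatrix s).1.adjugate with hA
    have hconj : cuspConj s A = !![(l : ℤ), b; 0, 1] := cuspConj_conj s _
    have hdet : A.det = l := by
      rw [← det_cuspConj s A, hconj]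
      simp
    have h10 : cuspConj s A 1 0 = 0 := by rw [hconj]; rfl
    obtain ⟨g, hg⟩ := exists_coe_eq_map (A := A) (hdet ▸ (prime_cast_pos l).ne')
    refine ⟨g, ⟨A, hdet, ?_, hg⟩, (smul_ratPoint_eq_iff hg).2 h10⟩
    rw [lower_left_eq s A h10, hconj]
    exact hb

lemma mapGL_smul_infty (γ : SL(2, ℤ)) :
    Matrix.SpecialLinearGroup.mapGL ℚ γ • (∞ : OnePoint ℚ) =
      if γ 1 0 = 0 then ∞ else (((γ 0 0 : ℚ) / (γ 1 0 : ℚ) : ℚ) : OnePoint ℚ) := by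
  rw [OnePoint.smul_infty_eq_ite]
  simp

/-- The first column of the chosen matrix is primitive and proportional to (a, d), which leaves only
a sign. -/
lemma cuspMatrix_lower_left {a : ℤ} {d : ℕ} (hd : d ≠ 0) (had : IsCoprime a (d : ℤ)) :
    cuspMatrix (((a : ℚ) / (d : ℚ) : ℚ) : OnePoint ℚ) 1 0 = d ∨
      cuspMatrix (((a : ℚ) / (d : ℚ) : ℚ) : OnePoint ℚ) 1 0 = -d := by
  set s : OnePoint ℚ := (((a : ℚ) / (d : ℚ) : ℚ) : OnePoint ℚ) with hs
  have h := cuspMatrix_spec s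
  have hdet := cuspMatrix_det s
  rw [mapGL_smul_infty] at h
  split_ifs at h with h0
  · exact absurd h (OnePoint.infty_ne_coe _)
  · rw [hs, OnePoint.coe_eq_coe, ← hs] at h
    have hdQ : (d : ℚ) ≠ 0 := by exact_mod_cast hd
    have h0Q : (cuspMatrix s 1 0 : ℚ) ≠ 0 := by exact_mod_cast h0
    rw [div_eq_div_iff h0Q hdQ] at h
    have h' : cuspMatrix s 0 0 * d = a * cuspMatrix s 1 0 := by exact_mod_cast h
    have h1 : (d : ℤ) ∣ cuspMatrix s 1 0 :=
      had.symm.dvd_of_dvd_mul_left ⟨cuspMatrix s 0 0, by rw [← h']; ring⟩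
    have h2 : cuspMatrix s 1 0 ∣ d := by
      have hc : IsCoprime (cuspMatrix s 1 0) (cuspMatrix s 0 0) :=
        ⟨-cuspMatrix s 0 1, cuspMatrix s 1 1, by linear_combination hdet⟩
      exact hc.dvd_of_dvd_mul_left ⟨a, by rw [h']; ring⟩
    rcases Int.natAbs_eq_natAbs_iff.1 (Int.natAbs_eq_of_dvd_dvd h1 h2) with h3 | h3
    · exact .inl h3.symm
    · exact .inr (by rw [h3, neg_neg])

/-- With N = dn and lower row (±d, y), the condition is that (ℓ - 1)y ≡ bd modulo n has a solution
b, that is, gcd(d, n) divides (ℓ - 1)y. The determinant makes y prime to d. -/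
lemma fixers_cusp_div_nonempty_iff [NeZero N] {a : ℤ} {d : ℕ} (hdN : d ∣ N)
    (had : IsCoprime a (d : ℤ)) :
    (fixers N l (ExtH.ratPoint (((a : ℚ) / (d : ℚ) : ℚ) : OnePoint ℚ))).Nonempty ↔
      l ≡ 1 [MOD Nat.gcd d (N / d)] := by
  have hd : d ≠ 0 := by
    rintro rfl
    exact NeZero.ne N (zero_dvd_iff.1 hdN)
  rw [fixers_cusp_nonempty_iff]
  have hc := cuspMatrix_lower_left hd had
  set s : OnePoint ℚ := (((a : ℚ) / (d : ℚ) : ℚ) : OnePoint ℚ) with hs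
  have hdet := cuspMatrix_det s
  obtain ⟨n, rfl⟩ := hdN
  rw [Nat.mul_div_cancel_left n (Nat.pos_of_ne_zero hd)]
  have hdZ : (d : ℤ) ≠ 0 := by exact_mod_cast hd
  set y := cuspMatrix s 1 1 with hy
  have hcop : IsCoprime ((Nat.gcd d n : ℕ) : ℤ) y := by
    have h1 : IsCoprime (d : ℤ) y := by
      rcases hc with hc | hc <;> rw [hc] at hdet
      · exact ⟨-cuspMatrix s 0 1, cuspMatrix s 0 0, by linear_combination hdet⟩
      · exact ⟨cuspMatrix s 0 1, cuspMatrix s 0 0, by linear_combination hdet⟩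
    exact h1.of_isCoprime_of_dvd_left (Int.natCast_dvd_natCast.2 (Nat.gcd_dvd_left d n))
  have key : (∃ b : ℤ, ((d * n : ℕ) : ℤ) ∣ cuspMatrix s 1 0 *
      ((l - 1) * y - b * cuspMatrix s 1 0)) ↔ ∃ b : ℤ, (n : ℤ) ∣ (l - 1) * y - b * d := by
    push_cast
    rcases hc with hc | hc <;> rw [hc]
    · exact exists_congr fun b => mul_dvd_mul_iff_left hdZ
    · constructor
      · rintro ⟨b, hb⟩
        rw [neg_mul, dvd_neg, mul_dvd_mul_iff_left hdZ] at hb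
        exact ⟨-b, by simpa using hb⟩
      · rintro ⟨b, hb⟩
        refine ⟨-b, ?_⟩
        rw [neg_mul, dvd_neg, mul_dvd_mul_iff_left hdZ]
        simpa using hb
  rw [key, Nat.ModEq.comm, Nat.modEq_iff_dvd]
  constructor
  · rintro ⟨b, hb⟩
    have h1 : ((Nat.gcd d n : ℕ) : ℤ) ∣ (l - 1) * y - b * d :=
      (Int.natCast_dvd_natCast.2 (Nat.gcd_dvd_right d n)).trans hb
    have h2 : ((Nat.gcd d n : ℕ) : ℤ) ∣ b * d :=
      (Int.natCast_dvd_natCast.2 (Nat.gcd_dvd_left d n)).mul_left b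
    have h3 := (dvd_sub_left h2).1 h1
    exact hcop.dvd_of_dvd_mul_right (by simpa using h3)
  · intro h
    obtain ⟨k, hk⟩ := h
    have hb := Nat.gcd_eq_gcd_ab d n
    refine ⟨k * y * Nat.gcdA d n, k * y * Nat.gcdB d n, ?_⟩
    push_cast at hk
    rw [hk]
    linear_combination k * y * hb

end Cusps

/-! ### Representatives of the cusps -/

lemma exists_isCoprime_add_mul {v m : ℤ} (h : IsCoprime v m) {N : ℕ} (hN : N ≠ 0) :
    ∃ k : ℤ, IsCoprime (v + k * m) (N : ℤ) := by
  classical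
  -- With this k, every prime factor of N divides exactly one of v and km.
  refine ⟨∏ p ∈ N.primeFactors.filter (fun p : ℕ => ¬ (p : ℤ) ∣ v), (p : ℤ), ?_⟩
  set k : ℤ := ∏ p ∈ N.primeFactors.filter (fun p : ℕ => ¬ (p : ℤ) ∣ v), (p : ℤ) with hk
  rw [Int.isCoprime_iff_nat_coprime]
  refine Nat.Coprime.symm (Nat.Coprime.symm (Nat.coprime_of_dvd fun p hp h1 h2 => ?_))
  have hpi := Nat.prime_iff_prime_int.1 hp
  rw [Int.natAbs_natCast] at h2
  have h1' : (p : ℤ) ∣ v + k * m := Int.natCast_dvd.2 h1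
  by_cases hv : (p : ℤ) ∣ v
  · have hkm := (dvd_add_right hv).1 h1'
    rcases hpi.dvd_or_dvd hkm with hd | hd
    · rw [hk, hpi.dvd_finsetProd_iff] at hd
      obtain ⟨q, hq, hpq⟩ := hd
      rw [Finset.mem_filter, Nat.mem_primeFactors] at hq
      rw [Int.natCast_dvd_natCast, Nat.prime_dvd_prime_iff_eq hp hq.1.1] at hpq
      exact hq.2 (hpq ▸ hv)
    · exact hpi.not_isUnit (h.isUnit_of_dvd' hv hd)
  · have hpk : (p : ℤ) ∣ k := by
      refine Finset.dvd_prod_of_mem (fun p : ℕ => (p : ℤ)) ?_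
      rw [Finset.mem_filter, Nat.mem_primeFactors]
      exact ⟨⟨hp, h2, hN⟩, hv⟩
    exact hv ((dvd_add_left (hpk.mul_right m)).1 h1')

lemma exists_cusp_eq (N : ℕ) [NeZero N] (s : OnePoint ℚ) :
    ∃ (a : ℤ) (d : ℕ), d ∣ N ∧ IsCoprime a (d : ℤ) ∧
      X0.cusp N s = X0.cusp N (((a : ℚ) / (d : ℚ) : ℚ) : OnePoint ℚ) := by
  set γ := cuspMatrix s with hγ
  have hdet : γ 0 0 * γ 1 1 - γ 0 1 * γ 1 0 = 1 := cuspMatrix_det s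
  set d := Nat.gcd N (γ 1 0).natAbs with hd
  have hdN : d ∣ N := Nat.gcd_dvd_left _ _
  have hd0 : d ≠ 0 := fun h => NeZero.ne N (Nat.eq_zero_of_gcd_eq_zero_left h)
  have hdZ : (d : ℤ) ≠ 0 := by exact_mod_cast hd0
  obtain ⟨n, hn⟩ := hdN
  have hnZ : (N : ℤ) = d * n := by exact_mod_cast hn
  obtain ⟨c, hc⟩ : (d : ℤ) ∣ γ 1 0 := Int.natCast_dvd.2 (Nat.gcd_dvd_right _ _)
  -- An element of Γ₀(N) with lower row (Nu, v) makes the lower left entry equal to d when this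
  -- equation, already divided by d, holds.
  obtain ⟨u₀, v₀, huv⟩ : ∃ u v : ℤ, n * γ 0 0 * u + c * v = 1 := by
    have h1 : IsCoprime (n : ℤ) c := by
      have hb := Int.gcd_eq_gcd_ab (N : ℤ) (γ 1 0)
      have hb' : (d : ℤ) = N * Int.gcdA N (γ 1 0) + γ 1 0 * Int.gcdB N (γ 1 0) := by
        rw [← hb, hd, Int.gcd, Int.natAbs_natCast]
      refine ⟨Int.gcdA N (γ 1 0), Int.gcdB N (γ 1 0), mul_left_cancel₀ hdZ ?_⟩
      linear_combination -hb' - Int.gcdA N (γ 1 0) * hnZ - Int.gcdB N (γ 1 0) * hc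
    have h2 : IsCoprime (γ 0 0) c := ⟨γ 1 1, -(γ 0 1 * d), by rw [hc] at hdet; linarith⟩
    obtain ⟨u, v, h⟩ := h1.mul_left h2
    exact ⟨u, v, by linarith⟩
  -- To be a lower row, (Nu, v) must be coprime. The equation makes v prime to u; moving along its
  -- solutions makes v prime to N.
  obtain ⟨k, hk⟩ := exists_isCoprime_add_mul (v := v₀) (m := n * γ 0 0)
    ⟨c, u₀, by linarith⟩ (NeZero.ne N)
  set v := v₀ + k * (n * γ 0 0) with hv
  set u := u₀ - k * c with hu
  have huv' : n * γ 0 0 * u + c * v = 1 := by rw [hu, hv]; linear_combination huv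
  have hcop : IsCoprime (N * u) v := IsCoprime.mul_left hk.symm ⟨n * γ 0 0, c, huv'⟩
  obtain ⟨q, p, hpq⟩ := hcop
  let σ : SL(2, ℤ) := ⟨!![p, -q; N * u, v], by simp; linarith⟩
  have hσ : σ ∈ CongruenceSubgroup.Gamma0 N := mem_gamma0_iff_dvd.2 ⟨u, rfl⟩
  have h00 : (σ * γ) 0 0 = p * γ 0 0 - q * γ 1 0 := by
    rw [Matrix.SpecialLinearGroup.coe_mul, Matrix.mul_apply, Fin.sum_univ_two, sub_eq_add_neg,
      ← neg_mul]
    rfl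
  have h10 : (σ * γ) 1 0 = d := by
    have : (σ * γ) 1 0 = N * u * γ 0 0 + v * γ 1 0 := by
      rw [Matrix.SpecialLinearGroup.coe_mul, Matrix.mul_apply, Fin.sum_univ_two]
      rfl
    rw [this, hc, hnZ]
    linear_combination d * huv'
  refine ⟨(σ * γ) 0 0, d, ⟨n, hn⟩, ?_, ?_⟩
  · have := (σ * γ).2
    rw [Matrix.det_fin_two] at this
    refine ⟨(σ * γ) 1 1, -(σ * γ) 0 1, ?_⟩
    rw [← h10]
    linear_combination this
  · refine X0.mk_eq_mk.2 ⟨_, mapGL_mem_gamma0Q.2 hσ, ?_⟩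
    change _ • ExtH.ratPoint s = ExtH.ratPoint _
    rw [smul_ratPoint]
    congr 1
    conv_lhs => rw [← cuspMatrix_spec s, smul_smul, ← map_mul]
    rw [mapGL_smul_infty, ← hγ, if_neg (by rw [h10]; exact hdZ), h10]
    norm_cast

/-! ### Width of a cusp and local intersection numbers at cusps -/

section Width

variable {M : ℕ} [NeZero M] {s : OnePoint ℚ}

lemma mem_width_iff {M : ℕ} {s : OnePoint ℚ} (h : ℕ) :
    cuspMatrix s * ModularGroup.T ^ h * (cuspMatrix s)⁻¹ ∈ CongruenceSubgroup.Gamma0 M ↔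
      (M : ℤ) ∣ h * cuspMatrix s 1 0 ^ 2 := by
  rw [mem_gamma0_iff_dvd]
  have hdet := cuspMatrix_det s
  have : (cuspMatrix s * ModularGroup.T ^ h * (cuspMatrix s)⁻¹) 1 0 =
      -(h * cuspMatrix s 1 0 ^ 2) := by
    rw [← zpow_natCast, Matrix.SpecialLinearGroup.coe_mul, Matrix.SpecialLinearGroup.coe_mul,
      ModularGroup.coe_T_zpow, Matrix.SpecialLinearGroup.coe_inv, Matrix.adjugate_fin_two]
    simp [Matrix.mul_apply, Fin.sum_univ_two]
    ring
  rw [this, dvd_neg]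

lemma cuspWidth_spec : 0 < cuspWidth M s ∧
    (M : ℤ) ∣ cuspWidth M s * cuspMatrix s 1 0 ^ 2 := by
  have hne : {h : ℕ | 0 < h ∧ cuspMatrix s * ModularGroup.T ^ h * (cuspMatrix s)⁻¹ ∈
      CongruenceSubgroup.Gamma0 M}.Nonempty :=
    ⟨M, Nat.pos_of_ne_zero (NeZero.ne M), (mem_width_iff M).2 (Dvd.intro _ rfl)⟩
  have := Nat.sInf_mem hne
  exact ⟨this.1, (mem_width_iff _).1 this.2⟩

/-- The admissible translations are the multiples of the least one. In this form, widths at two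
levels are compared by divisibility. -/
lemma cuspWidth_dvd_iff (k : ℕ) : cuspWidth M s ∣ k ↔ (M : ℤ) ∣ k * cuspMatrix s 1 0 ^ 2 := by
  obtain ⟨hpos, hdvd⟩ := cuspWidth_spec (M := M) (s := s)
  constructor
  · rintro ⟨r, rfl⟩
    refine (hdvd.mul_right (r : ℤ)).trans (dvd_of_eq ?_)
    push_cast
    ring
  · intro h
    by_contra hk
    have hmod : 0 < k % cuspWidth M s :=
      Nat.pos_of_ne_zero fun h0 => hk (Nat.dvd_of_mod_eq_zero h0)
    have hmem : (M : ℤ) ∣ ((k % cuspWidth M s : ℕ) : ℤ) * cuspMatrix s 1 0 ^ 2 := by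
      have e : (k : ℤ) = ((k % cuspWidth M s : ℕ) : ℤ) +
          cuspWidth M s * (k / cuspWidth M s : ℕ) := by
        exact_mod_cast (Nat.mod_add_div k (cuspWidth M s)).symm
      have : ((k % cuspWidth M s : ℕ) : ℤ) * cuspMatrix s 1 0 ^ 2 = k * cuspMatrix s 1 0 ^ 2 -
          (cuspWidth M s * cuspMatrix s 1 0 ^ 2) * (k / cuspWidth M s : ℕ) := by
        rw [e]
        ring
      rw [this]
      exact dvd_sub h (hdvd.mul_right _)
    have hle : cuspWidth M s ≤ k % cuspWidth M s := Nat.sInf_le ⟨hmod, (mem_width_iff _).2 hmem⟩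
    exact absurd (Nat.mod_lt k hpos) (not_lt.2 hle)

end Width

/-! ### Transversality at the cusps and the total multiplicity -/

section Branch

variable {N l : ℕ} [NeZero N] [NeZero l] [Fact l.Prime] {s : OnePoint ℚ}

lemma cuspWidth_mul_of_dvd (hl : ¬ l ∣ N) (h : (l : ℤ) ∣ cuspMatrix s 1 0) :
    cuspWidth (N * l) s = cuspWidth N s := by
  refine Nat.dvd_right_iff_eq.1 fun k => ?_
  rw [cuspWidth_dvd_iff, cuspWidth_dvd_iff]
  have hcop : IsCoprime (N : ℤ) (l : ℤ) :=
    Nat.isCoprime_iff_coprime.2 (((Nat.Prime.coprime_iff_not_dvd Fact.out).2 hl).symm)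
  push_cast
  refine ⟨fun hk => (dvd_mul_right _ _).trans hk, fun hk => hcop.mul_dvd hk ?_⟩
  exact (Dvd.dvd.mul_left (h.trans (dvd_pow_self _ two_ne_zero)) _)

/-- When ℓ is prime to the lower left entry, the extra condition at level Nℓ is that ℓ divide the
translation. -/
lemma cuspWidth_mul_of_not_dvd (hl : ¬ l ∣ N) (h : ¬ (l : ℤ) ∣ cuspMatrix s 1 0) :
    cuspWidth (N * l) s = l * cuspWidth N s := by
  have hpi := Nat.prime_iff_prime_int.1 (Fact.out : l.Prime)
  have hc : Nat.Coprime l N := (Nat.Prime.coprime_iff_not_dvd Fact.out).2 hl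
  have hcop : IsCoprime (N : ℤ) (l : ℤ) := Nat.isCoprime_iff_coprime.2 hc.symm
  have hwN : cuspWidth N s ∣ N := (cuspWidth_dvd_iff N).2 (Dvd.intro _ rfl)
  refine Nat.dvd_right_iff_eq.1 fun k => ?_
  rw [cuspWidth_dvd_iff]
  push_cast
  constructor
  · intro hk
    refine Nat.Coprime.mul_dvd_of_dvd_of_dvd (hc.coprime_dvd_right hwN) ?_ ?_
    · have h1 : (l : ℤ) ∣ k * cuspMatrix s 1 0 ^ 2 := (dvd_mul_left _ _).trans hk
      have h2 := (hpi.dvd_or_dvd h1).resolve_right fun h' => h (hpi.dvd_of_dvd_pow h')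
      exact_mod_cast h2
    · rw [cuspWidth_dvd_iff]
      exact (dvd_mul_right _ _).trans hk
  · intro hk
    refine hcop.mul_dvd ((cuspWidth_dvd_iff k).1 ((dvd_mul_left _ _).trans hk)) ?_
    have : (l : ℤ) ∣ k := by exact_mod_cast (dvd_mul_right _ _).trans hk
    exact this.mul_right _

lemma localCoord_ratPoint (M : ℕ) (s : OnePoint ℚ) (z : ℍ) :
    localCoord M (ExtH.ratPoint s) z = Function.Periodic.qParam (cuspWidth M s)
      (((cuspMatrix s)⁻¹ • z : ℍ) : ℂ) := by
  rw [Function.Periodic.qParam]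
  push_cast
  rfl

lemma tendsto_localCoord_ratPoint (M : ℕ) [NeZero M] (s : OnePoint ℚ) :
    Filter.Tendsto (localCoord M (ExtH.ratPoint s)) (nhdsExt (ExtH.ratPoint s)) (nhds 0) := by
  change Filter.Tendsto _ (Filter.map (fun z : ℍ => cuspMatrix s • z) _) _
  rw [Filter.tendsto_map'_iff]
  have hpos : (0 : ℝ) < cuspWidth M s := by exact_mod_cast cuspWidth_spec.1
  refine (UpperHalfPlane.qParam_tendsto_atImInfty hpos).congr fun z => ?_
  rw [Function.comp_apply, localCoord_ratPoint, inv_smul_smul]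

instance (s : OnePoint ℚ) : (nhdsExt (ExtH.ratPoint s)).NeBot :=
  inferInstanceAs (Filter.map (fun z : ℍ => cuspMatrix s • z) UpperHalfPlane.atImInfty).NeBot

lemma coe_inv_smul_smul {g : GL (Fin 2) ℚ} {A : Matrix (Fin 2) (Fin 2) ℤ}
    (hg : (g : Matrix (Fin 2) (Fin 2) ℚ) = A.map (Int.cast : ℤ → ℚ)) (hA : 0 < A.det)
    (h : cuspConj s A 1 0 = 0) (z : ℍ) :
    (((cuspMatrix s)⁻¹ • g.map (algebraMap ℚ ℝ) • z : ℍ) : ℂ) =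
      (cuspConj s A 0 0 * (((cuspMatrix s)⁻¹ • z : ℍ) : ℂ) + cuspConj s A 0 1) /
        cuspConj s A 1 1 := by
  have e : (cuspMatrix s)⁻¹ • g.map (algebraMap ℚ ℝ) • z =
      ((Matrix.SpecialLinearGroup.mapGL ℚ (cuspMatrix s))⁻¹ * g *
        Matrix.SpecialLinearGroup.mapGL ℚ (cuspMatrix s)).map (algebraMap ℚ ℝ) •
        (cuspMatrix s)⁻¹ • z := by
    have h1 : ∀ γ : SL(2, ℤ), ∀ z : ℍ, γ • z =
        (Matrix.SpecialLinearGroup.mapGL ℚ γ).map (algebraMap ℚ ℝ) • z := fun γ z => by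
      have := sl_smul_map_smul γ 1 z
      rwa [map_one, one_smul, mul_one] at this
    rw [sl_smul_map_smul, h1 (cuspMatrix s)⁻¹ z, smul_smul, ← map_mul, map_inv,
      mul_inv_cancel_right]
  rw [e, coe_map_smul (coe_cuspConj s hg) (by rwa [det_cuspConj]), h]
  simp

lemma isTheta_sub_mul_pow {F : Filter ℍ} {t : ℍ → ℂ} (ht : Filter.Tendsto t F (nhds 0)) {n : ℕ}
    (hn : 1 < n) (a : ℂ) {b : ℂ} (hb : b ≠ 0) :
    (fun z => b * t z - a * t z ^ n) =Θ[F] t := by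
  have h1 : (fun z => a * t z ^ n) =o[F] fun z => b * t z := by
    rw [Asymptotics.isLittleO_const_mul_right_iff hb]
    refine Asymptotics.IsLittleO.const_mul_left ?_ a
    have h3 : (fun z => t z ^ (n - 1)) =o[F] fun _ => (1 : ℂ) := by
      rw [Asymptotics.isLittleO_one_iff]
      have := ht.pow (n - 1)
      rwa [zero_pow (by omega)] at this
    have h4 := h3.mul_isBigO (Asymptotics.isBigO_refl t F)
    simp only [one_mul, ← pow_succ] at h4
    rwa [Nat.sub_add_cancel hn.le] at h4
  have h2 : (fun z => b * t z - a * t z ^ n) =Θ[F] fun z => b * t z := by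
    refine Filter.EventuallyEq.trans_isTheta (Filter.Eventually.of_forall fun z => ?_)
      h1.neg_left.right_isTheta_add.symm
    simp only [Pi.add_apply]
    ring
  exact h2.trans ((Asymptotics.isTheta_const_mul_left hb).2 (Asymptotics.isTheta_refl _ _))

lemma qParam_add (h : ℝ) (x y : ℂ) : Function.Periodic.qParam h (x + y) =
    Function.Periodic.qParam h x * Function.Periodic.qParam h y := by
  rw [Function.Periodic.qParam, Function.Periodic.qParam, Function.Periodic.qParam,
    ← Complex.exp_add]
  ring_nf

lemma qParam_nat_mul (h : ℝ) (n : ℕ) (x : ℂ) : Function.Periodic.qParam h (n * x) =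
    Function.Periodic.qParam h x ^ n := by
  rw [Function.Periodic.qParam, Function.Periodic.qParam, ← Complex.exp_nat_mul]
  ring_nf

lemma qParam_mul_width (h : ℝ) {n : ℕ} (hn : n ≠ 0) (x : ℂ) :
    Function.Periodic.qParam (n * h) (n * x) = Function.Periodic.qParam h x := by
  have hnC : (n : ℂ) ≠ 0 := by exact_mod_cast hn
  rw [Function.Periodic.qParam, Function.Periodic.qParam]
  push_cast
  congr 1
  rw [mul_left_comm, mul_div_mul_left _ _ hnC]

/-- The type of the matrix decides whether X₀(Nℓ) → X₀(N) is unramified or ramified of order ℓ at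
the cusp. In each case exactly one of the two projections contributes a term linear in q. -/
lemma ordAt_ratPoint (hl : ¬ l ∣ N) {δ : SL(2, ℤ)}
    (h : Matrix.SpecialLinearGroup.mapGL ℚ δ • mulMat l • ExtH.ratPoint s = ExtH.ratPoint s) :
    (ordAt (N * l) (ExtH.ratPoint s) fun z : ℍ => localCoord N (ExtH.ratPoint s) z -
      localCoord N (ExtH.ratPoint s) (δ • ((mulMat l).map (algebraMap ℚ ℝ) • z))) = 1 := by
  have hpi := Nat.prime_iff_prime_int.1 (Fact.out : l.Prime)
  set A := δ.1 * !![(l : ℤ), 0; 0, 1] with hA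
  have hcoe := coe_mapGL_mul_mulMat δ l
  have hdet : A.det = l := det_mul_diag δ l
  have hpos : 0 < A.det := hdet ▸ prime_cast_pos l
  rw [smul_smul, smul_ratPoint_eq_iff hcoe, ← hA] at h
  set q := localCoord (N * l) (ExtH.ratPoint s) with hq
  have hq0 := tendsto_localCoord_ratPoint (N * l) s
  have hqne : ∀ z, q z ≠ 0 := fun z => by
    rw [hq, localCoord_ratPoint]
    exact Complex.exp_ne_zero _
  refine ordAt_eq_one hq0 (Filter.Frequently.of_forall hqne) ?_
  obtain ⟨ε, hε, hdiag⟩ := cuspConj_diag hdet h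
  have hεC : (ε : ℂ) ≠ 0 := by rcases hε with rfl | rfl <;> simp
  have hlC : (l : ℂ) ≠ 0 := NeZero.ne _
  have hcol := cuspMatrix_mul_cuspConj s A
  have hc0 := congrFun₂ hcol 0 0
  have hc1 := congrFun₂ hcol 1 0
  simp only [Matrix.mul_apply, Fin.sum_univ_two, hA] at hc0 hc1
  rw [← hA] at hc0 hc1
  simp only [Matrix.of_apply, Matrix.cons_val_zero, Matrix.cons_val_one, mul_zero, add_zero,
    zero_add, mul_one] at hc0 hc1
  have hδdet := δ.det_coe
  rw [Matrix.det_fin_two] at hδdet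
  have hf : ∀ z : ℍ, localCoord N (ExtH.ratPoint s) (δ • ((mulMat l).map (algebraMap ℚ ℝ) • z)) =
      Function.Periodic.qParam (cuspWidth N s) ((cuspConj s A 0 0 *
        (((cuspMatrix s)⁻¹ • z : ℍ) : ℂ) + cuspConj s A 0 1) / cuspConj s A 1 1) := fun z => by
    rw [localCoord_ratPoint, sl_smul_map_smul, coe_inv_smul_smul hcoe hpos h]
  rcases hdiag with ⟨h1, e0, e1⟩ | ⟨h1, e0, e1⟩
  -- `A` maps the first column (a, c) of the cusp matrix to δ(ℓa, c) and also to a multiple of ℓ, so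
  -- ℓ ∣ c. The widths at levels N and Nℓ agree, and the difference is q - const · q^ℓ.
  · have hlc : (l : ℤ) ∣ cuspMatrix s 1 0 := by
      have : cuspMatrix s 1 0 = δ 0 0 * (cuspMatrix s 1 0 * cuspConj s A 0 0) -
          δ 1 0 * (cuspMatrix s 0 0 * cuspConj s A 0 0) := by
        linear_combination δ 1 0 * hc0 - δ 0 0 * hc1 - cuspMatrix s 1 0 * hδdet +
          (δ 0 0 * cuspMatrix s 1 1 - δ 1 0 * cuspMatrix s 0 1) * h
      rw [this]
      exact dvd_sub ((h1.mul_left _).mul_left _) ((h1.mul_left _).mul_left _)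
    have hw := cuspWidth_mul_of_dvd hl hlc
    have hN : ∀ z, localCoord N (ExtH.ratPoint s) z = q z := fun z => by
      rw [hq, localCoord_ratPoint, localCoord_ratPoint, hw]
    refine Filter.EventuallyEq.trans_isTheta (Filter.Eventually.of_forall fun z => ?_)
      (isTheta_sub_mul_pow hq0 (Fact.out : l.Prime).one_lt
      (Function.Periodic.qParam (cuspWidth N s) (cuspConj s A 0 1 / ε)) one_ne_zero)
    simp only []
    rw [hf, ← hq, e0, e1, hN, one_mul]
    have : (((ε * l : ℤ) : ℂ) * (((cuspMatrix s)⁻¹ • z : ℍ) : ℂ) + cuspConj s A 0 1) / ε =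
        cuspConj s A 0 1 / ε + l * (((cuspMatrix s)⁻¹ • z : ℍ) : ℂ) := by
      push_cast
      field_simp
      ring
    rw [this, qParam_add, qParam_nat_mul, ← localCoord_ratPoint, hN]
  -- Here `A` maps (a, c) to ±(a, c), so ℓ ∣ c would force ℓ ∣ a as well. The width grows by the
  -- factor ℓ, and the difference is q^ℓ - const · q.
  · have hlc : ¬ (l : ℤ) ∣ cuspMatrix s 1 0 := by
      intro hlc
      obtain ⟨c, hc⟩ := hlc
      have hla : (l : ℤ) ∣ cuspMatrix s 0 0 := by
        rw [e0] at hc0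
        have h2 : ε * ε = 1 := by rcases hε with rfl | rfl <;> rfl
        refine ⟨ε * (δ 0 0 * cuspMatrix s 0 0 + δ 0 1 * c), ?_⟩
        rw [hc] at hc0
        linear_combination ε * hc0 - cuspMatrix s 0 0 * h2 - ε * cuspMatrix s 0 1 * h
      have hdet' := cuspMatrix_det s
      refine hpi.not_isUnit (isUnit_of_dvd_one ?_)
      rw [← hdet', hc]
      exact dvd_sub (hla.mul_right _) ((dvd_mul_right _ _).mul_left _)
    have hw := cuspWidth_mul_of_not_dvd hl hlc
    have hq' : ∀ z, q z = Function.Periodic.qParam (cuspWidth N s)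
        ((((cuspMatrix s)⁻¹ • z : ℍ) : ℂ) / l) := fun z => by
      rw [hq, localCoord_ratPoint, hw, ← qParam_mul_width (cuspWidth N s) (NeZero.ne l),
        mul_div_cancel₀ _ hlC]
      push_cast
      rfl
    have hN : ∀ z, localCoord N (ExtH.ratPoint s) z = q z ^ l := fun z => by
      rw [hq', localCoord_ratPoint, ← qParam_nat_mul, mul_div_cancel₀ _ hlC]
    have hb : -Function.Periodic.qParam (cuspWidth N s) (cuspConj s A 0 1 / (ε * l)) ≠ 0 :=
      neg_ne_zero.2 (Complex.exp_ne_zero _)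
    refine Filter.EventuallyEq.trans_isTheta (Filter.Eventually.of_forall fun z => ?_)
      (isTheta_sub_mul_pow hq0 (Fact.out : l.Prime).one_lt (-1) hb)
    simp only []
    rw [hf, ← hq, e0, e1, hN]
    have : ((ε : ℂ) * (((cuspMatrix s)⁻¹ • z : ℍ) : ℂ) + cuspConj s A 0 1) / ((ε * l : ℤ) : ℂ) =
        cuspConj s A 0 1 / (ε * l) + (((cuspMatrix s)⁻¹ • z : ℍ) : ℂ) / l := by
      push_cast
      field_simp
      ring
    rw [this, qParam_add, ← hq']
    ring

lemma branchIndex_eq_one (hl : ¬ l ∣ N) {P : X0 (N * l)} (h : proj₁ N l P = proj₂ N l P) :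
    branchIndex N l P = 1 := by
  have h' := h
  rw [← P.mk_rep, proj₁_mk, proj₂_mk, eq_comm, X0.mk_eq_mk] at h'
  obtain ⟨g, ⟨δ, hδ, rfl⟩, hg⟩ := h'
  rw [branchIndex]
  have key : ∀ x : ExtH, ∀ δ : SL(2, ℤ), δ ∈ CongruenceSubgroup.Gamma0 N →
      Matrix.SpecialLinearGroup.mapGL ℚ δ • mulMat l • x = x →
      (ordAt (N * l) x fun z : ℍ => localCoord N x z -
        localCoord N x (δ • ((mulMat l).map (algebraMap ℚ ℝ) • z))) = 1 := by
    rintro (τ | s) δ hδ hx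
    · exact ordAt_point hl hδ hx
    · exact ordAt_ratPoint hl hx
  -- Every admissible δ contributes 1, so the supremum in the definition does not depend on a
  -- choice.
  refine le_antisymm (iSup_le fun δ => iSup₂_le fun hδ hx => (key _ δ hδ hx).le) ?_
  exact le_iSup_of_le δ (le_iSup₂_of_le hδ hg (key _ δ hδ hg).ge)

lemma branchIndex_eq_zero {N l : ℕ} [NeZero l] {P : X0 (N * l)} (h : proj₁ N l P ≠ proj₂ N l P) :
    branchIndex N l P = 0 := by
  rw [branchIndex, ← bot_eq_zero, eq_bot_iff]
  refine iSup_le fun δ => iSup₂_le fun hδ hx => absurd ?_ h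
  rw [← P.mk_rep, proj₁_mk, proj₂_mk, eq_comm, X0.mk_eq_mk]
  exact ⟨_, mapGL_mem_gamma0Q.2 hδ, hx⟩

lemma fixSet_finite (hl : ¬ l ∣ N) (x : X0 N) : (fixSet N l x).Finite := by
  obtain ⟨x | s, rfl⟩ := Quotient.exists_rep x
  · exact fixSet_pt_finite hl x
  · exact fixSet_cusp_finite hl s

lemma fixMult_eq (hl : ¬ l ∣ N) (x : X0 N) : fixMult N l x = (fixSet N l x).ncard := by
  classical
  have h : ∀ P : X0 (N * l), (∑ᶠ (_ : proj₁ N l P = x), branchIndex N l P) =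
      ∑ᶠ (_ : P ∈ fixSet N l x), (1 : ℕ∞) := fun P => by
    by_cases h1 : proj₁ N l P = x
    · rw [finsum_eq_if, if_pos h1]
      by_cases h2 : proj₂ N l P = x
      · rw [branchIndex_eq_one hl (h1.trans h2.symm), finsum_eq_if, if_pos ⟨h1, h2⟩]
      · rw [branchIndex_eq_zero (fun h => h2 (h ▸ h1)), finsum_eq_if, if_neg fun h => h2 h.2]
    · rw [finsum_eq_if, if_neg h1, finsum_eq_if, if_neg fun h => h1 h.1]
  rw [fixMult, finsum_congr h, finsum_mem_eq_finite_toFinset_sum _ (fixSet_finite hl x),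
    Finset.sum_const, nsmul_one, Set.ncard_eq_toFinset_card _ (fixSet_finite hl x)]

end Branch

/-! ### Dependence of the order on the representative -/

lemma HasEigen.conj_sl {A : Matrix (Fin 2) (Fin 2) ℤ} {τ : ℍ} {α : ℂ} (h : HasEigen A τ α)
    (γ : SL(2, ℤ)) : HasEigen (γ.1 * A * γ.1.adjugate) (γ • τ) α := by
  set j : ℂ := γ 1 0 * τ + γ 1 1 with hj
  have hj0 : j ≠ 0 := denom_ne_zero' (A := γ.1) (by rw [γ.2]; exact one_ne_zero) τ
  have hv : (γ.1.map (Int.cast : ℤ → ℂ)).mulVec (tauVec τ) = j • tauVec (γ • τ) := by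
    ext i
    fin_cases i
    · simp only [tauVec, Matrix.mulVec, dotProduct, Fin.sum_univ_two, Pi.smul_apply, coe_sl_smul]
      simp [mul_div_cancel₀ _ hj0, ← hj]
    · simp [tauVec, Matrix.mulVec, dotProduct, Fin.sum_univ_two, hj]
  have hmap : ∀ P Q : Matrix (Fin 2) (Fin 2) ℤ, (P * Q).map (Int.cast : ℤ → ℂ) =
    P.map Int.cast * Q.map Int.cast := fun P Q => Matrix.map_mul (f := Int.castRingHom ℂ)
  have h1 : γ.1 * A * γ.1.adjugate * γ.1 = γ.1 * A := by
    rw [Matrix.mul_assoc, Matrix.adjugate_mul, γ.2, one_smul, Matrix.mul_one]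
  have h' : (A.map (Int.cast : ℤ → ℂ)).mulVec (tauVec τ) = α • tauVec τ := h
  have h2 : j • ((γ.1 * A * γ.1.adjugate).map (Int.cast : ℤ → ℂ)).mulVec (tauVec (γ • τ)) =
      j • (α • tauVec (γ • τ)) := by
    rw [← Matrix.mulVec_smul, ← hv, Matrix.mulVec_mulVec, ← hmap, h1, hmap,
      ← Matrix.mulVec_mulVec, h', Matrix.mulVec_smul, hv, smul_comm]
  exact smul_right_injective _ hj0 h2

lemma pointOrder_le_smul {N : ℕ} [NeZero N] {γ : SL(2, ℤ)} (hγ : γ ∈ CongruenceSubgroup.Gamma0 N)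
    (τ : ℍ) : pointOrder N τ ≤ pointOrder N (γ • τ) := by
  intro α hα
  obtain ⟨A, hA, h⟩ := mem_pointOrder_iff.1 hα
  refine mem_pointOrder_iff.2 ⟨_, ?_, h.conj_sl γ⟩
  have hN := mem_gamma0_iff_dvd.1 hγ
  rw [Matrix.adjugate_fin_two]
  simp only [Matrix.mul_apply, Fin.sum_univ_two, Matrix.of_apply, Matrix.cons_val_zero,
    Matrix.cons_val_one]
  exact dvd_add (Dvd.dvd.mul_right (dvd_add (hN.mul_right _) (hA.mul_left _)) _)
    (Dvd.dvd.mul_left hN.neg_right _)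

lemma pointOrder_smul {N : ℕ} [NeZero N] {γ : SL(2, ℤ)} (hγ : γ ∈ CongruenceSubgroup.Gamma0 N)
    (τ : ℍ) : pointOrder N (γ • τ) = pointOrder N τ := by
  refine le_antisymm ?_ (pointOrder_le_smul hγ τ)
  have := pointOrder_le_smul (inv_mem hγ) (γ • τ)
  rwa [inv_smul_smul] at this

lemma mapGL_smul_point (γ : SL(2, ℤ)) (τ : ℍ) :
    Matrix.SpecialLinearGroup.mapGL ℚ γ • ExtH.point τ = ExtH.point (γ • τ) := by
  have := sl_smul_map_smul γ 1 τ
  rw [map_one, one_smul, mul_one] at this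
  rw [this, smul_point]

lemma pointOrder_eq_of_pt_eq {N : ℕ} [NeZero N] {τ τ' : ℍ} (h : X0.pt N τ = X0.pt N τ') :
    pointOrder N τ = pointOrder N τ' := by
  obtain ⟨g, ⟨γ, hγ, rfl⟩, hg⟩ := X0.mk_eq_mk.1 h
  have h1 : ExtH.point (γ • τ) = ExtH.point τ' := (mapGL_smul_point γ τ).symm.trans hg
  rw [← ExtH.point_injective h1, pointOrder_smul hγ]

lemma pt_ne_cusp {N : ℕ} (τ : ℍ) (s : OnePoint ℚ) : X0.pt N τ ≠ X0.cusp N s := by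
  intro h
  obtain ⟨g, -, hg⟩ := X0.mk_eq_mk.1 h
  exact Sum.inl_ne_inr hg

/-! ### Finiteness of the support -/

/-- Γ₀(N) has finite index. The inverse turns left cosets into Γ₀(N)-orbits of translates. -/
lemma finite_translates (N : ℕ) [NeZero N] (y : ExtH) :
    (Set.range fun γ : SL(2, ℤ) =>
      X0.mk N (Matrix.SpecialLinearGroup.mapGL ℚ γ⁻¹ • y)).Finite := by
  have : Finite (SL(2, ℤ) ⧸ CongruenceSubgroup.Gamma0 N) := inferInstance
  let f : SL(2, ℤ) ⧸ CongruenceSubgroup.Gamma0 N → X0 N :=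
    Quotient.lift (fun γ : SL(2, ℤ) => X0.mk N (Matrix.SpecialLinearGroup.mapGL ℚ γ⁻¹ • y))
      (fun a b hab => by
        rw [← Quotient.eq_iff_equiv] at hab
        have h : a⁻¹ * b ∈ CongruenceSubgroup.Gamma0 N := QuotientGroup.eq.1 hab
        refine X0.mk_eq_mk.2 ⟨_, mapGL_mem_gamma0Q.2 (inv_mem h), ?_⟩
        rw [smul_smul, ← map_mul, mul_inv_rev, inv_inv, mul_inv_cancel_right])
  refine (Set.finite_range f).subset ?_
  rintro _ ⟨γ, rfl⟩
  exact ⟨QuotientGroup.mk γ, rfl⟩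

lemma finite_range_cusp (N : ℕ) [NeZero N] : (Set.range (X0.cusp N)).Finite := by
  refine (finite_translates N (ExtH.ratPoint ∞)).subset ?_
  rintro _ ⟨s, rfl⟩
  refine ⟨(cuspMatrix s)⁻¹, ?_⟩
  simp only [inv_inv]
  rw [smul_ratPoint, cuspMatrix_spec]
  rfl

lemma finite_isRoot_quadratic (t n : ℤ) : {x : ℂ | x ^ 2 - t * x + n = 0}.Finite := by
  let p : Polynomial ℂ := Polynomial.X ^ 2 - Polynomial.C (t : ℂ) * Polynomial.X +
    Polynomial.C (n : ℂ)
  have hp : p ≠ 0 := by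
    intro h
    have h1 := congrArg (Polynomial.eval 1) h
    have h2 := congrArg (Polynomial.eval (-1)) h
    have h0 := congrArg (Polynomial.eval 0) h
    simp [p] at h0 h1 h2
    rw [h0] at h1 h2
    have : (2 : ℂ) = 0 := by linear_combination h1 + h2
    norm_num at this
  refine (Polynomial.finite_setOfPred_isRoot hp).subset fun x hx => ?_
  change p.eval x = 0
  simpa [p] using hx

/-- Write α = cτ + d and e = Re α. In the fundamental domain 4 (Im τ)² ≥ 3 and |Re τ| ≤ 1/2, so ℓ =
e² + c² (Im τ)² bounds c, d and the trace. These leave finitely many α, and τ = (α - d)/c. -/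
lemma finite_fd_cm (l : ℕ) [Fact l.Prime] :
    {τ : ℍ | τ ∈ ModularGroup.fd ∧ ∃ α ∈ pointOrder 1 τ, Complex.normSq α = l}.Finite := by
  let I : Set ℤ := Set.Icc (-(2 * l : ℤ)) (2 * l)
  have hI : I.Finite := Set.finite_Icc _ _
  let R : Set ℂ := ⋃ t ∈ I, {x : ℂ | x ^ 2 - t * x + (l : ℤ) = 0}
  have hR : R.Finite := hI.biUnion fun t _ => finite_isRoot_quadratic t l
  refine Set.Finite.of_finite_image (f := UpperHalfPlane.coe)
    (((hR.prod (hI.prod hI)).image fun x : ℂ × ℤ × ℤ => (x.1 - x.2.2) / x.2.1).subset ?_)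
    UpperHalfPlane.coe_injective.injOn
  rintro _ ⟨τ, ⟨hτ, α, hα, hn⟩, rfl⟩
  obtain ⟨A, -, he⟩ := mem_pointOrder_iff.1 hα
  obtain ⟨t, ht⟩ := exists_add_conj_eq hα
  have h1 := (hasEigen_iff.1 he).2
  have hc0 : A 1 0 ≠ 0 := by
    intro h0
    rw [h0, Int.cast_zero, zero_mul, zero_add] at h1
    exact not_isInt_of_normSq_eq hn _ h1.symm
  have hc0' : (A 1 0 : ℂ) ≠ 0 := by exact_mod_cast hc0
  have hl1 : (1 : ℝ) ≤ l := by exact_mod_cast (Fact.out : l.Prime).one_lt.le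
  set e : ℝ := A 1 0 * τ.re + A 1 1 with hedef
  have hre : α.re = e := by rw [← h1]; simp [hedef]
  have him : α.im = A 1 0 * τ.im := by rw [← h1]; simp
  rw [Complex.normSq_apply, hre, him] at hn
  have h3 := ModularGroup.three_le_four_mul_im_sq_of_mem_fd hτ
  have hre2 : |τ.re| ≤ 1 / 2 := hτ.2
  have hcsq : (A 1 0 : ℝ) ^ 2 ≤ 2 * l := by
    nlinarith [sq_nonneg e, mul_nonneg (sq_nonneg (A 1 0 : ℝ)) (sub_nonneg.2 h3)]
  have hc : |(A 1 0 : ℝ)| ≤ 2 * l := by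
    have h1 : (1 : ℝ) ≤ |(A 1 0 : ℝ)| := by exact_mod_cast Int.one_le_abs hc0
    rw [← sq_abs] at hcsq
    nlinarith
  have hesq : e ^ 2 ≤ l := by nlinarith [sq_nonneg (A 1 0 * τ.im : ℝ)]
  have hel : |e| ≤ l := by
    refine abs_le_of_sq_le_sq ?_ (by linarith)
    nlinarith
  have hd : |(A 1 1 : ℝ)| ≤ 2 * l := by
    have : (A 1 1 : ℝ) = e - A 1 0 * τ.re := by rw [hedef]; ring
    rw [this]
    refine (abs_sub _ _).trans ?_
    rw [abs_mul]
    nlinarith [abs_nonneg (A 1 0 : ℝ), abs_nonneg τ.re]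
  have htl : |(t : ℝ)| ≤ 2 * l := by
    have : (t : ℝ) = 2 * e := by
      rw [Complex.add_conj, hre] at ht
      exact_mod_cast ht.symm
    rw [this, abs_mul, abs_two]
    linarith
  have hmem : ∀ k : ℤ, |(k : ℝ)| ≤ 2 * l → k ∈ I := fun k hk => by
    have : |k| ≤ 2 * (l : ℤ) := by exact_mod_cast hk
    exact abs_le.1 this
  refine ⟨(α, A 1 0, A 1 1), ⟨?_, hmem _ hc, hmem _ hd⟩, ?_⟩
  · refine Set.mem_biUnion (hmem t htl) ?_
    have hm : α * (starRingEnd ℂ) α = l := mul_conj_eq (by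
      rw [Complex.normSq_apply, hre, him, hn])
    change α ^ 2 - t * α + (l : ℤ) = 0
    push_cast
    rw [← ht]
    linear_combination -hm
  · simp only
    rw [div_eq_iff hc0', ← h1]
    ring

lemma finite_support (N l : ℕ) [NeZero N] [NeZero l] [Fact l.Prime] (hl : ¬ l ∣ N) :
    {x : X0 N | (fixSet N l x).ncard ≠ 0}.Finite := by
  refine ((finite_range_cusp N).union ((finite_fd_cm l).biUnion fun τ _ =>
    finite_translates N (ExtH.point τ))).subset ?_
  rintro x hx
  obtain ⟨τ | s, rfl⟩ := Quotient.exists_rep x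
  · right
    obtain ⟨α, hα, hn⟩ := (fixSet_pt_ncard_ne_zero (τ := τ) hl).1 hx
    obtain ⟨g, hg⟩ := ModularGroup.exists_smul_mem_fd τ
    have hα' : α ∈ pointOrder 1 (g • τ) := by
      refine pointOrder_le_smul (mem_gamma0_iff_dvd.2 (by simp)) τ ?_
      rw [pointOrder_one]
      exact hα.1
    refine Set.mem_biUnion (x := g • τ) ⟨hg, α, hα', hn⟩ ⟨g, ?_⟩
    simp only
    rw [mapGL_smul_point, inv_smul_smul]
    rfl
  · exact .inl ⟨s, rfl⟩

/-! ### Discriminants -/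

section Discr

variable {N : ℕ} [NeZero N] {τ : ℍ} {ω : ℂ}

/-- A non-real generator of the order gives a basis. -/
lemma exists_basis {N : ℕ} {τ : ℍ} {ω : ℂ} (hω : ω ∈ pointOrder N τ) (him : ω.im ≠ 0)
    (hgen : ∀ α ∈ pointOrder N τ, ∃ m n : ℤ, α = m + n * ω) :
    ∃ b : Module.Basis (Fin 2) ℤ (pointOrder N τ), b 0 = 1 ∧ b 1 = ⟨ω, hω⟩ := by
  have hli : LinearIndependent ℤ ![(1 : pointOrder N τ), ⟨ω, hω⟩] := by
    rw [LinearIndependent.pair_iff]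
    intro m n h
    have h1 := congrArg Subtype.val h
    simp only [zsmul_eq_mul] at h1
    push_cast at h1
    have h2 := congrArg Complex.im h1
    have h3 := congrArg Complex.re h1
    simp [him] at h2
    subst h2
    simpa using h3
  suffices hsp : ⊤ ≤ Submodule.span ℤ (Set.range ![(1 : pointOrder N τ), ⟨ω, hω⟩]) from
    ⟨Module.Basis.mk hli hsp, by rw [Module.Basis.mk_apply]; rfl,
      by rw [Module.Basis.mk_apply]; rfl⟩
  rintro ⟨α, hα⟩ -
  obtain ⟨m, n, rfl⟩ := hgen α hα
  have : (⟨m + n * ω, hα⟩ : pointOrder N τ) = m • (1 : pointOrder N τ) + n • ⟨ω, hω⟩ := by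
    refine Subtype.ext ?_
    simp only [zsmul_eq_mul]
    push_cast
    ring
  rw [this]
  refine add_mem (Submodule.smul_mem _ _ (Submodule.subset_span ⟨0, rfl⟩))
    (Submodule.smul_mem _ _ (Submodule.subset_span ⟨1, rfl⟩))

lemma trace_eq {R : Type*} [CommRing R] (b : Module.Basis (Fin 2) ℤ R) (h0 : b 0 = 1) {t q : ℤ}
    (h1 : b 1 * b 1 = t • b 1 - q • b 0) (m n : ℤ) :
    Algebra.trace ℤ R (m • b 0 + n • b 1) = 2 * m + n * t := by
  rw [Algebra.trace_eq_matrix_trace b, Matrix.trace_fin_two, Algebra.leftMulMatrix_eq_repr_mul,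
    Algebra.leftMulMatrix_eq_repr_mul]
  have e0 : (m • b 0 + n • b 1) * b 0 = m • b 0 + n • b 1 := by rw [h0, mul_one]
  have e1 : (m • b 0 + n • b 1) * b 1 = (-(n * q)) • b 0 + (m + n * t) • b 1 := by
    rw [add_mul, smul_mul_assoc, smul_mul_assoc, h1, h0, one_mul, smul_sub, smul_smul, smul_smul,
      add_smul, neg_smul]
    abel
  rw [e0, e1]
  simp only [map_add, map_smul, Module.Basis.repr_self, Finsupp.add_apply, Finsupp.smul_apply,
    Finsupp.single_apply]
  simp
  ring

lemma discr_eq {R : Type*} [CommRing R] (b : Module.Basis (Fin 2) ℤ R) (h0 : b 0 = 1) {t q : ℤ}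
    (h1 : b 1 * b 1 = t • b 1 - q • b 0) : Algebra.discr ℤ b = t ^ 2 - 4 * q := by
  rw [Algebra.discr_def, Matrix.det_fin_two]
  simp only [Algebra.traceMatrix_apply, Algebra.traceForm_apply]
  have e00 : b 0 * b 0 = (1 : ℤ) • b 0 + (0 : ℤ) • b 1 := by rw [h0]; simp
  have e01 : b 0 * b 1 = (0 : ℤ) • b 0 + (1 : ℤ) • b 1 := by rw [h0]; simp
  have e10 : b 1 * b 0 = (0 : ℤ) • b 0 + (1 : ℤ) • b 1 := by rw [h0]; simp
  have e11 : b 1 * b 1 = (-q) • b 0 + t • b 1 := by rw [h1, neg_smul]; abel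
  rw [e00, e01, e10, e11]
  simp only [trace_eq b h0 h1]
  ring

/-- The discriminant over ℤ does not depend on the basis, so it may be computed in the basis 1, ω.
-/
lemma hasDiscr_iff {N : ℕ} {τ : ℍ} {ω : ℂ} (hω : ω ∈ pointOrder N τ) (him : ω.im ≠ 0)
    (hgen : ∀ α ∈ pointOrder N τ, ∃ m n : ℤ, α = m + n * ω) {t q : ℤ}
    (ht : ω + (starRingEnd ℂ) ω = t) (hq : Complex.normSq ω = q) (D : ℤ) :
    HasDiscr (pointOrder N τ) D ↔ t ^ 2 - 4 * q = D := by
  obtain ⟨b, h0, h1⟩ := exists_basis hω him hgen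
  have hq' : ω * (starRingEnd ℂ) ω = q := by rw [Complex.mul_conj, hq]; simp
  have hmul : b 1 * b 1 = t • b 1 - q • b 0 := by
    rw [h0, h1]
    refine Subtype.ext ?_
    simp only [zsmul_eq_mul]
    push_cast
    rw [← ht, ← hq']
    ring
  have hd := discr_eq b h0 hmul
  constructor
  · rintro ⟨b', hb'⟩
    rw [← hd, ← hb']
    exact Algebra.discr_eq_discr _ b b'
  · rintro rfl
    exact ⟨b, hd⟩

/-- With ω real the order is ℤ, and two integers cannot be independent. This disposes of points
without complex multiplication. -/
lemma im_ne_zero_of_hasDiscr {D : ℤ} (h : HasDiscr (pointOrder N τ) D)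
    (hω : ω ∈ pointOrder N τ) (hgen : ∀ α ∈ pointOrder N τ, ∃ m n : ℤ, α = m + n * ω) :
    ω.im ≠ 0 := by
  intro him
  obtain ⟨k, hk⟩ := intCast_eq_of_im_eq_zero hω him
  obtain ⟨b, -⟩ := h
  have hint : ∀ i, ∃ m : ℤ, b i = (m : pointOrder N τ) := fun i => by
    obtain ⟨m, n, e⟩ := hgen _ (b i).2
    refine ⟨m + n * k, Subtype.ext ?_⟩
    rw [e, hk]
    push_cast
    rfl
  obtain ⟨m, hm⟩ := hint 0
  obtain ⟨n, hn⟩ := hint 1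
  have hli := b.linearIndependent
  rw [Fintype.linearIndependent_iff] at hli
  have h := hli ![n, -m] (by
    rw [Fin.sum_univ_two, hm, hn]
    simp [mul_comm])
  have hm0 : m = 0 := by simpa using h 1
  refine b.ne_zero 0 ?_
  rw [hm, hm0, Int.cast_zero]

/-! ### The case `l = 2` -/

lemma exists_normSq_add {N : ℕ} {τ : ℍ} {ω : ℂ} {t q : ℤ} (hω : ω ∈ pointOrder N τ)
    (ht : ω + (starRingEnd ℂ) ω = t) (hq : Complex.normSq ω = q) (k : ℤ)
    (hk : q + t * k + k ^ 2 = 2) : ∃ α ∈ pointOrder N τ, Complex.normSq α = (2 : ℕ) := by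
  refine ⟨ω + k, add_mem hω (intCast_mem _ _), ?_⟩
  have hq' : ω * (starRingEnd ℂ) ω = q := by rw [Complex.mul_conj, hq]; simp
  have h : ((Complex.normSq (ω + k) : ℝ) : ℂ) = ((2 : ℕ) : ℝ) := by
    have hk' : (q + t * k + k ^ 2 : ℂ) = 2 := by exact_mod_cast hk
    rw [← Complex.mul_conj, map_add, map_intCast]
    push_cast
    rw [← hk', ← ht, ← hq']
    ring
  exact_mod_cast h

lemma numPrimesAbove_two {t q : ℤ} (hω : ω ∈ pointOrder N τ)
    (hgen : ∀ α ∈ pointOrder N τ, ∃ m n : ℤ, α = m + n * ω)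
    (ht : ω + (starRingEnd ℂ) ω = t) (hq : Complex.normSq ω = q) {α : ℂ}
    (hα : α ∈ pointOrder N τ) (hn : Complex.normSq α = (2 : ℕ)) :
    ((t ^ 2 - 4 * q = -4 ∨ t ^ 2 - 4 * q = -8) ∧ numPrimesAbove (pointOrder N τ) 2 = 1) ∨
      (t ^ 2 - 4 * q = -7 ∧ numPrimesAbove (pointOrder N τ) 2 = 2) := by
  have : Fact (Nat.Prime 2) := ⟨Nat.prime_two⟩
  obtain ⟨s, hs⟩ := exists_add_conj_eq hα
  have hcard := numPrimesAbove_eq hα hn hs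
  obtain ⟨m, n, e⟩ := hgen α hα
  have hodd := not_dvd_coeff hω hn e
  have hq' : ω * (starRingEnd ℂ) ω = q := by rw [Complex.mul_conj, hq]; simp
  have hαα := mul_conj_eq hn
  -- Both sides are (α - ᾱ)². As D is negative, and 0 or 1 modulo 4, and n is odd, only n² = 1
  -- survives, with D = -8, -7, -4 for s = 0, ±1, ±2.
  have hdisc : s ^ 2 - 8 = n ^ 2 * (t ^ 2 - 4 * q) := by
    have : ((s ^ 2 - 8 : ℤ) : ℂ) = (n ^ 2 * (t ^ 2 - 4 * q) : ℤ) := by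
      push_cast
      rw [← hs, ← ht, ← hq']
      have e8 : (8 : ℂ) = 4 * (α * (starRingEnd ℂ) α) := by rw [hαα]; norm_num
      rw [e8, e, map_add, map_mul, map_intCast, map_intCast]
      ring
    exact_mod_cast this
  have hneg : t ^ 2 - 4 * q ≤ 0 := by
    have h1 : (t : ℝ) = 2 * ω.re := by
      rw [Complex.add_conj] at ht
      exact_mod_cast ht.symm
    rw [Complex.normSq_apply] at hq
    have h2 : ((t ^ 2 - 4 * q : ℤ) : ℝ) ≤ 0 := by
      push_cast
      rw [h1, ← hq]
      nlinarith [sq_nonneg ω.im]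
    exact_mod_cast h2
  set D := t ^ 2 - 4 * q with hD
  have hD4 : D % 4 = 0 ∨ D % 4 = 1 := by
    have h1 : D % 4 = t ^ 2 % 4 := by omega
    have h2 : t % 4 = 0 ∨ t % 4 = 1 ∨ t % 4 = 2 ∨ t % 4 = 3 := by omega
    rcases h2 with h2 | h2 | h2 | h2 <;> simp [h1, pow_two, Int.mul_emod, h2]
  have hs2 : s ^ 2 ≤ 8 := by nlinarith [sq_nonneg n]
  have hs' : -2 ≤ s ∧ s ≤ 2 := by constructor <;> nlinarith
  have hD0 : D ≠ 0 := by
    intro h0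
    rw [h0, mul_zero] at hdisc
    obtain ⟨h1, h2⟩ := hs'
    interval_cases s <;> omega
  have hD1 : 0 ≤ -1 - D := by omega
  have hn2 : n ^ 2 ≤ 8 := by nlinarith [mul_nonneg (sq_nonneg n) hD1, sq_nonneg s]
  have hn' : -2 ≤ n ∧ n ≤ 2 := by constructor <;> nlinarith
  obtain ⟨h1, h2⟩ := hs'
  obtain ⟨h3, h4⟩ := hn'
  have hnn : n ^ 2 = 1 := by interval_cases n <;> simp at hodd ⊢
  rw [hnn, one_mul] at hdisc
  interval_cases s <;> norm_num at hcard hdisc <;> omega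

lemma fixSet_two_ncard (h2 : ¬ 2 ∣ N) (τ : ℍ) :
    (HasDiscr (pointOrder N τ) (-(4 : ℕ)) ∧ ¬ HasDiscr (pointOrder N τ) (-(8 : ℕ)) ∧
      ¬ HasDiscr (pointOrder N τ) (-(7 : ℕ)) ∧ (fixSet N 2 (X0.pt N τ)).ncard = 1) ∨
    (¬ HasDiscr (pointOrder N τ) (-(4 : ℕ)) ∧ HasDiscr (pointOrder N τ) (-(8 : ℕ)) ∧
      ¬ HasDiscr (pointOrder N τ) (-(7 : ℕ)) ∧ (fixSet N 2 (X0.pt N τ)).ncard = 1) ∨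
    (¬ HasDiscr (pointOrder N τ) (-(4 : ℕ)) ∧ ¬ HasDiscr (pointOrder N τ) (-(8 : ℕ)) ∧
      HasDiscr (pointOrder N τ) (-(7 : ℕ)) ∧ (fixSet N 2 (X0.pt N τ)).ncard = 2) ∨
    (¬ HasDiscr (pointOrder N τ) (-(4 : ℕ)) ∧ ¬ HasDiscr (pointOrder N τ) (-(8 : ℕ)) ∧
      ¬ HasDiscr (pointOrder N τ) (-(7 : ℕ)) ∧ (fixSet N 2 (X0.pt N τ)).ncard = 0) := by
  have : Fact (Nat.Prime 2) := ⟨Nat.prime_two⟩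
  obtain ⟨ω, hω, hgen⟩ := exists_generator N τ
  obtain ⟨t, ht⟩ := exists_add_conj_eq hω
  obtain ⟨q, hq⟩ := exists_normSq_eq hω
  by_cases him : ω.im = 0
  · have hno : ∀ D, ¬ HasDiscr (pointOrder N τ) D := fun D h =>
      im_ne_zero_of_hasDiscr h hω hgen him
    refine .inr (.inr (.inr ⟨hno _, hno _, hno _, ?_⟩))
    by_contra hne
    obtain ⟨α, hα, hn⟩ := (fixSet_pt_ncard_ne_zero h2).1 hne
    obtain ⟨m, n, e⟩ := hgen α hα
    obtain ⟨k, hk⟩ := intCast_eq_of_im_eq_zero hω him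
    refine not_isInt_of_normSq_eq hn (m + n * k) ?_
    rw [e, hk]
    push_cast
    rfl
  · simp only [hasDiscr_iff hω him hgen ht hq]
    by_cases hex : ∃ α ∈ pointOrder N τ, Complex.normSq α = (2 : ℕ)
    · obtain ⟨α, hα, hn⟩ := hex
      rw [fixSet_pt_ncard h2 hα hn]
      have := numPrimesAbove_two hω hgen ht hq hα hn
      push_cast
      omega
    · have h0 : (fixSet N 2 (X0.pt N τ)).ncard = 0 := by
        by_contra hne
        exact hex ((fixSet_pt_ncard_ne_zero h2).1 hne)
      -- The elements ω + k have norm q + tk + k². If t = 2r, discriminant -4 would give norm 2 at k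
      -- = 1 - r and -8 at k = -r; if t = 2r + 1, discriminant -7 would give it at k = -r.
      have hodd : ∀ k, q + t * k + k ^ 2 ≠ 2 := fun k hk =>
        hex (exists_normSq_add hω ht hq k hk)
      obtain ⟨r, hr | hr⟩ := Int.even_or_odd' t
      · have e1 := hodd (1 - r)
        have e2 := hodd (-r)
        have e3 : t ^ 2 = 4 * r ^ 2 := by rw [hr]; ring
        have e4 : q + t * (1 - r) + (1 - r) ^ 2 = q - r ^ 2 + 1 := by rw [hr]; ring
        have e5 : q + t * (-r) + (-r) ^ 2 = q - r ^ 2 := by rw [hr]; ring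
        rw [e4] at e1
        rw [e5] at e2
        rw [e3, h0]
        push_cast
        clear e3 e4 e5
        generalize r ^ 2 = R at *
        exact .inr (.inr (.inr ⟨by omega, by omega, by omega, trivial⟩))
      · have e2 := hodd (-r)
        have e3 : t ^ 2 = 4 * r ^ 2 + 4 * r + 1 := by rw [hr]; ring
        have e5 : q + t * (-r) + (-r) ^ 2 = q - r ^ 2 - r := by rw [hr]; ring
        rw [e5] at e2
        rw [e3, h0]
        push_cast
        clear e3 e5
        generalize r ^ 2 = R at *
        exact .inr (.inr (.inr ⟨by omega, by omega, by omega, trivial⟩))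

end Discr

/-! ### The divisors in the case `l = 2` -/

section Divisors

variable {N : ℕ} [NeZero N]

lemma cmDivisor_pt (d : ℕ) (τ : ℍ) [Decidable (HasDiscr (pointOrder N τ) (-(d : ℤ)))] :
    cmDivisor N d (X0.pt N τ) = if HasDiscr (pointOrder N τ) (-(d : ℤ)) then 1 else 0 := by
  have h : X0.pt N τ ∈ {x | ∃ τ' : ℍ, x = X0.pt N τ' ∧ HasDiscr (pointOrder N τ') (-(d : ℤ))} ↔
      HasDiscr (pointOrder N τ) (-(d : ℤ)) := by
    refine ⟨?_, fun h => ⟨τ, rfl, h⟩⟩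
    rintro ⟨τ', e, h⟩
    rwa [pointOrder_eq_of_pt_eq e]
  classical
  rw [cmDivisor, Set.indicator_apply]
  simp only [h, Pi.one_apply]

lemma cmDivisor_cusp (N d : ℕ) (s : OnePoint ℚ) : cmDivisor N d (X0.cusp N s) = 0 :=
  Set.indicator_of_notMem (by rintro ⟨τ, e, -⟩; exact pt_ne_cusp τ s e.symm) _

lemma cuspDivisor_pt (N : ℕ) (τ : ℍ) : cuspDivisor N (X0.pt N τ) = 0 :=
  Set.indicator_of_notMem (by rintro ⟨s, e⟩; exact pt_ne_cusp τ s e.symm) _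

lemma cuspDivisor_cusp (N : ℕ) (s : OnePoint ℚ) : cuspDivisor N (X0.cusp N s) = 1 :=
  Set.indicator_of_mem (Set.mem_range_self s) _

lemma unitaryCuspDivisor_pt (N : ℕ) (τ : ℍ) : unitaryCuspDivisor N (X0.pt N τ) = 0 :=
  Set.indicator_of_notMem (by rintro ⟨a, d, -, -, -, e⟩; exact pt_ne_cusp τ _ e) _

lemma X0.exists_eq {N : ℕ} (x : X0 N) : (∃ τ, x = X0.pt N τ) ∨ ∃ s, x = X0.cusp N s := by
  obtain ⟨x | x, rfl⟩ := Quotient.exists_rep x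
  exacts [.inl ⟨x, rfl⟩, .inr ⟨x, rfl⟩]

lemma fixSet_two_pt (h2 : ¬ 2 ∣ N) (τ : ℍ) :
    (fixSet N 2 (X0.pt N τ)).ncard = cmDivisor N 4 (X0.pt N τ) + cmDivisor N 8 (X0.pt N τ) +
      2 * cmDivisor N 7 (X0.pt N τ) := by
  classical
  simp only [cmDivisor_pt]
  rcases fixSet_two_ncard h2 τ with ⟨h4, h8, h7, h⟩ | ⟨h4, h8, h7, h⟩ | ⟨h4, h8, h7, h⟩ |
    ⟨h4, h8, h7, h⟩ <;> simp only [h4, h8, h7, h, if_true, if_false]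

lemma fixSet_cusp_div_ne_zero_iff {l : ℕ} [Fact l.Prime] (hl : ¬ l ∣ N) {a : ℤ} {d : ℕ}
    (hd : d ∣ N) (had : IsCoprime a (d : ℤ)) :
    (fixSet N l (X0.cusp N (((a : ℚ) / (d : ℚ) : ℚ) : OnePoint ℚ))).ncard ≠ 0 ↔
      l ≡ 1 [MOD Nat.gcd d (N / d)] :=
  (fixSet_cusp_ncard_ne_zero hl).trans (fixers_cusp_div_nonempty_iff hd had)

lemma fixSet_two_cusp (h2 : ¬ 2 ∣ N) (s : OnePoint ℚ) :
    (fixSet N 2 (X0.cusp N s)).ncard = 2 * unitaryCuspDivisor N (X0.cusp N s) := by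
  have : Fact (Nat.Prime 2) := ⟨Nat.prime_two⟩
  by_cases h : (fixSet N 2 (X0.cusp N s)).ncard = 0
  · rw [h, unitaryCuspDivisor, Set.indicator_of_notMem, mul_zero]
    rintro ⟨a, d, hd, had, hcop, e⟩
    rw [e] at h
    refine (fixSet_cusp_div_ne_zero_iff h2 hd had).2 ?_ h
    rw [hcop.gcd_eq_one]
    exact Nat.modEq_one
  · obtain ⟨a, d, hd, had, e⟩ := exists_cusp_eq N s
    rw [fixSet_cusp_ncard_eq_two h2 ((fixSet_cusp_ncard_ne_zero h2).1 h), unitaryCuspDivisor,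
      Set.indicator_of_mem, Pi.one_apply, mul_one]
    refine ⟨a, d, hd, had, ?_, e⟩
    rw [e] at h
    -- 2 ≡ 1 modulo g means g ∣ 1, so for ℓ = 2 the congruence is coprimality.
    have h1 := (Nat.modEq_iff_dvd' one_le_two).1 ((fixSet_cusp_div_ne_zero_iff h2 hd had).1 h).symm
    exact Nat.dvd_one.1 h1

lemma fixSet_cusp_of_squarefree {l : ℕ} [Fact l.Prime] (hl : ¬ l ∣ N) (hN : Squarefree N)
    (s : OnePoint ℚ) : (fixSet N l (X0.cusp N s)).ncard = 2 := by
  obtain ⟨a, d, hd, had, e⟩ := exists_cusp_eq N s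
  refine fixSet_cusp_ncard_eq_two hl ((fixSet_cusp_ncard_ne_zero hl).1 ?_)
  rw [e, fixSet_cusp_div_ne_zero_iff hl hd had]
  rw [← Nat.mul_div_cancel' hd, Nat.squarefree_mul_iff] at hN
  rw [hN.1.gcd_eq_one]
  exact Nat.modEq_one

end Divisors

end

end ModularHecke

open ModularHecke

theorem mainTheorem7 (N l : ℕ) [NeZero N] [Fact l.Prime] (hl : ¬ l ∣ N) :
    -- every branch of the graph of `T_ℓ` that meets the diagonal meets it transversally
    (∀ P : X0 (N * l), proj₁ N l P = proj₂ N l P → branchIndex N l P = 1) ∧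
    -- `F` is the fixed point divisor of `T_ℓ`
    ∃ F : X0 N →₀ ℕ, (∀ x, fixMult N l x = F x) ∧
      -- the non-cuspidal points of its support
      (∀ τ : ℍ, F (X0.pt N τ) ≠ 0 ↔ ∃ α ∈ pointOrder N τ, Complex.normSq α = l) ∧
      (∀ τ : ℍ, F (X0.pt N τ) ≠ 0 →
        IsCM τ ∧
        (∃ I : Ideal (pointOrder N τ), Nonempty ((pointOrder N τ ⧸ I) ≃+* ZMod N)) ∧
        F (X0.pt N τ) = numPrimesAbove (pointOrder N τ) l ∧
        F (X0.pt N τ) = numPrimesAbove (curveOrder τ) l) ∧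
      -- the cusps
      (∀ s : OnePoint ℚ, F (X0.cusp N s) ≠ 0 → F (X0.cusp N s) = 2) ∧
      (∀ (a : ℤ) (d : ℕ), d ∣ N → IsCoprime a (d : ℤ) →
        (F (X0.cusp N (((a : ℚ) / (d : ℚ) : ℚ) : OnePoint ℚ)) ≠ 0 ↔
          l ≡ 1 [MOD Nat.gcd d (N / d)])) ∧
      (Squarefree N → ∀ s : OnePoint ℚ, F (X0.cusp N s) = 2) ∧
      -- the case `ℓ = 2`
      (l = 2 →
        (F : X0 N → ℕ) = cmDivisor N 4 + cmDivisor N 8 + 2 • cmDivisor N 7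
          + 2 • unitaryCuspDivisor N) ∧
      (l = 2 → Squarefree N →
        (F : X0 N → ℕ) = cmDivisor N 4 + cmDivisor N 8 + 2 • cmDivisor N 7
          + 2 • cuspDivisor N) := by
  -- By transversality the multiplicity is a number of branches, so the divisor is defined as that
  -- count.
  obtain ⟨F, hF⟩ : ∃ F : X0 N →₀ ℕ, (F : X0 N → ℕ) = fun x => (fixSet N l x).ncard :=
    ⟨Finsupp.ofSupportFinite _ (finite_support N l hl), rfl⟩
  refine ⟨fun P h => branchIndex_eq_one hl h, F, ?_⟩
  simp only [hF]
  refine ⟨fixMult_eq hl, fun τ => fixSet_pt_ncard_ne_zero hl, fun τ hF => ?_,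
    fun s hF => fixSet_cusp_ncard_eq_two hl ((fixSet_cusp_ncard_ne_zero hl).1 hF),
    fun a d hd had => fixSet_cusp_div_ne_zero_iff hl hd had,
    fun hN => fixSet_cusp_of_squarefree hl hN, ?_, ?_⟩
  · obtain ⟨α, hα, hn⟩ := (fixSet_pt_ncard_ne_zero hl).1 hF
    rw [numPrimesAbove_curveOrder hα hn]
    exact ⟨isCM_of_normSq_eq hα.1 hn, exists_quotient_equiv_zmod N τ,
      fixSet_pt_ncard hl hα hn, fixSet_pt_ncard hl hα hn⟩
  · rintro rfl
    funext x
    obtain ⟨τ, rfl⟩ | ⟨s, rfl⟩ := X0.exists_eq x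
    · simp [fixSet_two_pt hl, unitaryCuspDivisor_pt]
    · simp [fixSet_two_cusp hl, cmDivisor_cusp]
  · rintro rfl hN
    funext x
    obtain ⟨τ, rfl⟩ | ⟨s, rfl⟩ := X0.exists_eq x
    · simp [fixSet_two_pt hl, cuspDivisor_pt]
    · simp [fixSet_cusp_of_squarefree hl hN, cuspDivisor_cusp, cmDivisor_cusp]
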